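/- **Setting.** A finite quiver consists of finite sets $\mathbf I$ (vertices) and $\Omega$ (edges) with maps $h\mapsto h'$ (source) and $h\mapsto h''$ (target) from $\Omega$ to $\mathbf I$; loops and multiple edges are allowed. Let $a$ be an admissible automorphism of it: bijections of $\mathbf I$ and $\Omega$, compatible with source and target, such that an edge with $h'\ne h''$ never has both ends in one $a$-orbit. Let $e\in\Omega$, let $[i_+]$, $[i_-]$ be the $a$-orbits of $e'$, $e''$ and let $C$ be the $a$-orbit of $e$. Assume: $\#[i_+]=\#[i_-]=\#C$; there are no loops at vertices of $[i_+]\cup[i_-]$; if $h,l$ are edges with all ends in $[i_+]\cup[i_-]$, $h'\neq h''$ and $l'\in\{h',h''\}$, then $l''\in\{h',h''\}$. The contracted quiver has vertex set $\mathbf I\setminus[i_-]$; its edges are the edges of $\Omega$ with no end in $[i_-]$, the symbols $l h$ (from $h'$ to $l''$) with $h\in C$, $h''=l'$, and the symbols $\bar h\, l$ (from $l'$ to $h'$) with $h\in C$, $l\notin C$, $h''=l''$; it carries the automorphism induced by $a$. Let $q=p^r$ ($p$ prime, $r\ge1$), $K=\overline{\mathbb F}_p$, $v\in\mathbb C$ with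 $v^2=q$, $k=\mathbb Q(v)$. For $\nu\in\mathbb N[I]$, that is, $\nu:\mathbf I\to\mathbb N$ constant on $a$-orbits, put $V_i=K^{\nu_i}$, $E_V=\bigoplus_{h\in\Omega}\mathrm{Hom}(V_{h'},V_{h''})$, $G_V=\prod_i GL(V_i)$ acting by $(g\cdot x)_h=g_{h''}x_hg_{h'}^{-1}$. Let $F$ be the twisted Frobenius on $E_V$ and $G_V$: it raises matrix entries to the $q$-th power and permutes components by $a$, $(Fx)_{a(h)}=\mathrm{Fr}(x_h)$, $(Fg)_{a(i)}=\mathrm{Fr}(g_i)$. The Hall algebra is $H=\bigoplus_{\nu\in\mathbb N[I]}H_\nu$, where $H_\nu$ is the space of $G_V^F$-invariant functions $E_V^F\to k$. For $\nu=\tau+\omega$ and $V=T\oplus W$ accordingly, the product $H_\tau\times H_\omega\to H_\nu$ is $$f_1\circ f_2=v^{-m(\tau,\omega)}\,\frac1{\#G_T^F\,\#G_W^F}\,(p_3)_!(p_2)_!p_1^*(f_1\otimes f_2),\qquad m(\tau,\omega)=\sum_{i\in\mathbf I}\tau_i\omega_i+\sum_{h\in\Omega}\tau_{h'}\omega_{h''},$$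 where $S_W\subseteq E_V$ is the set of $x$ leaving $W$ invariant, $Q\subseteq G_V$ is the stabilizer of $W$ with unipotent radical $U$, both acting on $G_V\times S_W$ by $b\cdot(g,x)=(gb^{-1},b\cdot x)$, $E'=U\backslash(G_V\times S_W)$, $E''=Q\backslash(G_V\times S_W)$, and $$E_T^F\times E_W^F\xleftarrow{\;p_1\;}E'^F\xrightarrow{\;p_2\;}E''^F\xrightarrow{\;p_3\;}E_V^F$$ are given by $p_1[g,x]=(x^T,x^W)$ (induced maps on $V/W\cong T$ and on $W$), $p_2$ the projection, $p_3[g,x]=g\cdot x$; $\phi^*$ is composition with $\phi$, and $\phi_!$ is summation over the fibres of $\phi$. The unit is the function $1$ in $H_0$. Let $\mathbb N[\hat I]\subseteq\mathbb N[I]$ be the set of $\nu$ with $\nu_{i_+}=\nu_{i_-}$, and for such $\nu$ let $E_V^\heartsuit\subseteq E_V$ be the set of $x$ with $x_h$ an isomorphism for all $h\in C$. Put $H_{\hat I}=\bigoplus_{\nu\in\mathbb N[\hat I]}H_\nu$; let $H^\heartsuit=\bigoplus_{\nu\in\mathbb N[\hat I]}H^\heartsuit_\nu$ and $H^c=\bigoplus_{\nu\in\mathbb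 N[\hat I]}H^c_\nu$ be formed by the $G_V^F$-invariant functions on $E_V^{\heartsuit,F}$ and on $E_V^F\setminus E_V^{\heartsuit,F}$, the product of $H^\heartsuit$ being given by the same formula for the diagram above restricted to $E^\heartsuit$. Let $\hat H$ be the Hall algebra of the contracted quiver. Extension by zero gives maps $H^c\to H_{\hat I}$ and $j_!:H^\heartsuit\to H_{\hat I}$, and restriction of functions gives $j^*:H_{\hat I}\to H^\heartsuit$. Let $\mu_\nu$ map $x\in E_V^{\heartsuit}$ to the representation $\hat x$ of the contracted quiver with $\hat x_h=x_h$, $\hat x_{lh}=x_lx_h$, $\hat x_{\bar hl}=x_h^{-1}x_l$, and let $\mu^\star:\hat H\to H^\heartsuit$ be given in degree $\nu\in\mathbb N[\hat I]$ by $f\mapsto v^{-\nu_{i_-}^2\#[i_-]}\,f\circ\mu_\nu$. A homomorphism of Hall algebras is a $k$-linear multiplicative map preserving the unit. **Theorem.** $H_{\hat I}$ is a subalgebra of $H$ containing the unit, $H^c$ is a two-sided ideal of $H_{\hat I}$, and $$0\longrightarrow H^c\longrightarrow H_{\hat I}\xrightarrow{\;j^*\;}H^\heartsuit\longrightarrow0$$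 is a short exact sequence, in which $j^*$ is a homomorphism of Hall algebras, split by the homomorphism of Hall algebras $j_!$ (that is, $j^*j_!=\mathrm{id}$). Furthermore $\mu^\star$ is an isomorphism of Hall algebras, and $j_!\mu^\star$ induces an isomorphism of Hall algebras $\hat H\cong H_{\hat I}/H^c$. Thus $\hat H$ is a split subquotient of $H$: there is a surjective homomorphism of Hall algebras $\pi:H_{\hat I}\to\hat H$ with kernel $H^c$, and $j_!\mu^\star$ is a homomorphism of Hall algebras with $\pi\, j_!\mu^\star=\mathrm{id}$. -/

import Mathlib

open scoped DirectSum

noncomputable section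

namespace HallContraction

universe u w

/-! ## Quivers with an automorphism -/

/-- An oriented graph with vertex set `I` and edge set `Ω` (loops and multiple edges allowed),
together with an automorphism `a = (aV, aE)`. -/
structure AutQuiver (I : Type u) (Ω : Type w) where
  src : Ω → I
  tgt : Ω → I
  aV : Equiv.Perm I
  aE : Equiv.Perm Ω
  src_aE : ∀ h, src (aE h) = aV (src h)
  tgt_aE : ∀ h, tgt (aE h) = aV (tgt h)

/-- The algebraic closure of the prime field with `p` elements. -/
abbrev Kbar (p : ℕ) [Fact p.Prime] : Type := AlgebraicClosure (ZMod p)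

/-- The Frobenius map `z ↦ z ^ q` of `Kbar p`, where `q = p ^ r`. -/
def Fr (p r : ℕ) [Fact p.Prime] : Kbar p →+* Kbar p := iterateFrobenius (Kbar p) p r

theorem Fr_apply (p r : ℕ) [Fact p.Prime] (z : Kbar p) : Fr p r z = z ^ p ^ r :=
  iterateFrobenius_def p r z

/-! ## Matrices: change of (equal) sizes and blocks -/

section Matrices

variable {R : Type*}

/-- Regard an `m × n` matrix as an `m' × n'` matrix when `m = m'` and `n = n'`. -/
def recast {m m' n n' : ℕ} (hm : m = m') (hn : n = n') (x : Matrix (Fin m) (Fin n) R) :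
    Matrix (Fin m') (Fin n') R :=
  x.submatrix (Fin.cast hm.symm) (Fin.cast hn.symm)

@[simp] theorem recast_rfl {m n : ℕ} (hm : m = m) (hn : n = n) (x : Matrix (Fin m) (Fin n) R) :
    recast hm hn x = x := rfl

theorem recast_mul [CommRing R] {m m' n n' k k' : ℕ} (hm : m = m') (hn : n = n') (hk : k = k')
    (x : Matrix (Fin m) (Fin n) R) (y : Matrix (Fin n) (Fin k) R) :
    recast hm hk (x * y) = recast hm hn x * recast hn hk y := by
  subst hm hn hk; rfl

theorem recast_recast {m m' m'' n n' n'' : ℕ} (hm : m = m') (hn : n = n') (hm' : m' = m'')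
    (hn' : n' = n'') (x : Matrix (Fin m) (Fin n) R) :
    recast hm' hn' (recast hm hn x) = recast (hm.trans hm') (hn.trans hn') x := rfl

theorem recast_fam {α : Type*} {m n : α → ℕ} (z : ∀ j, Matrix (Fin (m j)) (Fin (n j)) R)
    {i j : α} (h : i = j) (hm : m i = m j) (hn : n i = n j) : recast hm hn (z i) = z j := by
  subst h; rfl

/-- Blocks of a matrix whose rows and columns are split as `m + m'` and `n + n'`
(the first part is the `T`-part, the second part the `W`-part). -/
def blkTT {m m' n n' : ℕ} (x : Matrix (Fin (m + m')) (Fin (n + n')) R) :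
    Matrix (Fin m) (Fin n) R := x.submatrix (Fin.castAdd m') (Fin.castAdd n')

/-- The component from the `W`-part to the `T`-part. -/
def blkTW {m m' n n' : ℕ} (x : Matrix (Fin (m + m')) (Fin (n + n')) R) :
    Matrix (Fin m) (Fin n') R := x.submatrix (Fin.castAdd m') (Fin.natAdd n)

/-- The component from the `T`-part to the `W`-part. -/
def blkWT {m m' n n' : ℕ} (x : Matrix (Fin (m + m')) (Fin (n + n')) R) :
    Matrix (Fin m') (Fin n) R := x.submatrix (Fin.natAdd m) (Fin.castAdd n')

/-- The component from the `W`-part to the `W`-part. -/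
def blkWW {m m' n n' : ℕ} (x : Matrix (Fin (m + m')) (Fin (n + n')) R) :
    Matrix (Fin m') (Fin n') R := x.submatrix (Fin.natAdd m) (Fin.natAdd n)

theorem blk_ext {m m' n n' : ℕ} {x y : Matrix (Fin (m + m')) (Fin (n + n')) R}
    (h1 : blkTT x = blkTT y) (h2 : blkTW x = blkTW y) (h3 : blkWT x = blkWT y)
    (h4 : blkWW x = blkWW y) : x = y := by
  ext i j
  refine Fin.addCases (fun i => ?_) (fun i => ?_) i <;>
    refine Fin.addCases (fun j => ?_) (fun j => ?_) j
  · exact congrFun (congrFun h1 i) j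
  · exact congrFun (congrFun h2 i) j
  · exact congrFun (congrFun h3 i) j
  · exact congrFun (congrFun h4 i) j

variable [CommRing R] {m m' n n' k k' : ℕ}
  (x : Matrix (Fin (m + m')) (Fin (n + n')) R) (y : Matrix (Fin (n + n')) (Fin (k + k')) R)

theorem blkTT_mul : blkTT (x * y) = blkTT x * blkTT y + blkTW x * blkWT y := by
  ext i j; simp [blkTT, blkTW, blkWT, Matrix.mul_apply, Fin.sum_univ_add]

theorem blkTW_mul : blkTW (x * y) = blkTT x * blkTW y + blkTW x * blkWW y := by
  ext i j; simp [blkTT, blkTW, blkWW, Matrix.mul_apply, Fin.sum_univ_add]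

theorem blkWT_mul : blkWT (x * y) = blkWT x * blkTT y + blkWW x * blkWT y := by
  ext i j; simp [blkTT, blkWW, blkWT, Matrix.mul_apply, Fin.sum_univ_add]

theorem blkWW_mul : blkWW (x * y) = blkWT x * blkTW y + blkWW x * blkWW y := by
  ext i j; simp [blkTW, blkWW, blkWT, Matrix.mul_apply, Fin.sum_univ_add]

@[simp] theorem blkTT_one : blkTT (1 : Matrix (Fin (m + m')) (Fin (m + m')) R) = 1 := by
  ext i j; simp [blkTT, Matrix.one_apply]

@[simp] theorem blkTW_one : blkTW (1 : Matrix (Fin (m + m')) (Fin (m + m')) R) = 0 := by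
  ext i j; simp [blkTW, Matrix.one_apply, Fin.ext_iff]; omega

@[simp] theorem blkWW_one : blkWW (1 : Matrix (Fin (m + m')) (Fin (m + m')) R) = 1 := by
  ext i j; simp [blkWW, Matrix.one_apply]

/-- A (rectangular) matrix that defines an isomorphism. -/
def IsIsoMat {m n : ℕ} (x : Matrix (Fin m) (Fin n) R) : Prop :=
  ∃ y : Matrix (Fin n) (Fin m) R, x * y = 1 ∧ y * x = 1

open Classical in
/-- The inverse of an isomorphism (and `0` for other matrices). -/
def isoInv {m n : ℕ} (x : Matrix (Fin m) (Fin n) R) : Matrix (Fin n) (Fin m) R :=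
  if h : IsIsoMat x then h.choose else 0

theorem isoInv_eq {m n : ℕ} {x : Matrix (Fin m) (Fin n) R} {y : Matrix (Fin n) (Fin m) R}
    (h1 : x * y = 1) (h2 : y * x = 1) : isoInv x = y := by
  have h : IsIsoMat x := ⟨y, h1, h2⟩
  rw [isoInv, dif_pos h]
  calc h.choose = h.choose * (x * y) := by rw [h1, Matrix.mul_one]
    _ = y := by rw [← Matrix.mul_assoc, h.choose_spec.2, Matrix.one_mul]

theorem IsIsoMat.mul_isoInv {m n : ℕ} {x : Matrix (Fin m) (Fin n) R} (h : IsIsoMat x) :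
    x * isoInv x = 1 ∧ isoInv x * x = 1 := by
  rw [isoInv, dif_pos h]; exact h.choose_spec

theorem isIsoMat_recast {m m' n n' : ℕ} (hm : m = m') (hn : n = n') {x : Matrix (Fin m) (Fin n) R}
    (h : IsIsoMat x) : IsIsoMat (recast hm hn x) := by
  subst hm hn; exact h

theorem isoInv_recast {m m' n n' : ℕ} (hm : m = m') (hn : n = n') (x : Matrix (Fin m) (Fin n) R) :
    isoInv (recast hm hn x) = recast hn hm (isoInv x) := by
  subst hm hn; rfl

theorem map_mul_map {S : Type*} [CommRing S] (σ : R →+* S) {m n k : ℕ}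
    (x : Matrix (Fin m) (Fin n) R) (y : Matrix (Fin n) (Fin k) R) :
    (x * y).map σ = x.map σ * y.map σ := Matrix.map_mul

theorem one_map' {S : Type*} [CommRing S] (σ : R →+* S) {m : ℕ} :
    (1 : Matrix (Fin m) (Fin m) R).map σ = 1 := Matrix.map_one _ (map_zero σ) (map_one σ)

theorem isIsoMat_map {S : Type*} [CommRing S] (σ : R →+* S) {m n : ℕ}
    {x : Matrix (Fin m) (Fin n) R} (h : IsIsoMat x) : IsIsoMat (x.map σ) := by
  obtain ⟨y, h1, h2⟩ := h
  exact ⟨y.map σ, by rw [← map_mul_map, h1, one_map'], by rw [← map_mul_map, h2, one_map']⟩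

theorem isoInv_map {S : Type*} [CommRing S] (σ : R →+* S) {m n : ℕ}
    {x : Matrix (Fin m) (Fin n) R} (h : IsIsoMat x) : isoInv (x.map σ) = (isoInv x).map σ := by
  obtain ⟨h1, h2⟩ := h.mul_isoInv
  exact isoInv_eq (by rw [← map_mul_map, h1, one_map']) (by rw [← map_mul_map, h2, one_map'])

end Matrices

/-! ## Twisted Frobenius on families of matrices -/

section Fam

variable (p r : ℕ) [Fact p.Prime] {α : Type*} (a : Equiv.Perm α) {m n : α → ℕ}

/-- Families of matrices over `Kbar p`, of sizes `m j × n j`. -/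
abbrev Fam (m n : α → ℕ) : Type _ := ∀ j, Matrix (Fin (m j)) (Fin (n j)) (Kbar p)

theorem eq_symm (hm : ∀ j, m (a j) = m j) (j : α) : m (a.symm j) = m j := by
  conv_rhs => rw [← a.apply_symm_apply j]
  exact (hm _).symm

/-- The twisted Frobenius: permute the members of the family by `a` and raise all entries to
the `q`-th power, that is, `(F z)_{a j} = Fr (z_j)`. -/
def frobFam (hm : ∀ j, m (a j) = m j) (hn : ∀ j, n (a j) = n j) (z : Fam p m n) : Fam p m n :=
  fun j => (recast (eq_symm a hm j) (eq_symm a hn j) (z (a.symm j))).map (Fr p r)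

theorem frobFam_apply (hm : ∀ j, m (a j) = m j) (hn : ∀ j, n (a j) = n j) (z : Fam p m n)
    (j : α) : frobFam p r a hm hn z (a j) =
      (recast (hm j).symm (hn j).symm (z j)).map (Fr p r) := by
  have h : a.symm (a j) = j := a.symm_apply_apply j
  rw [frobFam, ← recast_fam z h (congrArg m h) (congrArg n h)]
  rfl

theorem finite_frobFam [Finite α] [NeZero r] (hm : ∀ j, m (a j) = m j)
    (hn : ∀ j, n (a j) = n j) : Finite {z : Fam p m n // frobFam p r a hm hn z = z} := by
  classical
  have key : ∀ z : Fam p m n, frobFam p r a hm hn z = z → ∀ (k : ℕ) (j : α)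
      (s : Fin (m j)) (t : Fin (n j)) (s' : Fin (m ((a ^ k) j))) (t' : Fin (n ((a ^ k) j))),
      (s : ℕ) = s' → (t : ℕ) = t' → z ((a ^ k) j) s' t' = (z j s t) ^ (p ^ r) ^ k := by
    intro z hz k
    induction k with
    | zero =>
      intro j s t s' t' h1 h2
      have : s' = s := Fin.ext h1.symm
      have : t' = t := Fin.ext h2.symm
      subst s' t'
      change z j s t = z j s t ^ (p ^ r) ^ 0
      rw [pow_zero, pow_one]
    | succ k ih =>
      intro j s t s' t' h1 h2
      have e : (a ^ (k + 1)) j = (a ^ k) (a j) := by rw [pow_succ]; rfl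
      have h3 := ih (a j) (Fin.cast (hm j).symm s) (Fin.cast (hn j).symm t)
        (Fin.cast (congrArg m e) s') (Fin.cast (congrArg n e) t') h1 h2
      have h4 : z ((a ^ (k + 1)) j) s' t' = z ((a ^ k) (a j)) (Fin.cast (congrArg m e) s')
          (Fin.cast (congrArg n e) t') := by
        rw [← recast_fam z e (congrArg m e) (congrArg n e)]
        rfl
      have h5 : z (a j) (Fin.cast (hm j).symm s) (Fin.cast (hn j).symm t) = z j s t ^ p ^ r := by
        conv_lhs => rw [← hz, frobFam_apply]
        rw [Matrix.map_apply, Fr_apply]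
        rfl
      rw [h4, h3, h5, ← pow_mul, ← pow_succ']
  have hp : 1 < p := (Fact.out : p.Prime).one_lt
  set N := orderOf a with hN
  have hN0 : N ≠ 0 := (orderOf_pos a).ne'
  have hq : 1 < (p ^ r) ^ N := Nat.one_lt_pow hN0 (Nat.one_lt_pow (NeZero.ne r) hp)
  let P : Polynomial (Kbar p) := Polynomial.X ^ ((p ^ r) ^ N) - Polynomial.X
  have hP : P ≠ 0 := FiniteField.X_pow_card_sub_X_ne_zero _ hq
  let S : Set (Kbar p) := (P.roots.toFinset : Set _)
  have hS : S.Finite := Finset.finite_toSet _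
  have : {z : Fam p m n | frobFam p r a hm hn z = z} ⊆
      Set.pi Set.univ fun j => {x | ∀ s t, x s t ∈ S} := by
    intro z hz j _ s t
    have e : (a ^ N) j = j := by rw [hN, pow_orderOf_eq_one]; rfl
    have h := key z hz N j s t (Fin.cast (congrArg m e.symm) s) (Fin.cast (congrArg n e.symm) t)
      rfl rfl
    have h4 : z j s t = z ((a ^ N) j) (Fin.cast (congrArg m e.symm) s)
        (Fin.cast (congrArg n e.symm) t) := by
      rw [← recast_fam z e.symm (congrArg m e.symm) (congrArg n e.symm)]
      rfl
    rw [← h4] at h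
    simp only [S, P, Finset.mem_coe, Multiset.mem_toFinset, Polynomial.mem_roots hP,
      Polynomial.IsRoot, Polynomial.eval_sub, Polynomial.eval_pow, Polynomial.eval_X]
    rw [← h, sub_self]
  have hfin : ∀ j, ({x : Matrix (Fin (m j)) (Fin (n j)) (Kbar p) | ∀ s t, x s t ∈ S}).Finite :=
    fun j => Set.Finite.pi' (fun _ : Fin (m j) => Set.Finite.pi' (fun _ : Fin (n j) => hS))
  exact ((Set.Finite.pi' hfin).subset fun z hz j => this hz j trivial).to_subtype

theorem frobFam_mul {k : α → ℕ} (hm : ∀ j, m (a j) = m j) (hn : ∀ j, n (a j) = n j)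
    (hk : ∀ j, k (a j) = k j) (z : Fam p m n) (y : Fam p n k) :
    frobFam p r a hm hk (fun j => z j * y j) =
      fun j => frobFam p r a hm hn z j * frobFam p r a hn hk y j := by
  funext j
  simp only [frobFam]
  rw [recast_mul _ (eq_symm a hn j), map_mul_map]

end Fam

/-! ## Representation spaces -/

namespace AutQuiver

variable {I : Type u} {Ω : Type w} (Q : AutQuiver I Ω)

/-- `ℕ[I/a]`: dimension vectors, that is, functions on the vertices that are constant on the
orbits of the automorphism. -/
def dimVec : AddSubmonoid (I → ℕ) where
  carrier := {ν | ∀ i, ν (Q.aV i) = ν i}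
  zero_mem' := fun _ => rfl
  add_mem' := fun {ν μ} hν hμ i => by
    change ν (Q.aV i) + μ (Q.aV i) = ν i + μ i
    rw [hν i, hμ i]

/-- The type of dimension vectors. -/
abbrev DimVec : Type u := ↥Q.dimVec

variable {Q}

theorem tgt_inv (ν : Q.DimVec) (h : Ω) : ν.1 (Q.tgt (Q.aE h)) = ν.1 (Q.tgt h) := by
  rw [Q.tgt_aE, ν.2]

theorem src_inv (ν : Q.DimVec) (h : Ω) : ν.1 (Q.src (Q.aE h)) = ν.1 (Q.src h) := by
  rw [Q.src_aE, ν.2]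

theorem tgt_symm (h : Ω) : Q.tgt (Q.aE.symm h) = Q.aV.symm (Q.tgt h) := by
  rw [Equiv.eq_symm_apply, ← Q.tgt_aE, Equiv.apply_symm_apply]

theorem src_symm (h : Ω) : Q.src (Q.aE.symm h) = Q.aV.symm (Q.src h) := by
  rw [Equiv.eq_symm_apply, ← Q.src_aE, Equiv.apply_symm_apply]

variable (p r : ℕ) [Fact p.Prime]

/-- The representation space `E_V`, where `V_i = K ^ (ν i)` with its standard basis. -/
abbrev Rep (ν : Q.DimVec) : Type w :=
  Fam p (fun h : Ω => ν.1 (Q.tgt h)) (fun h : Ω => ν.1 (Q.src h))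

/-- The group `G_V`, the product of the groups `GL(V_i)`. -/
abbrev Grp (ν : Q.DimVec) : Type u := ∀ i : I, GL (Fin (ν.1 i)) (Kbar p)

variable {p}

/-- The action `(g • x)_h = g_{h''} x_h g_{h'}⁻¹`. -/
def act {ν : Q.DimVec} (g : Grp p ν) (x : Rep p ν) : Rep p ν := fun h =>
  (g (Q.tgt h)).1 * x h * (g (Q.src h))⁻¹.1

theorem act_one {ν : Q.DimVec} (x : Rep p ν) : act 1 x = x := by
  funext h
  simp [act]

theorem act_mul {ν : Q.DimVec} (g g' : Grp p ν) (x : Rep p ν) :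
    act (g * g') x = act g (act g' x) := by
  funext h
  simp only [act, Pi.mul_apply, mul_inv_rev, Units.val_mul]
  simp only [Matrix.mul_assoc]

/-- The twisted Frobenius on `E_V`. -/
def frobRep {ν : Q.DimVec} (x : Rep p ν) : Rep p ν :=
  frobFam p r Q.aE (tgt_inv ν) (src_inv ν) x

/-- The twisted Frobenius on families of square matrices indexed by the vertices. -/
def frobEnd {ν : Q.DimVec} (z : Fam p ν.1 ν.1) : Fam p ν.1 ν.1 :=
  frobFam p r Q.aV ν.2 ν.2 z

theorem frobEnd_mul {ν : Q.DimVec} (z y : Fam p ν.1 ν.1) (i : I) :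
    frobEnd r (fun i => z i * y i) i = frobEnd r z i * frobEnd r y i :=
  congrFun (frobFam_mul p r Q.aV ν.2 ν.2 ν.2 z y) i

theorem frobEnd_one {ν : Q.DimVec} :
    frobEnd r (fun _ => 1 : Fam p ν.1 ν.1) = fun _ => 1 := by
  funext i
  have h : ∀ {m n : ℕ} (e e' : m = n), recast e e' (1 : Matrix (Fin m) (Fin m) (Kbar p)) = 1 := by
    intro m n e e'; subst e; rfl
  simp only [frobEnd, frobFam]
  rw [h, one_map']

/-- The twisted Frobenius on `G_V`. -/
def frobGrp {ν : Q.DimVec} (g : Grp p ν) : Grp p ν := fun i =>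
  { val := frobEnd r (fun i => (g i).1) i
    inv := frobEnd r (fun i => (g i)⁻¹.1) i
    val_inv := by
      rw [← frobEnd_mul]; simp only [Units.mul_inv]; rw [frobEnd_one]
    inv_val := by
      rw [← frobEnd_mul]; simp only [Units.inv_mul]; rw [frobEnd_one] }

theorem frobGrp_val {ν : Q.DimVec} (g : Grp p ν) (i : I) :
    (frobGrp r g i).1 = frobEnd r (fun i => (g i).1) i := rfl

theorem frobGrp_inv_val {ν : Q.DimVec} (g : Grp p ν) (i : I) :
    (frobGrp r g i)⁻¹.1 = frobEnd r (fun i => (g i)⁻¹.1) i := rfl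

theorem frobGrp_mul {ν : Q.DimVec} (g g' : Grp p ν) :
    frobGrp r (g * g') = frobGrp r g * frobGrp r g' := by
  funext i
  apply Units.ext
  exact frobEnd_mul r (fun i => (g i).1) (fun i => (g' i).1) i

theorem frobGrp_inv {ν : Q.DimVec} (g : Grp p ν) : frobGrp r g⁻¹ = (frobGrp r g)⁻¹ := by
  funext i
  apply Units.ext
  rfl

theorem frobEnd_tgt {ν : Q.DimVec} (z : Fam p ν.1 ν.1) (h : Ω)
    (e : ν.1 (Q.tgt (Q.aE.symm h)) = ν.1 (Q.tgt h)) :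
    frobEnd r z (Q.tgt h) = (recast e e (z (Q.tgt (Q.aE.symm h)))).map (Fr p r) := by
  have h1 := recast_fam z (tgt_symm (Q := Q) h) (congrArg ν.1 (tgt_symm h)) (congrArg ν.1 (tgt_symm h))
  simp only [frobEnd, frobFam]
  rw [← h1, recast_recast]

theorem frobEnd_src {ν : Q.DimVec} (z : Fam p ν.1 ν.1) (h : Ω)
    (e : ν.1 (Q.src (Q.aE.symm h)) = ν.1 (Q.src h)) :
    frobEnd r z (Q.src h) = (recast e e (z (Q.src (Q.aE.symm h)))).map (Fr p r) := by
  have h1 := recast_fam z (src_symm (Q := Q) h) (congrArg ν.1 (src_symm h)) (congrArg ν.1 (src_symm h))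
  simp only [frobEnd, frobFam]
  rw [← h1, recast_recast]

theorem frobRep_act {ν : Q.DimVec} (g : Grp p ν) (x : Rep p ν) :
    frobRep r (act g x) = act (frobGrp r g) (frobRep r x) := by
  funext h
  have e1 := eq_symm Q.aE (m := fun h => ν.1 (Q.tgt h)) (tgt_inv ν) h
  have e2 := eq_symm Q.aE (m := fun h => ν.1 (Q.src h)) (src_inv ν) h
  simp only [act, frobGrp_val, frobGrp_inv_val]
  rw [frobEnd_tgt r _ h e1, frobEnd_src r _ h e2]
  simp only [frobRep, frobFam, act]
  rw [recast_mul e1 e2 e2, recast_mul e1 e1 e2, map_mul_map, map_mul_map]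

/-! ## The decomposition `V = T ⊕ W` and the subgroups `Q` and `U` -/

variable {τ ω : Q.DimVec}

/-- `x` maps `W` into itself. -/
def Stab (x : Rep p (τ + ω)) : Prop :=
  ∀ h, blkTW (m := τ.1 (Q.tgt h)) (m' := ω.1 (Q.tgt h)) (n := τ.1 (Q.src h))
    (n' := ω.1 (Q.src h)) (x h) = 0

/-- The representation induced on the quotient `T` of `V` by `W`. -/
def quotRep (x : Rep p (τ + ω)) : Rep p τ := fun h =>
  blkTT (m := τ.1 (Q.tgt h)) (m' := ω.1 (Q.tgt h)) (n := τ.1 (Q.src h)) (n' := ω.1 (Q.src h)) (x h)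

/-- The representation induced on the subspace `W`. -/
def subRep (x : Rep p (τ + ω)) : Rep p ω := fun h =>
  blkWW (m := τ.1 (Q.tgt h)) (m' := ω.1 (Q.tgt h)) (n := τ.1 (Q.src h)) (n' := ω.1 (Q.src h)) (x h)

/-- The blocks of the `i`-th component of an element of `G_V`. -/
def gTT (g : Grp p (τ + ω)) (i : I) : Matrix (Fin (τ.1 i)) (Fin (τ.1 i)) (Kbar p) :=
  blkTT (m := τ.1 i) (m' := ω.1 i) (n := τ.1 i) (n' := ω.1 i) (g i).1

/-- The component from `W` to `T`. -/
def gTW (g : Grp p (τ + ω)) (i : I) : Matrix (Fin (τ.1 i)) (Fin (ω.1 i)) (Kbar p) :=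
  blkTW (m := τ.1 i) (m' := ω.1 i) (n := τ.1 i) (n' := ω.1 i) (g i).1

/-- The component from `W` to `W`. -/
def gWW (g : Grp p (τ + ω)) (i : I) : Matrix (Fin (ω.1 i)) (Fin (ω.1 i)) (Kbar p) :=
  blkWW (m := τ.1 i) (m' := ω.1 i) (n := τ.1 i) (n' := ω.1 i) (g i).1

theorem gTW_mul {g g' : Grp p (τ + ω)} (h : ∀ i, gTW g i = 0) (h' : ∀ i, gTW g' i = 0) (i : I) :
    gTW (g * g') i = 0 := by
  have := blkTW_mul (m := τ.1 i) (m' := ω.1 i) (n := τ.1 i) (n' := ω.1 i) (k := τ.1 i)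
    (k' := ω.1 i) (g i).1 (g' i).1
  have h1 := h i
  have h2 := h' i
  rw [gTW] at h1 h2 ⊢
  rw [h1, h2] at this
  simpa using this

theorem gTT_mul {g g' : Grp p (τ + ω)} (h : ∀ i, gTW g i = 0) (i : I) :
    gTT (g * g') i = gTT g i * gTT g' i := by
  have := blkTT_mul (m := τ.1 i) (m' := ω.1 i) (n := τ.1 i) (n' := ω.1 i) (k := τ.1 i)
    (k' := ω.1 i) (g i).1 (g' i).1
  have h1 := h i
  rw [gTW] at h1
  rw [h1] at this
  rw [Matrix.zero_mul, add_zero] at this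
  exact this

theorem gWW_mul {g g' : Grp p (τ + ω)} (h' : ∀ i, gTW g' i = 0) (i : I) :
    gWW (g * g') i = gWW g i * gWW g' i := by
  have := blkWW_mul (m := τ.1 i) (m' := ω.1 i) (n := τ.1 i) (n' := ω.1 i) (k := τ.1 i)
    (k' := ω.1 i) (g i).1 (g' i).1
  have h1 := h' i
  rw [gTW] at h1
  rw [h1] at this
  rw [Matrix.mul_zero, zero_add] at this
  exact this

theorem gTT_one (i : I) : gTT (1 : Grp p (τ + ω)) i = 1 := blkTT_one

theorem gTW_one (i : I) : gTW (1 : Grp p (τ + ω)) i = 0 := blkTW_one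

theorem gWW_one (i : I) : gWW (1 : Grp p (τ + ω)) i = 1 := blkWW_one

variable (p τ ω)

/-- The stabilizer of `W` in `G_V`: the elements `g` such that both `g` and its inverse
map `W` into `W`. -/
def parab : Subgroup (Grp p (τ + ω)) where
  carrier := {g | (∀ i, gTW g i = 0) ∧ ∀ i, gTW g⁻¹ i = 0}
  one_mem' := ⟨gTW_one, by rw [inv_one]; exact gTW_one⟩
  mul_mem' := fun {g g'} h h' => ⟨gTW_mul h.1 h'.1, by rw [mul_inv_rev]; exact gTW_mul h'.2 h.2⟩
  inv_mem' := fun {g} h => ⟨h.2, by rw [inv_inv]; exact h.1⟩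

/-- The unipotent radical of `parab`: the kernel of the map to `G_T × G_W`. -/
def unip : Subgroup (Grp p (τ + ω)) where
  carrier := {g | g ∈ parab p τ ω ∧ (∀ i, gTT g i = 1) ∧ ∀ i, gWW g i = 1}
  one_mem' := ⟨one_mem _, gTT_one, gWW_one⟩
  mul_mem' := fun {g g'} h h' => ⟨mul_mem h.1 h'.1,
    fun i => by rw [gTT_mul h.1.1, h.2.1, h'.2.1, Matrix.one_mul],
    fun i => by rw [gWW_mul h'.1.1, h.2.2, h'.2.2, Matrix.one_mul]⟩
  inv_mem' := fun {g} h => ⟨inv_mem h.1,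
    fun i => by
      have := gTT_mul (g' := g⁻¹) h.1.1 i
      rwa [mul_inv_cancel, gTT_one, h.2.1, Matrix.one_mul, eq_comm] at this,
    fun i => by
      have := gWW_mul (g' := g) (g := g⁻¹) h.1.1 i
      rwa [inv_mul_cancel, gWW_one, h.2.2, Matrix.mul_one, eq_comm] at this⟩

variable {p τ ω}

theorem unip_le : unip p τ ω ≤ parab p τ ω := fun _ h => h.1

theorem recast_blk {m m' n n' k k' l l' : ℕ} (e1 : m = k) (e2 : m' = k') (e3 : n = l)
    (e4 : n' = l') (e5 : m + m' = k + k') (e6 : n + n' = l + l')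
    (x : Matrix (Fin (m + m')) (Fin (n + n')) (Kbar p)) :
    blkTT ((recast e5 e6 x).map (Fr p r)) = (recast e1 e3 (blkTT x)).map (Fr p r) ∧
    blkTW ((recast e5 e6 x).map (Fr p r)) = (recast e1 e4 (blkTW x)).map (Fr p r) ∧
    blkWW ((recast e5 e6 x).map (Fr p r)) = (recast e2 e4 (blkWW x)).map (Fr p r) := by
  subst e1 e2 e3 e4
  exact ⟨rfl, rfl, rfl⟩

theorem recast_zero_map {m m' n n' : ℕ} (hm : m = m') (hn : n = n') :
    (recast hm hn (0 : Matrix (Fin m) (Fin n) (Kbar p))).map (Fr p r) = 0 := by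
  subst hm hn
  ext; simp

theorem recast_one_map {m m' : ℕ} (hm hm' : m = m') :
    (recast hm hm' (1 : Matrix (Fin m) (Fin m) (Kbar p))).map (Fr p r) = 1 := by
  subst hm
  exact one_map' _

theorem frobGrp_blk (g : Grp p (τ + ω)) (i : I) :
    gTT (frobGrp r g) i = (recast (eq_symm Q.aV τ.2 i) (eq_symm Q.aV τ.2 i)
      (gTT g (Q.aV.symm i))).map (Fr p r) ∧
    gTW (frobGrp r g) i = (recast (eq_symm Q.aV τ.2 i) (eq_symm Q.aV ω.2 i)
      (gTW g (Q.aV.symm i))).map (Fr p r) ∧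
    gWW (frobGrp r g) i = (recast (eq_symm Q.aV ω.2 i) (eq_symm Q.aV ω.2 i)
      (gWW g (Q.aV.symm i))).map (Fr p r) :=
  recast_blk r (eq_symm Q.aV τ.2 i) (eq_symm Q.aV ω.2 i) (eq_symm Q.aV τ.2 i)
    (eq_symm Q.aV ω.2 i) _ _ _

theorem frobGrp_parab {g : Grp p (τ + ω)} (h : g ∈ parab p τ ω) :
    frobGrp r g ∈ parab p τ ω := by
  refine ⟨fun i => ?_, fun i => ?_⟩
  · rw [(frobGrp_blk r g i).2.1, h.1, recast_zero_map]
  · rw [← frobGrp_inv, (frobGrp_blk r g⁻¹ i).2.1, h.2, recast_zero_map]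

theorem frobGrp_unip {g : Grp p (τ + ω)} (h : g ∈ unip p τ ω) :
    frobGrp r g ∈ unip p τ ω := by
  refine ⟨frobGrp_parab r h.1, fun i => ?_, fun i => ?_⟩
  · rw [(frobGrp_blk r g i).1, h.2.1, recast_one_map]
  · rw [(frobGrp_blk r g i).2.2, h.2.2, recast_one_map]

theorem frobRep_blk (x : Rep p (τ + ω)) (h : Ω) :
    quotRep (frobRep r x) h = frobRep r (quotRep x) h ∧
    (blkTW (m := τ.1 (Q.tgt h)) (m' := ω.1 (Q.tgt h)) (n := τ.1 (Q.src h))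
      (n' := ω.1 (Q.src h)) (frobRep r x h) =
        (recast (eq_symm Q.aE (m := fun h => τ.1 (Q.tgt h)) (tgt_inv τ) h)
          (eq_symm Q.aE (m := fun h => ω.1 (Q.src h)) (src_inv ω) h)
          (blkTW (m := τ.1 (Q.tgt (Q.aE.symm h))) (m' := ω.1 (Q.tgt (Q.aE.symm h)))
            (n := τ.1 (Q.src (Q.aE.symm h))) (n' := ω.1 (Q.src (Q.aE.symm h)))
            (x (Q.aE.symm h)))).map (Fr p r)) ∧
    subRep (frobRep r x) h = frobRep r (subRep x) h :=
  recast_blk r (eq_symm Q.aE (m := fun h => τ.1 (Q.tgt h)) (tgt_inv τ) h)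
    (eq_symm Q.aE (m := fun h => ω.1 (Q.tgt h)) (tgt_inv ω) h)
    (eq_symm Q.aE (m := fun h => τ.1 (Q.src h)) (src_inv τ) h)
    (eq_symm Q.aE (m := fun h => ω.1 (Q.src h)) (src_inv ω) h) _ _ _

theorem frobRep_stab {x : Rep p (τ + ω)} (hx : Stab x) : Stab (frobRep r x) := by
  intro h
  rw [(frobRep_blk r x h).2.1, hx, recast_zero_map]

theorem quotRep_frob (x : Rep p (τ + ω)) : quotRep (frobRep r x) = frobRep r (quotRep x) :=
  funext fun h => (frobRep_blk r x h).1

theorem subRep_frob (x : Rep p (τ + ω)) : subRep (frobRep r x) = frobRep r (subRep x) :=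
  funext fun h => (frobRep_blk r x h).2.2

/-- Elements of `U` change neither the sub- nor the quotient representation. -/
theorem act_unip {b : Grp p (τ + ω)} (hb : b ∈ unip p τ ω) {x : Rep p (τ + ω)} (hx : Stab x) :
    quotRep (act b x) = quotRep x ∧ subRep (act b x) = subRep x := by
  have hb' := inv_mem hb
  constructor
  · funext h
    have e1 := blkTT_mul (m := τ.1 (Q.tgt h)) (m' := ω.1 (Q.tgt h)) (n := τ.1 (Q.src h))
      (n' := ω.1 (Q.src h)) (k := τ.1 (Q.src h)) (k' := ω.1 (Q.src h))
      ((b (Q.tgt h)).1 * x h) (b (Q.src h))⁻¹.1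
    have e2 := blkTT_mul (m := τ.1 (Q.tgt h)) (m' := ω.1 (Q.tgt h)) (n := τ.1 (Q.tgt h))
      (n' := ω.1 (Q.tgt h)) (k := τ.1 (Q.src h)) (k' := ω.1 (Q.src h)) (b (Q.tgt h)).1 (x h)
    have e3 := blkTW_mul (m := τ.1 (Q.tgt h)) (m' := ω.1 (Q.tgt h)) (n := τ.1 (Q.tgt h))
      (n' := ω.1 (Q.tgt h)) (k := τ.1 (Q.src h)) (k' := ω.1 (Q.src h)) (b (Q.tgt h)).1 (x h)
    have a1 := hb.1.1 (Q.tgt h)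
    have a2 := hb.2.1 (Q.tgt h)
    have a3 := hb'.2.1 (Q.src h)
    have a4 := hx h
    rw [gTW] at a1
    rw [gTT] at a2 a3
    rw [a1, a2, Matrix.one_mul, Matrix.zero_mul, add_zero] at e2
    rw [a1, a4, Matrix.mul_zero, Matrix.zero_mul, add_zero] at e3
    refine e1.trans ?_
    rw [e2, e3, Matrix.zero_mul, add_zero]
    refine (congrArg _ a3).trans (Matrix.mul_one _)
  · funext h
    have e1 := blkWW_mul (m := τ.1 (Q.tgt h)) (m' := ω.1 (Q.tgt h)) (n := τ.1 (Q.src h))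
      (n' := ω.1 (Q.src h)) (k := τ.1 (Q.src h)) (k' := ω.1 (Q.src h))
      ((b (Q.tgt h)).1 * x h) (b (Q.src h))⁻¹.1
    have e2 := blkWW_mul (m := τ.1 (Q.tgt h)) (m' := ω.1 (Q.tgt h)) (n := τ.1 (Q.tgt h))
      (n' := ω.1 (Q.tgt h)) (k := τ.1 (Q.src h)) (k' := ω.1 (Q.src h)) (b (Q.tgt h)).1 (x h)
    have a1 := hb'.1.1 (Q.src h)
    have a2 := hb.2.2 (Q.tgt h)
    have a3 := hb'.2.2 (Q.src h)
    have a4 := hx h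
    rw [gTW] at a1
    rw [gWW] at a2 a3
    rw [a4, a2, Matrix.mul_zero, Matrix.one_mul, zero_add] at e2
    refine e1.trans ?_
    rw [e2]
    refine (congrArg₂ (· + ·) ((congrArg _ a1).trans (Matrix.mul_zero _))
      ((congrArg _ a3).trans (Matrix.mul_one _))).trans (zero_add _)

/-! ## Functions on the rational points of invariant loci -/

/-- The points of `X ⊆ E_V` that are fixed by the twisted Frobenius. -/
abbrev Pts {ν : Q.DimVec} (X : Set (Rep p ν)) : Type w := {x : Rep p ν // x ∈ X ∧ frobRep r x = x}

/-- The functions on the rational points of `X` that are invariant under the rational points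
of `G_V`. -/
def InvFun (k : Type*) [Field k] {ν : Q.DimVec} (X : Set (Rep p ν)) :
    Submodule k (Pts r X → k) where
  carrier := {f | ∀ g : Grp p ν, frobGrp r g = g → ∀ x y : Pts r X, y.1 = act g x.1 → f y = f x}
  zero_mem' := fun _ _ _ _ _ => rfl
  add_mem' := fun {f f'} hf hf' g hg x y h => by
    simp only [Pi.add_apply]; rw [hf g hg x y h, hf' g hg x y h]
  smul_mem' := fun c f hf g hg x y h => by
    simp only [Pi.smul_apply]; rw [hf g hg x y h]

/-- A locus: for each dimension vector in `D`, a subset of `E_V` that is stable under `G_V` and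
the twisted Frobenius, and such that the diagram of the induction restricts to it. -/
structure Locus (Q : AutQuiver I Ω) (p r : ℕ) [Fact p.Prime] (D : AddSubmonoid Q.DimVec) where
  carrier : ∀ ν : D, Set (Rep p ν.1)
  act_mem : ∀ (ν : D) (g : Grp p ν.1) (x : Rep p ν.1), x ∈ carrier ν → act g x ∈ carrier ν
  frob_mem : ∀ (ν : D) (x : Rep p ν.1), x ∈ carrier ν → frobRep r x ∈ carrier ν
  blk_mem : ∀ (τ ω : D) (x : Rep p (τ.1 + ω.1)), x ∈ carrier (τ + ω) → Stab x →
    quotRep x ∈ carrier τ ∧ subRep x ∈ carrier ω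

/-- The whole representation spaces. -/
def fullLocus (Q : AutQuiver I Ω) (p r : ℕ) [Fact p.Prime] (D : AddSubmonoid Q.DimVec) :
    Locus Q p r D where
  carrier := fun _ => Set.univ
  act_mem := fun _ _ _ _ => trivial
  frob_mem := fun _ _ _ => trivial
  blk_mem := fun _ _ _ _ _ => ⟨trivial, trivial⟩

/-- Push-forward of functions along a map of finite sets. -/
def push {k : Type*} [Field k] {X Y : Type*} (φ : X → Y) (f : X → k) (y : Y) : k :=
  ∑ᶠ x ∈ φ ⁻¹' {y}, f x

section push

variable {k : Type*} [Field k] {X Y : Type*} {φ : X → Y}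

theorem push_add {f f' : X → k} (hf : f.support.Finite) (hf' : f'.support.Finite) :
    push φ (f + f') = push φ f + push φ f' := by
  funext y
  exact finsum_mem_add_distrib' (hf.inter_of_right _) (hf'.inter_of_right _)

theorem push_smul (c : k) (f : X → k) : push φ (c • f) = c • push φ f := by
  funext y
  simp only [push, Pi.smul_apply, smul_eq_mul, mul_finsum_mem]

theorem push_support {f : X → k} (hf : f.support.Finite) : (push φ f).support.Finite := by
  refine (hf.image φ).subset fun y hy => ?_
  obtain ⟨x, hx, hx'⟩ := exists_ne_zero_of_finsum_mem_ne_zero hy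
  exact ⟨x, hx', hx⟩

theorem push_inv {f : X → k} (σ : X → X) (hσ : σ.Bijective) (ρ : Y → Y) (hρ : ρ.Injective)
    (h : ∀ x, φ (σ x) = ρ (φ x)) (hf : ∀ x, f (σ x) = f x) (y : Y) :
    push φ f (ρ y) = push φ f y := by
  refine (finsum_mem_eq_of_bijOn σ ⟨?_, hσ.1.injOn, ?_⟩ fun x _ => (hf x).symm).symm
  · intro x hx
    simp only [Set.mem_preimage, Set.mem_singleton_iff] at hx ⊢
    rw [h, hx]
  · intro x hx
    obtain ⟨x, rfl⟩ := hσ.2 x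
    refine ⟨x, ?_, rfl⟩
    simp only [Set.mem_preimage, Set.mem_singleton_iff] at hx ⊢
    exact hρ ((h x).symm.trans hx)

end push

/-! ## The induction diagram -/

namespace Locus

variable {r}
variable {D : AddSubmonoid Q.DimVec} (L : Locus Q p r D) (τ ω : D)

/-- The elements of the locus that leave `W` invariant. -/
abbrev SW : Type w := {x : Rep p (τ.1 + ω.1) // Stab x ∧ x ∈ L.carrier (τ + ω)}

/-- The set `G_V × S_W`. -/
abbrev Pre : Type (max u w) := Grp p (τ.1 + ω.1) × L.SW τ ω

variable {τ ω}

/-- The equivalence relation of the action `b • (g, x) = (g b⁻¹, b • x)` of a subgroup `B`. -/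
def indSetoid (B : Subgroup (Grp p (τ.1 + ω.1))) : Setoid (L.Pre τ ω) where
  r y z := ∃ b ∈ B, z.1 = y.1 * b⁻¹ ∧ z.2.1 = act b y.2.1
  iseqv :=
    { refl := fun y => ⟨1, one_mem _, by simp, (act_one _).symm⟩
      symm := by
        rintro y z ⟨b, hb, h1, h2⟩
        exact ⟨b⁻¹, inv_mem hb, by rw [h1]; simp, by
          rw [h2, ← act_mul, inv_mul_cancel, act_one]⟩
      trans := by
        rintro y z t ⟨b, hb, h1, h2⟩ ⟨b', hb', h3, h4⟩
        exact ⟨b' * b, mul_mem hb' hb, by rw [h3, h1, mul_inv_rev, mul_assoc], by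
          rw [h4, h2, ← act_mul]⟩ }

/-- The set of orbits of `B` on `G_V × S_W`. -/
abbrev Ind (B : Subgroup (Grp p (τ.1 + ω.1))) : Type (max u w) := Quotient (L.indSetoid B)

/-- The twisted Frobenius on `G_V × S_W`. -/
def frobPre (y : L.Pre τ ω) : L.Pre τ ω :=
  (frobGrp r y.1, ⟨frobRep r y.2.1, frobRep_stab r y.2.2.1, L.frob_mem _ _ y.2.2.2⟩)

/-- The twisted Frobenius on the set of orbits. -/
def frobInd (B : Subgroup (Grp p (τ.1 + ω.1))) (hB : ∀ b ∈ B, frobGrp r b ∈ B) :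
    L.Ind B → L.Ind B :=
  Quotient.map L.frobPre (by
    rintro y z ⟨b, hb, h1, h2⟩
    exact ⟨frobGrp r b, hB b hb, by
      simp only [frobPre]; rw [h1, frobGrp_mul, frobGrp_inv], by
      simp only [frobPre]; rw [h2, frobRep_act]⟩)

/-- Left translation by `g` on the set of orbits. -/
def trInd (B : Subgroup (Grp p (τ.1 + ω.1))) (g : Grp p (τ.1 + ω.1)) : L.Ind B → L.Ind B :=
  Quotient.map (fun y => (g * y.1, y.2)) (by
    rintro y z ⟨b, hb, h1, h2⟩
    exact ⟨b, hb, by simp only; rw [h1, mul_assoc], h2⟩)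

theorem trInd_mul (B : Subgroup (Grp p (τ.1 + ω.1))) (g g' : Grp p (τ.1 + ω.1)) (y : L.Ind B) :
    L.trInd B g (L.trInd B g' y) = L.trInd B (g * g') y := by
  induction y using Quotient.inductionOn with
  | h y => simp only [trInd, Quotient.map_mk]; rw [mul_assoc]

theorem trInd_one (B : Subgroup (Grp p (τ.1 + ω.1))) (y : L.Ind B) :
    L.trInd B 1 y = y := by
  induction y using Quotient.inductionOn with
  | h y => simp only [trInd, Quotient.map_mk, one_mul]

theorem trInd_frob (B : Subgroup (Grp p (τ.1 + ω.1))) (hB : ∀ b ∈ B, frobGrp r b ∈ B)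
    (g : Grp p (τ.1 + ω.1)) (y : L.Ind B) :
    L.frobInd B hB (L.trInd B g y) = L.trInd B (frobGrp r g) (L.frobInd B hB y) := by
  induction y using Quotient.inductionOn with
  | h y => simp only [trInd, frobInd, Quotient.map_mk, frobPre]; rw [frobGrp_mul]

variable (τ ω)

/-- The points of `E' = U \ (G_V × S_W)` fixed by the twisted Frobenius. -/
abbrev E1F : Type (max u w) :=
  {y : L.Ind (unip p τ.1 ω.1) // L.frobInd _ (fun _ => frobGrp_unip r) y = y}

/-- The points of `E'' = Q \ (G_V × S_W)` fixed by the twisted Frobenius. -/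
abbrev E2F : Type (max u w) :=
  {y : L.Ind (parab p τ.1 ω.1) // L.frobInd _ (fun _ => frobGrp_parab r) y = y}

variable {τ ω}

/-- The first component of `p₁`, before passing to fixed points. -/
def preT : L.Ind (unip p τ.1 ω.1) → Rep p τ.1 :=
  Quotient.lift (fun y => quotRep y.2.1) (by
    rintro y z ⟨b, hb, -, h2⟩
    rw [h2, (act_unip hb y.2.2.1).1])

/-- The second component of `p₁`, before passing to fixed points. -/
def preW : L.Ind (unip p τ.1 ω.1) → Rep p ω.1 :=
  Quotient.lift (fun y => subRep y.2.1) (by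
    rintro y z ⟨b, hb, -, h2⟩
    rw [h2, (act_unip hb y.2.2.1).2])

theorem pre_mem (y : L.Ind (unip p τ.1 ω.1)) :
    L.preT y ∈ L.carrier τ ∧ L.preW y ∈ L.carrier ω := by
  induction y using Quotient.inductionOn with
  | h y => exact L.blk_mem τ ω y.2.1 y.2.2.2 y.2.2.1

theorem pre_frob (y : L.Ind (unip p τ.1 ω.1)) :
    L.preT (L.frobInd _ (fun _ => frobGrp_unip r) y) = frobRep r (L.preT y) ∧
    L.preW (L.frobInd _ (fun _ => frobGrp_unip r) y) = frobRep r (L.preW y) := by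
  induction y using Quotient.inductionOn with
  | h y => exact ⟨quotRep_frob r y.2.1, subRep_frob r y.2.1⟩

/-- The map `p₁ : [g, x] ↦ (x^T, x^W)`. -/
def p1 (y : L.E1F τ ω) : Pts r (L.carrier τ) × Pts r (L.carrier ω) :=
  (⟨L.preT y.1, (L.pre_mem y.1).1, by rw [← (L.pre_frob y.1).1, y.2]⟩,
    ⟨L.preW y.1, (L.pre_mem y.1).2, by rw [← (L.pre_frob y.1).2, y.2]⟩)

/-- The projection from the `U`-orbits to the `Q`-orbits. -/
def proj : L.Ind (unip p τ.1 ω.1) → L.Ind (parab p τ.1 ω.1) :=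
  Quotient.map id (by
    rintro y z ⟨b, hb, h⟩
    exact ⟨b, unip_le hb, h⟩)

theorem proj_frob (y : L.Ind (unip p τ.1 ω.1)) :
    L.frobInd _ (fun _ => frobGrp_parab r) (L.proj y) =
      L.proj (L.frobInd _ (fun _ => frobGrp_unip r) y) := by
  induction y using Quotient.inductionOn with
  | h y => rfl

/-- The map `p₂`, sending a `U`-orbit to its `Q`-orbit. -/
def p2 (y : L.E1F τ ω) : L.E2F τ ω := ⟨L.proj y.1, by rw [proj_frob, y.2]⟩

/-- The map `[g, x] ↦ g • x` on the orbits of any subgroup. -/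
def ev (B : Subgroup (Grp p (τ.1 + ω.1))) : L.Ind B → Rep p (τ.1 + ω.1) :=
  Quotient.lift (fun y => act y.1 y.2.1) (by
    rintro y z ⟨b, hb, h1, h2⟩
    rw [h1, h2, ← act_mul, inv_mul_cancel_right])

theorem ev_mem (B : Subgroup (Grp p (τ.1 + ω.1))) (y : L.Ind B) :
    L.ev B y ∈ L.carrier (τ + ω) := by
  induction y using Quotient.inductionOn with
  | h y => exact L.act_mem (τ + ω) y.1 y.2.1 y.2.2.2

theorem ev_frob (B : Subgroup (Grp p (τ.1 + ω.1))) (hB : ∀ b ∈ B, frobGrp r b ∈ B)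
    (y : L.Ind B) : L.ev B (L.frobInd B hB y) = frobRep r (L.ev B y) := by
  induction y using Quotient.inductionOn with
  | h y => exact (frobRep_act r y.1 y.2.1).symm

theorem ev_tr (B : Subgroup (Grp p (τ.1 + ω.1))) (g : Grp p (τ.1 + ω.1)) (y : L.Ind B) :
    L.ev B (L.trInd B g y) = act g (L.ev B y) := by
  induction y using Quotient.inductionOn with
  | h y => exact act_mul g y.1 y.2.1

/-- The map `p₃ : [g, x] ↦ g • x`. -/
def p3 (y : L.E2F τ ω) : Pts r (L.carrier (τ + ω)) :=
  ⟨L.ev _ y.1, L.ev_mem _ y.1, (L.ev_frob _ _ y.1).symm.trans (congrArg (L.ev _) y.2)⟩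

/-- The restriction to `W`. -/
def colW {N m m' : ℕ} (g : Matrix (Fin N) (Fin (m + m')) (Kbar p)) :
    Matrix (Fin N) (Fin m') (Kbar p) := g.submatrix id (Fin.natAdd m)

/-- The composite with the projection to `T`. -/
def rowT {N m m' : ℕ} (g : Matrix (Fin (m + m')) (Fin N) (Kbar p)) :
    Matrix (Fin m) (Fin N) (Kbar p) := g.submatrix (Fin.castAdd m') id

theorem colW_mul {N M m m' : ℕ} (g : Matrix (Fin N) (Fin M) (Kbar p))
    (c : Matrix (Fin M) (Fin (m + m')) (Kbar p)) : colW (g * c) = g * colW c := rfl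

theorem rowT_mul {N M m m' : ℕ} (c : Matrix (Fin (m + m')) (Fin M) (Kbar p))
    (g : Matrix (Fin M) (Fin N) (Kbar p)) : rowT (c * g) = rowT c * g := rfl

theorem colW_eq_one {m m' : ℕ} {c : Matrix (Fin (m + m')) (Fin (m + m')) (Kbar p)} :
    colW c = colW (m := m) (m' := m') 1 ↔ blkTW c = 0 ∧ blkWW c = 1 := by
  constructor
  · intro h
    exact ⟨(congrArg (fun z => z.submatrix (Fin.castAdd m') id) h).trans blkTW_one,
      (congrArg (fun z => z.submatrix (Fin.natAdd m) id) h).trans blkWW_one⟩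
  · rintro ⟨h1, h2⟩
    ext i j
    refine Fin.addCases (fun i => ?_) (fun i => ?_) i
    · exact congrFun (congrFun (h1.trans blkTW_one.symm) i) j
    · exact congrFun (congrFun (h2.trans blkWW_one.symm) i) j

theorem rowT_eq_one {m m' : ℕ} {c : Matrix (Fin (m + m')) (Fin (m + m')) (Kbar p)} :
    rowT c = rowT (m := m) (m' := m') 1 ↔ blkTT c = 1 ∧ blkTW c = 0 := by
  constructor
  · intro h
    exact ⟨(congrArg (fun z => z.submatrix id (Fin.castAdd m')) h).trans blkTT_one,
      (congrArg (fun z => z.submatrix id (Fin.natAdd m)) h).trans blkTW_one⟩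
  · rintro ⟨h1, h2⟩
    ext i j
    refine Fin.addCases (fun j => ?_) (fun j => ?_) j
    · exact congrFun (congrFun (h1.trans blkTT_one.symm) i) j
    · exact congrFun (congrFun (h2.trans blkTW_one.symm) i) j

theorem colW_recast {k k' l l' : ℕ} (e1 : k = l) (e2 : k' = l') (e3 e4 : k + k' = l + l')
    (x : Matrix (Fin (k + k')) (Fin (k + k')) (Kbar p)) :
    colW ((recast e3 e4 x).map (Fr p r)) = (recast e3 e2 (colW x)).map (Fr p r) ∧
    rowT ((recast e3 e4 x).map (Fr p r)) = (recast e1 e4 (rowT x)).map (Fr p r) := by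
  subst e1 e2; exact ⟨rfl, rfl⟩

/-- The restriction of `g` to `W`, as a function of the orbit `[g, x]`. -/
def famA : L.Ind (unip p τ.1 ω.1) → Fam p (τ.1 + ω.1).1 ω.1.1 := Quotient.lift
  (fun y i => colW (m := τ.1.1 i) (m' := ω.1.1 i) (y.1 i).1) (by
    rintro y z ⟨b, hb, h1, -⟩
    have hb' := inv_mem hb
    funext i
    have : colW (m := τ.1.1 i) (m' := ω.1.1 i) ((b⁻¹) i).1 = colW (m := τ.1.1 i) (m' := ω.1.1 i) 1 :=
      colW_eq_one.2 ⟨hb'.1.1 i, hb'.2.2 i⟩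
    have e : (z.1 i).1 = (y.1 i).1 * ((b⁻¹) i).1 := by rw [h1]; rfl
    simp only [e]
    refine Eq.symm ((colW_mul (m := τ.1.1 i) (m' := ω.1.1 i) _ _).trans ?_)
    rw [this, ← colW_mul, Matrix.mul_one])

/-- The composite of `g⁻¹` with the projection to `T`, as a function of the orbit `[g, x]`. -/
def famB : L.Ind (unip p τ.1 ω.1) → Fam p τ.1.1 (τ.1 + ω.1).1 := Quotient.lift
  (fun y i => rowT (m := τ.1.1 i) (m' := ω.1.1 i) (y.1 i)⁻¹.1) (by
    rintro y z ⟨b, hb, h1, -⟩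
    funext i
    have : rowT (m := τ.1.1 i) (m' := ω.1.1 i) (b i).1 = rowT (m := τ.1.1 i) (m' := ω.1.1 i) 1 :=
      rowT_eq_one.2 ⟨hb.2.1 i, hb.1.1 i⟩
    have e : (z.1 i)⁻¹.1 = (b i).1 * (y.1 i)⁻¹.1 := by rw [h1]; simp
    simp only [e]
    refine Eq.symm ((rowT_mul (m := τ.1.1 i) (m' := ω.1.1 i) _ _).trans ?_)
    rw [this, ← rowT_mul, Matrix.one_mul])

theorem fam_frob (y : L.Ind (unip p τ.1 ω.1)) :
    L.famA (L.frobInd _ (fun _ => frobGrp_unip r) y) =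
      frobFam p r Q.aV (τ.1 + ω.1).2 ω.1.2 (L.famA y) ∧
    L.famB (L.frobInd _ (fun _ => frobGrp_unip r) y) =
      frobFam p r Q.aV τ.1.2 (τ.1 + ω.1).2 (L.famB y) := by
  induction y using Quotient.inductionOn with
  | h y =>
    constructor
    · funext i
      exact (colW_recast (eq_symm Q.aV τ.1.2 i) (eq_symm Q.aV ω.1.2 i) _ _ _).1
    · funext i
      exact (colW_recast (eq_symm Q.aV τ.1.2 i) (eq_symm Q.aV ω.1.2 i) _ _ _).2

theorem fam_inj (y z : L.Ind (unip p τ.1 ω.1)) (h1 : L.ev _ y = L.ev _ z)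
    (h2 : L.famA y = L.famA z) (h3 : L.famB y = L.famB z) : y = z := by
  induction y using Quotient.inductionOn with
  | h y =>
  induction z using Quotient.inductionOn with
  | h z =>
  have key : ∀ y z : L.Pre τ ω,
      L.famA (Quotient.mk _ y) = L.famA (Quotient.mk _ z) →
      L.famB (Quotient.mk _ y) = L.famB (Quotient.mk _ z) → ∀ i,
      gTT (z.1⁻¹ * y.1) i = 1 ∧ gTW (z.1⁻¹ * y.1) i = 0 ∧ gWW (z.1⁻¹ * y.1) i = 1 := by
    intro y z h2 h3 i
    have h2' : colW (m := τ.1.1 i) (m' := ω.1.1 i) (y.1 i).1 = colW (z.1 i).1 := congrFun h2 i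
    have h3' : rowT (m := τ.1.1 i) (m' := ω.1.1 i) (y.1 i)⁻¹.1 = rowT (z.1 i)⁻¹.1 :=
      congrFun h3 i
    have e1 : colW (m := τ.1.1 i) (m' := ω.1.1 i) ((z.1 i)⁻¹.1 * (y.1 i).1) = colW (m := τ.1.1 i) (m' := ω.1.1 i) 1 := by
      refine (colW_mul (m := τ.1.1 i) (m' := ω.1.1 i) _ _).trans ?_
      rw [h2', ← colW_mul]
      exact congrArg colW (Units.inv_mul _)
    have e2 : rowT (m := τ.1.1 i) (m' := ω.1.1 i) ((z.1 i)⁻¹.1 * (y.1 i).1) = rowT (m := τ.1.1 i) (m' := ω.1.1 i) 1 := by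
      refine (rowT_mul (m := τ.1.1 i) (m' := ω.1.1 i) _ _).trans ?_
      rw [← h3', ← rowT_mul]
      exact congrArg rowT (Units.inv_mul _)
    exact ⟨(rowT_eq_one.1 e2).1, (colW_eq_one.1 e1).1, (colW_eq_one.1 e1).2⟩
  have k1 := key y z h2 h3
  have k2 := key z y h2.symm h3.symm
  refine Quotient.sound ⟨z.1⁻¹ * y.1, ⟨⟨fun i => (k1 i).2.1, fun i => ?_⟩, fun i => (k1 i).1,
    fun i => (k1 i).2.2⟩, by simp, ?_⟩
  · rw [mul_inv_rev, inv_inv]; exact (k2 i).2.1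
  · have h1' : act y.1 y.2.1 = act z.1 z.2.1 := h1
    rw [act_mul, h1', ← act_mul, inv_mul_cancel, act_one]

/-- There are finitely many rational points in `E'`: an orbit `[g, x]` is determined by
`g • x`, the restriction of `g` to `W` and the composite of `g⁻¹` with the projection to `T`. -/
theorem finite_E1F [Finite I] [Finite Ω] [NeZero r] : Finite (L.E1F τ ω) := by
  have f1 : Finite {z : Rep p (τ.1 + ω.1) // frobRep r z = z} := finite_frobFam p r Q.aE (m := fun h => (τ.1 + ω.1).1 (Q.tgt h))
    (n := fun h => (τ.1 + ω.1).1 (Q.src h)) (tgt_inv (τ.1 + ω.1)) (src_inv (τ.1 + ω.1))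
  have f2 := finite_frobFam p r Q.aV (τ.1 + ω.1).2 ω.1.2
  have f3 := finite_frobFam p r Q.aV τ.1.2 (τ.1 + ω.1).2
  refine Finite.of_injective (fun y : L.E1F τ ω =>
    ((⟨L.ev _ y.1, (L.ev_frob _ _ y.1).symm.trans (congrArg (L.ev _) y.2)⟩,
      ⟨L.famA y.1, (L.fam_frob y.1).1.symm.trans (congrArg L.famA y.2)⟩,
      ⟨L.famB y.1, (L.fam_frob y.1).2.symm.trans (congrArg L.famB y.2)⟩) :
      {z : Rep p (τ.1 + ω.1) // frobRep r z = z} ×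
      {z // frobFam p r Q.aV (τ.1 + ω.1).2 ω.1.2 z = z} ×
      {z // frobFam p r Q.aV τ.1.2 (τ.1 + ω.1).2 z = z})) ?_
  intro y z h
  simp only [Prod.mk.injEq, Subtype.mk.injEq] at h
  exact Subtype.ext (L.fam_inj _ _ h.1 h.2.1 h.2.2)

theorem pre_tr (g : Grp p (τ.1 + ω.1)) (y : L.Ind (unip p τ.1 ω.1)) :
    L.preT (L.trInd _ g y) = L.preT y ∧ L.preW (L.trInd _ g y) = L.preW y := by
  induction y using Quotient.inductionOn with
  | h y => exact ⟨rfl, rfl⟩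

theorem proj_tr (g : Grp p (τ.1 + ω.1)) (y : L.Ind (unip p τ.1 ω.1)) :
    L.proj (L.trInd _ g y) = L.trInd _ g (L.proj y) := by
  induction y using Quotient.inductionOn with
  | h y => rfl

theorem trInd_bij (B : Subgroup (Grp p (τ.1 + ω.1))) (hB : ∀ b ∈ B, frobGrp r b ∈ B)
    (g : Grp p (τ.1 + ω.1)) (hg : frobGrp r g = g) :
    Function.Bijective (fun y : {y : L.Ind B // L.frobInd B hB y = y} =>
      (⟨L.trInd B g y.1, by rw [trInd_frob, hg, y.2]⟩ : {y : L.Ind B // L.frobInd B hB y = y})) := by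
  constructor
  · intro y z h
    have h' : L.trInd B g y.1 = L.trInd B g z.1 := congrArg Subtype.val h
    have := congrArg (L.trInd B g⁻¹) h'
    rw [trInd_mul, trInd_mul, inv_mul_cancel, trInd_one, trInd_one] at this
    exact Subtype.ext this
  · intro y
    refine ⟨⟨L.trInd B g⁻¹ y.1, by rw [trInd_frob, frobGrp_inv, hg, y.2]⟩, Subtype.ext ?_⟩
    change L.trInd B g (L.trInd B g⁻¹ y.1) = y.1
    rw [trInd_mul, mul_inv_cancel, trInd_one]

end Locus

/-! ## Hall algebras -/

/-- The exponent `m_Ω(τ, ω)`. -/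
def mExp [Fintype I] [Fintype Ω] (τ ω : Q.DimVec) : ℕ :=
  ∑ i, τ.1 i * ω.1 i + ∑ h, τ.1 (Q.src h) * ω.1 (Q.tgt h)

variable (p) in
/-- The number of rational points of `G_V`. -/
def cardG (ν : Q.DimVec) : ℕ := Nat.card {g : Grp p ν // frobGrp r g = g}

variable {r} {k : Type*} [Field k] {D : AddSubmonoid Q.DimVec}

/-- The homogeneous component of the Hall algebra of a locus. (The square root `v` of `q` is
recorded since the multiplication depends on it.) -/
def HallPart (_v : k) (L : Locus Q p r D) (ν : D) : Type _ := ↥(InvFun r k (L.carrier ν))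

instance (v : k) (L : Locus Q p r D) (ν : D) : AddCommGroup (HallPart v L ν) :=
  inferInstanceAs (AddCommGroup ↥(InvFun r k (L.carrier ν)))

instance (v : k) (L : Locus Q p r D) (ν : D) : Module k (HallPart v L ν) :=
  inferInstanceAs (Module k ↥(InvFun r k (L.carrier ν)))

/-- `(p₃)_! (p₂)_! (p₁)^* (f₁ ⊗ f₂)` as a function on the rational points of `E_V`. -/
def indFun (L : Locus Q p r D) {τ ω : D} (f₁ : Pts r (L.carrier τ) → k)
    (f₂ : Pts r (L.carrier ω) → k) : Pts r (L.carrier (τ + ω)) → k :=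
  push L.p3 (push L.p2 (fun y => f₁ (L.p1 y).1 * f₂ (L.p1 y).2))

theorem indFun_inv (L : Locus Q p r D) {τ ω : D} (f₁ : Pts r (L.carrier τ) → k)
    (f₂ : Pts r (L.carrier ω) → k) : indFun L f₁ f₂ ∈ InvFun r k (L.carrier (τ + ω)) := by
  intro g hg x y hxy
  have b1 := L.trInd_bij (unip p τ.1 ω.1) (fun _ => frobGrp_unip r) g hg
  have b2 := L.trInd_bij (parab p τ.1 ω.1) (fun _ => frobGrp_parab r) g hg
  let ρ : Pts r (L.carrier (τ + ω)) → Pts r (L.carrier (τ + ω)) := fun z =>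
    ⟨act g z.1, L.act_mem _ _ _ z.2.1, by rw [frobRep_act, hg, z.2.2]⟩
  have hρ : ρ.Injective := by
    intro z t h
    have h' : act g z.1 = act g t.1 := congrArg Subtype.val h
    have := congrArg (act g⁻¹) h'
    rw [← act_mul, ← act_mul, inv_mul_cancel, act_one, act_one] at this
    exact Subtype.ext this
  have e : y = ρ x := Subtype.ext hxy
  rw [e]
  refine push_inv _ b2 ρ hρ (fun z => Subtype.ext (L.ev_tr _ g z.1)) (fun z => ?_) x
  refine push_inv _ b1 _ b2.1 (fun t => Subtype.ext (L.proj_tr g t.1)) (fun t => ?_) z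
  have h1 : (L.p1 ⟨L.trInd _ g t.1, by rw [L.trInd_frob, hg, t.2]⟩) = L.p1 t :=
    Prod.ext (Subtype.ext (L.pre_tr g t.1).1) (Subtype.ext (L.pre_tr g t.1).2)
  simp only [h1]

section

variable [Finite I] [Finite Ω] [NeZero r]

theorem indFun_add_left (L : Locus Q p r D) {τ ω : D} (f₁ f₁' : Pts r (L.carrier τ) → k)
    (f₂ : Pts r (L.carrier ω) → k) :
    indFun L (f₁ + f₁') f₂ = indFun L f₁ f₂ + indFun L f₁' f₂ := by
  have := L.finite_E1F (τ := τ) (ω := ω)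
  simp only [indFun, Pi.add_apply, add_mul]
  rw [← push_add (push_support (Set.toFinite _)) (push_support (Set.toFinite _)),
    ← push_add (Set.toFinite _) (Set.toFinite _)]
  rfl

theorem indFun_add_right (L : Locus Q p r D) {τ ω : D} (f₁ : Pts r (L.carrier τ) → k)
    (f₂ f₂' : Pts r (L.carrier ω) → k) :
    indFun L f₁ (f₂ + f₂') = indFun L f₁ f₂ + indFun L f₁ f₂' := by
  have := L.finite_E1F (τ := τ) (ω := ω)
  simp only [indFun, Pi.add_apply, mul_add]
  rw [← push_add (push_support (Set.toFinite _)) (push_support (Set.toFinite _)),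
    ← push_add (Set.toFinite _) (Set.toFinite _)]
  rfl

end

theorem indFun_smul_left (L : Locus Q p r D) {τ ω : D} (c : k) (f₁ : Pts r (L.carrier τ) → k)
    (f₂ : Pts r (L.carrier ω) → k) : indFun L (c • f₁) f₂ = c • indFun L f₁ f₂ := by
  rw [indFun, indFun, ← push_smul, ← push_smul]
  simp only [Pi.smul_apply, smul_eq_mul, mul_assoc]
  rfl

theorem indFun_smul_right (L : Locus Q p r D) {τ ω : D} (c : k) (f₁ : Pts r (L.carrier τ) → k)
    (f₂ : Pts r (L.carrier ω) → k) : indFun L f₁ (c • f₂) = c • indFun L f₁ f₂ := by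
  rw [indFun, indFun, ← push_smul, ← push_smul]
  simp only [Pi.smul_apply, smul_eq_mul, mul_left_comm _ c]
  rfl

section

variable [Fintype I] [Fintype Ω]

/-- The multiplication `Ind = v ^ (- m_Ω(τ, ω)) (#G_T #G_W)⁻¹ (p₃)_! (p₂)_! (p₁)^*`. -/
def hallMul (v : k) (L : Locus Q p r D) {τ ω : D} (f₁ : HallPart v L τ) (f₂ : HallPart v L ω) :
    HallPart v L (τ + ω) :=
  ⟨(v⁻¹ ^ mExp τ.1 ω.1 * ((cardG p r τ.1 * cardG p r ω.1 : ℕ) : k)⁻¹) • indFun L f₁.1 f₂.1,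
    Submodule.smul_mem _ _ (indFun_inv L f₁.1 f₂.1)⟩

instance [NeZero r] (v : k) (L : Locus Q p r D) :
    DirectSum.GNonUnitalNonAssocSemiring (HallPart v L) where
  mul := hallMul v L
  mul_zero := fun {τ ω} a => by
    have h := indFun_smul_right L (0 : k) a.1 (0 : HallPart v L ω).1
    rw [zero_smul, zero_smul] at h
    refine Subtype.ext ?_
    change _ • indFun L a.1 0 = 0
    rw [h, smul_zero]
  zero_mul := fun {τ ω} a => by
    have h := indFun_smul_left L (0 : k) (0 : HallPart v L τ).1 a.1
    rw [zero_smul, zero_smul] at h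
    refine Subtype.ext ?_
    change _ • indFun L 0 a.1 = 0
    rw [h, smul_zero]
  mul_add := fun {τ ω} a b c => by
    refine Subtype.ext ?_
    change _ • indFun L a.1 (b.1 + c.1) = _ • indFun L a.1 b.1 + _ • indFun L a.1 c.1
    rw [indFun_add_right, smul_add]
  add_mul := fun {τ ω} a b c => by
    refine Subtype.ext ?_
    change _ • indFun L (a.1 + b.1) c.1 = _ • indFun L a.1 c.1 + _ • indFun L b.1 c.1
    rw [indFun_add_left, smul_add]

/-- The unit: the function with value `1` in dimension `0`. -/
instance (v : k) (L : Locus Q p r D) : GradedMonoid.GOne (HallPart v L) where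
  one := ⟨fun _ => 1, fun _ _ _ _ _ => rfl⟩

/-- The Hall algebra of a locus. -/
abbrev Hall (v : k) (L : Locus Q p r D) : Type _ := ⨁ ν : D, HallPart v L ν

theorem hall_smul_mul [NeZero r] (v : k) (L : Locus Q p r D) (c : k) (x y : Hall v L) :
    (c • x) * y = c • (x * y) := by
  induction x using DirectSum.induction_on with
  | zero => simp
  | add x x' h h' => rw [smul_add, add_mul, add_mul, smul_add, h, h']
  | of τ a =>
    induction y using DirectSum.induction_on with
    | zero => simp
    | add x x' h h' => rw [mul_add, mul_add, smul_add, h, h']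
    | of ω b =>
      rw [← DirectSum.lof_eq_of k, ← map_smul, DirectSum.lof_eq_of, DirectSum.lof_eq_of,
        DirectSum.of_mul_of, DirectSum.of_mul_of, ← DirectSum.lof_eq_of k,
        ← DirectSum.lof_eq_of k, ← map_smul]
      congr 1
      refine Subtype.ext ?_
      change _ • indFun L (c • a.1) b.1 = c • _ • indFun L a.1 b.1
      rw [indFun_smul_left, smul_comm]

theorem hall_mul_smul [NeZero r] (v : k) (L : Locus Q p r D) (c : k) (x y : Hall v L) :
    x * (c • y) = c • (x * y) := by
  induction x using DirectSum.induction_on with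
  | zero => simp
  | add x x' h h' => rw [add_mul, add_mul, smul_add, h, h']
  | of τ a =>
    induction y using DirectSum.induction_on with
    | zero => simp
    | add x x' h h' => rw [smul_add, mul_add, mul_add, smul_add, h, h']
    | of ω b =>
      rw [← DirectSum.lof_eq_of k _ _ ω, ← map_smul, DirectSum.lof_eq_of, DirectSum.lof_eq_of,
        DirectSum.of_mul_of, DirectSum.of_mul_of, ← DirectSum.lof_eq_of k,
        ← DirectSum.lof_eq_of k, ← map_smul]
      congr 1
      refine Subtype.ext ?_
      change _ • indFun L a.1 (c • b.1) = c • _ • indFun L a.1 b.1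
      rw [indFun_smul_right, smul_comm]

instance [NeZero r] (v : k) (L : Locus Q p r D) : IsScalarTower k (Hall v L) (Hall v L) :=
  ⟨fun c x y => hall_smul_mul v L c x y⟩

instance [NeZero r] (v : k) (L : Locus Q p r D) : SMulCommClass k (Hall v L) (Hall v L) :=
  ⟨fun c x y => (hall_mul_smul v L c x y).symm⟩

end

/-! ## Restriction and extension by zero -/

/-- Extension by zero of invariant functions from a `G_V`-stable subset `X` to `E_V`. -/
def extZero {ν : Q.DimVec} (X : Set (Rep p ν)) (hX : ∀ (g : Grp p ν) x, x ∈ X → act g x ∈ X) :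
    ↥(InvFun r k X) →ₗ[k] ↥(InvFun r k (Set.univ : Set (Rep p ν))) where
  toFun f := by
    classical
    exact ⟨fun x => if h : x.1 ∈ X then f.1 ⟨x.1, h, x.2.2⟩ else 0, by
      intro g hg x y hxy
      by_cases h : x.1 ∈ X
      · have h' : y.1 ∈ X := by rw [hxy]; exact hX g _ h
        simp only [dif_pos h, dif_pos h']
        exact f.2 g hg ⟨x.1, h, x.2.2⟩ ⟨y.1, h', y.2.2⟩ hxy
      · have h' : y.1 ∉ X := by
          intro h'
          apply h
          have := hX g⁻¹ _ h'
          rwa [hxy, ← act_mul, inv_mul_cancel, act_one] at this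
        simp only [dif_neg h, dif_neg h']⟩
  map_add' f f' := by
    refine Subtype.ext (funext fun x => ?_)
    by_cases h : x.1 ∈ X <;> simp [h]
  map_smul' c f := by
    refine Subtype.ext (funext fun x => ?_)
    by_cases h : x.1 ∈ X <;> simp [h]

/-- Restriction of invariant functions on `E_V` to a subset `X`. -/
def restr {ν : Q.DimVec} (X : Set (Rep p ν)) :
    ↥(InvFun r k (Set.univ : Set (Rep p ν))) →ₗ[k] ↥(InvFun r k X) where
  toFun f := ⟨fun x => f.1 ⟨x.1, trivial, x.2.2⟩, fun g hg x y hxy =>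
    f.2 g hg ⟨x.1, trivial, x.2.2⟩ ⟨y.1, trivial, y.2.2⟩ hxy⟩
  map_add' _ _ := rfl
  map_smul' _ _ := rfl

/-- `j^*`: the restriction of functions to a locus. -/
def jStar (v : k) (L : Locus Q p r D) : Hall v (fullLocus Q p r D) →ₗ[k] Hall v L :=
  DirectSum.lmap (M := HallPart v (fullLocus Q p r D)) (N := HallPart v L)
    fun ν => restr (L.carrier ν)

/-- `j_!`: the extension by zero of functions on a locus. -/
def jShriek (v : k) (L : Locus Q p r D) : Hall v L →ₗ[k] Hall v (fullLocus Q p r D) :=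
  DirectSum.lmap (M := HallPart v L) (N := HallPart v (fullLocus Q p r D))
    fun ν => extZero (L.carrier ν) (L.act_mem ν)

variable (k) in
/-- The direct sum of the spaces of invariant functions on the complement of a locus. -/
abbrev HallCompl (L : Locus Q p r D) : Type _ := ⨁ ν : D, ↥(InvFun r k (L.carrier ν)ᶜ)

/-- Extension by zero of functions on the complement of a locus. -/
def iShriek (v : k) (L : Locus Q p r D) : HallCompl k L →ₗ[k] Hall v (fullLocus Q p r D) :=
  DirectSum.lmap (M := fun ν : D => ↥(InvFun r k (L.carrier ν)ᶜ))
    (N := HallPart v (fullLocus Q p r D))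
    fun ν => extZero (L.carrier ν)ᶜ fun g x hx h => hx (by
      have := L.act_mem ν g⁻¹ _ h
      rwa [← act_mul, inv_mul_cancel, act_one] at this)

/-- The inclusion of the part of the Hall algebra with dimension vectors in `D`. -/
def incl [Fintype I] (v : k) (D : AddSubmonoid Q.DimVec) :
    Hall v (fullLocus Q p r D) →ₗ[k] Hall v (fullLocus Q p r ⊤) :=
  DirectSum.toModule k D _ fun ν =>
    DirectSum.lof k _ (HallPart v (fullLocus Q p r ⊤)) ⟨ν.1, trivial⟩

/-! ## Edge contraction -/

/-- The automorphism is admissible: an edge that is not a loop does not have both ends in the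
same orbit. -/
def Admissible (Q : AutQuiver I Ω) : Prop :=
  ∀ h, Q.src h ≠ Q.tgt h → ¬ Q.aV.SameCycle (Q.src h) (Q.tgt h)

/-- The orbit `[i₊]` of the source of the edge `c`. -/
def plus (Q : AutQuiver I Ω) (c : Ω) : Set I := {i | Q.aV.SameCycle (Q.src c) i}

/-- The orbit `[i₋]` of the target of the edge `c`. -/
def minus (Q : AutQuiver I Ω) (c : Ω) : Set I := {i | Q.aV.SameCycle (Q.tgt c) i}

/-- The orbit of the edge `c`: the edges that are contracted. -/
def conE (Q : AutQuiver I Ω) (c : Ω) : Set Ω := {h | Q.aE.SameCycle c h}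

/-- The conditions under which the orbit of the edge `c` can be contracted. -/
structure Contractible (Q : AutQuiver I Ω) (c : Ω) : Prop where
  card_eq : (Q.plus c).ncard = (Q.minus c).ncard
  card_conE : (Q.conE c).ncard = (Q.plus c).ncard
  parallel : ∀ h l : Ω, Q.src h ∈ Q.plus c ∪ Q.minus c → Q.tgt h ∈ Q.plus c ∪ Q.minus c →
    Q.src h ≠ Q.tgt h → Q.src l ∈ Q.plus c ∪ Q.minus c → Q.tgt l ∈ Q.plus c ∪ Q.minus c →
    (Q.src l = Q.src h ∨ Q.src l = Q.tgt h) → (Q.tgt l = Q.src h ∨ Q.tgt l = Q.tgt h)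
  no_loop : ∀ h : Ω, Q.src h = Q.tgt h → Q.src h ∉ Q.plus c ∪ Q.minus c

section Contraction

variable {c : Ω}

theorem aV_minus (i : I) : Q.aV i ∈ Q.minus c ↔ i ∈ Q.minus c :=
  Equiv.Perm.sameCycle_apply_right

theorem aE_conE (h : Ω) : Q.aE h ∈ Q.conE c ↔ h ∈ Q.conE c :=
  Equiv.Perm.sameCycle_apply_right

theorem aE_symm_conE (h : Ω) : Q.aE.symm h ∈ Q.conE c ↔ h ∈ Q.conE c := by
  rw [← aE_conE, Equiv.apply_symm_apply]

theorem src_pow (n : ℤ) (h : Ω) : Q.src ((Q.aE ^ n) h) = (Q.aV ^ n) (Q.src h) := by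
  induction n using Int.induction_on generalizing h with
  | zero => rfl
  | succ n ih => rw [zpow_add_one, zpow_add_one, Equiv.Perm.mul_apply, ih, Q.src_aE]; rfl
  | pred n ih =>
    rw [zpow_sub_one, zpow_sub_one, Equiv.Perm.mul_apply, ih]
    exact congrArg _ (src_symm h)

theorem tgt_pow (n : ℤ) (h : Ω) : Q.tgt ((Q.aE ^ n) h) = (Q.aV ^ n) (Q.tgt h) := by
  induction n using Int.induction_on generalizing h with
  | zero => rfl
  | succ n ih => rw [zpow_add_one, zpow_add_one, Equiv.Perm.mul_apply, ih, Q.tgt_aE]; rfl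
  | pred n ih =>
    rw [zpow_sub_one, zpow_sub_one, Equiv.Perm.mul_apply, ih]
    exact congrArg _ (tgt_symm h)

theorem src_mem_plus {h : Ω} (hh : h ∈ Q.conE c) : Q.src h ∈ Q.plus c := by
  obtain ⟨n, rfl⟩ := hh
  exact ⟨n, (src_pow n c).symm⟩

theorem tgt_mem_minus {h : Ω} (hh : h ∈ Q.conE c) : Q.tgt h ∈ Q.minus c := by
  obtain ⟨n, rfl⟩ := hh
  exact ⟨n, (tgt_pow n c).symm⟩

/-- No edge has both ends in `[i₋]`. -/
theorem not_both (hQ : Q.Admissible) (hc : Q.Contractible c) {h : Ω}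
    (h1 : Q.src h ∈ Q.minus c) : Q.tgt h ∉ Q.minus c := by
  intro h2
  by_cases e : Q.src h = Q.tgt h
  · exact hc.no_loop h e (Or.inr h1)
  · exact hQ h e (Equiv.Perm.SameCycle.trans (Equiv.Perm.SameCycle.symm h1) h2)

theorem src_notMem (hQ : Q.Admissible) (hc : Q.Contractible c) {h : Ω} (hh : h ∈ Q.conE c) :
    Q.src h ∉ Q.minus c :=
  fun h1 => not_both hQ hc h1 (tgt_mem_minus hh)

/-- The vertices of the contracted quiver. -/
abbrev HatV (Q : AutQuiver I Ω) (c : Ω) : Type u := {i : I // i ∉ Q.minus c}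

/-- The edges of the contracted quiver: the edges of the quiver not meeting `[i₋]`, the paths
`l h` and the paths `h⁻¹ l`, where `h` is a contracted edge and `l` is another edge. -/
inductive HatE (Q : AutQuiver I Ω) (c : Ω) : Type w
  | old (h : Ω) (hs : Q.src h ∉ Q.minus c) (ht : Q.tgt h ∉ Q.minus c)
  | post (l h : Ω) (hh : h ∈ Q.conE c) (e : Q.tgt h = Q.src l)
  | pre (h l : Ω) (hh : h ∈ Q.conE c) (hl : l ∉ Q.conE c) (e : Q.tgt h = Q.tgt l)

instance [Finite Ω] : Finite (HatE Q c) := by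
  refine Finite.of_injective (β := Ω ⊕ (Ω × Ω) ⊕ (Ω × Ω)) (fun x => match x with
    | .old h _ _ => .inl h
    | .post l h _ _ => .inr (.inl (l, h))
    | .pre h l _ _ _ => .inr (.inr (h, l))) ?_
  intro x y h
  cases x <;> cases y <;> simp_all

instance [Fintype I] : Fintype (HatV Q c) := Fintype.ofFinite _

instance [Fintype Ω] : Fintype (HatE Q c) := Fintype.ofFinite _

/-- The map induced on edges by the automorphism. -/
def hatE : HatE Q c → HatE Q c
  | .old h hs ht => .old (Q.aE h) (by rwa [Q.src_aE, aV_minus]) (by rwa [Q.tgt_aE, aV_minus])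
  | .post l h hh e => .post (Q.aE l) (Q.aE h) (by rwa [aE_conE])
      (by rw [Q.src_aE, Q.tgt_aE, e])
  | .pre h l hh hl e => .pre (Q.aE h) (Q.aE l) (by rwa [aE_conE]) (by rwa [aE_conE])
      (by rw [Q.tgt_aE, Q.tgt_aE, e])

theorem aV_symm_minus (i : I) : Q.aV.symm i ∈ Q.minus c ↔ i ∈ Q.minus c := by
  rw [← aV_minus, Equiv.apply_symm_apply]

/-- The inverse of `hatE`. -/
def hatEinv : HatE Q c → HatE Q c
  | .old h hs ht => .old (Q.aE.symm h) (by rwa [src_symm, aV_symm_minus])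
      (by rwa [tgt_symm, aV_symm_minus])
  | .post l h hh e => .post (Q.aE.symm l) (Q.aE.symm h) (by rwa [aE_symm_conE])
      (by rw [src_symm, tgt_symm, e])
  | .pre h l hh hl e => .pre (Q.aE.symm h) (Q.aE.symm l) (by rwa [aE_symm_conE])
      (by rwa [aE_symm_conE]) (by rw [tgt_symm, tgt_symm, e])

/-- The contraction of the quiver along the orbit of the edge `c`. -/
def contract (Q : AutQuiver I Ω) (c : Ω) (hQ : Q.Admissible) (hc : Q.Contractible c) :
    AutQuiver (HatV Q c) (HatE Q c) where
  src
    | .old h hs _ => ⟨Q.src h, hs⟩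
    | .post _ h hh _ => ⟨Q.src h, src_notMem hQ hc hh⟩
    | .pre _ l hh _ e => ⟨Q.src l, fun h1 =>
        not_both hQ hc h1 (by rw [← e]; exact tgt_mem_minus hh)⟩
  tgt
    | .old h _ ht => ⟨Q.tgt h, ht⟩
    | .post l _ hh e => ⟨Q.tgt l, not_both hQ hc (by rw [← e]; exact tgt_mem_minus hh)⟩
    | .pre h _ hh _ _ => ⟨Q.src h, src_notMem hQ hc hh⟩
  aV := Q.aV.subtypePerm fun i => not_congr (aV_minus i)
  aE := ⟨hatE, hatEinv, by rintro (_ | _ | _) <;> simp [hatE, hatEinv],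
    by rintro (_ | _ | _) <;> simp [hatE, hatEinv]⟩
  src_aE := by
    rintro (_ | _ | _) <;> exact Subtype.ext (Q.src_aE _)
  tgt_aE := by
    rintro (_ | _ | _)
    · exact Subtype.ext (Q.tgt_aE _)
    · exact Subtype.ext (Q.tgt_aE _)
    · exact Subtype.ext (Q.src_aE _)

/-- `ℕ[Î]` inside `ℕ[I]`: the dimension vectors with equal values at `i₊` and `i₋`. -/
def balanced (Q : AutQuiver I Ω) (c : Ω) : AddSubmonoid Q.DimVec where
  carrier := {ν | ν.1 (Q.src c) = ν.1 (Q.tgt c)}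
  zero_mem' := rfl
  add_mem' := fun {ν μ} (hν : _ = _) (hμ : _ = _) => by
    change ν.1 (Q.src c) + μ.1 (Q.src c) = ν.1 (Q.tgt c) + μ.1 (Q.tgt c)
    rw [hν, hμ]

theorem dim_sameCycle (ν : Q.DimVec) {i j : I} (h : Q.aV.SameCycle i j) : ν.1 i = ν.1 j := by
  obtain ⟨n, rfl⟩ := h
  induction n using Int.induction_on generalizing i with
  | zero => rfl
  | succ n ih => rw [zpow_add_one, Equiv.Perm.mul_apply, ← ih, ν.2]
  | pred n ih =>
    rw [zpow_sub_one, Equiv.Perm.mul_apply, ← ih]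
    exact (eq_symm Q.aV ν.2 i).symm

theorem dim_conE (ν : Q.balanced c) {h : Ω} (hh : h ∈ Q.conE c) :
    ν.1.1 (Q.tgt h) = ν.1.1 (Q.src h) := by
  have e : ν.1.1 (Q.src c) = ν.1.1 (Q.tgt c) := ν.2
  rw [← dim_sameCycle ν.1 (src_mem_plus hh), ← dim_sameCycle ν.1 (tgt_mem_minus hh), e]

theorem frobRep_apply {ν : Q.DimVec} (x : Rep p ν) (h : Ω) :
    frobRep r x h = (recast (eq_symm Q.aE (m := fun h => ν.1 (Q.tgt h)) (tgt_inv ν) h)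
      (eq_symm Q.aE (m := fun h => ν.1 (Q.src h)) (src_inv ν) h)
      (x (Q.aE.symm h))).map (Fr p r) := rfl

theorem isoInv_act {ν : Q.DimVec} (g : Grp p ν) (x : Rep p ν) (h : Ω) (hx : IsIsoMat (x h)) :
    IsIsoMat (act g x h) ∧ isoInv (act g x h) =
      (g (Q.src h)).1 * isoInv (x h) * (g (Q.tgt h))⁻¹.1 := by
  obtain ⟨h1, h2⟩ := hx.mul_isoInv
  have a1 : (g (Q.src h))⁻¹.1 * (g (Q.src h)).1 = 1 := Units.inv_mul _
  have a2 : (g (Q.tgt h))⁻¹.1 * (g (Q.tgt h)).1 = 1 := Units.inv_mul _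
  have a3 : (g (Q.src h)).1 * (g (Q.src h))⁻¹.1 = 1 := Units.mul_inv _
  have a4 : (g (Q.tgt h)).1 * (g (Q.tgt h))⁻¹.1 = 1 := Units.mul_inv _
  have e1 : act g x h * ((g (Q.src h)).1 * isoInv (x h) * (g (Q.tgt h))⁻¹.1) = 1 := by
    calc _ = (g (Q.tgt h)).1 * (x h * ((g (Q.src h))⁻¹.1 * (g (Q.src h)).1) * isoInv (x h)) *
          (g (Q.tgt h))⁻¹.1 := by simp only [act, Matrix.mul_assoc]
      _ = 1 := by rw [a1, Matrix.mul_one, h1, Matrix.mul_one, a4]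
  have e2 : ((g (Q.src h)).1 * isoInv (x h) * (g (Q.tgt h))⁻¹.1) * act g x h = 1 := by
    calc _ = (g (Q.src h)).1 * (isoInv (x h) * ((g (Q.tgt h))⁻¹.1 * (g (Q.tgt h)).1) * x h) *
          (g (Q.src h))⁻¹.1 := by simp only [act, Matrix.mul_assoc]
      _ = 1 := by rw [a2, Matrix.mul_one, h2, Matrix.mul_one, a3]
  exact ⟨⟨_, e1, e2⟩, isoInv_eq e1 e2⟩

theorem blk_iso {m m' n n' : ℕ} (e : m = n) (e' : m' = n')
    {x : Matrix (Fin (m + m')) (Fin (n + n')) (Kbar p)} (hx : IsIsoMat x) (h0 : blkTW x = 0) :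
    IsIsoMat (blkTT x) ∧ IsIsoMat (blkWW x) := by
  subst e e'
  obtain ⟨y, h1, h2⟩ := hx
  have t := blkTT_mul x y
  rw [h1, h0, Matrix.zero_mul, add_zero, blkTT_one] at t
  have w := blkWW_mul y x
  rw [h2, h0, Matrix.mul_zero, zero_add, blkWW_one] at w
  exact ⟨⟨_, t.symm, mul_eq_one_comm.1 t.symm⟩, ⟨_, mul_eq_one_comm.1 w.symm, w.symm⟩⟩

/-- The locus `E_V^♡` where the contracted edges act by isomorphisms. -/
def heart (Q : AutQuiver I Ω) (p r : ℕ) [Fact p.Prime] (c : Ω) :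
    Locus Q p r (Q.balanced c) where
  carrier := fun ν => {x | ∀ h ∈ Q.conE c, IsIsoMat (x h)}
  act_mem := fun ν g x hx h hh => (isoInv_act g x h (hx h hh)).1
  frob_mem := fun ν x hx h hh => by
    rw [frobRep_apply]
    exact isIsoMat_map _ (isIsoMat_recast _ _ (hx _ ((aE_symm_conE h).2 hh)))
  blk_mem := fun τ ω x hx hs =>
    ⟨fun h hh => (blk_iso (dim_conE τ hh) (dim_conE ω hh) (hx h hh) (hs h)).1,
      fun h hh => (blk_iso (dim_conE τ hh) (dim_conE ω hh) (hx h hh) (hs h)).2⟩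

variable (hQ : Q.Admissible) (hc : Q.Contractible c)

/-- The dimension vector of the contracted quiver obtained by forgetting `[i₋]`. -/
def hatDim (ν : Q.balanced c) : (Q.contract c hQ hc).DimVec :=
  ⟨fun i => ν.1.1 i.1, fun i => ν.1.2 i.1⟩

theorem hatDim_injective : Function.Injective (hatDim hQ hc) := by
  intro ν μ h
  have h' : ∀ i : HatV Q c, ν.1.1 i.1 = μ.1.1 i.1 := fun i =>
    congrFun (congrArg Subtype.val h) i
  refine Subtype.ext (Subtype.ext (funext fun i => ?_))
  by_cases hi : i ∈ Q.minus c
  · have e1 : ν.1.1 (Q.src c) = ν.1.1 (Q.tgt c) := ν.2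
    have e2 : μ.1.1 (Q.src c) = μ.1.1 (Q.tgt c) := μ.2
    rw [← dim_sameCycle ν.1 hi, ← dim_sameCycle μ.1 hi, ← e1, ← e2]
    exact h' ⟨Q.src c, src_notMem hQ hc (Equiv.Perm.SameCycle.refl _ _)⟩
  · exact h' ⟨i, hi⟩

/-- The contraction map `μ_ν`. -/
def contractRep {ν : Q.balanced c} (x : Rep p ν.1) : Rep p (hatDim hQ hc ν)
  | .old h _ _ => x h
  | .post l h _ e => recast rfl (congrArg ν.1.1 e.symm) (x l) * x h
  | .pre h l _ _ e => isoInv (x h) * recast (congrArg ν.1.1 e.symm) rfl (x l)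

/-- The projection from `G_V` to the group of the contracted quiver. -/
def hatGrp {ν : Q.balanced c} (g : Grp p ν.1) : Grp p (hatDim hQ hc ν) := fun i => g i.1

theorem hatGrp_frob {ν : Q.balanced c} (g : Grp p ν.1) :
    frobGrp r (hatGrp hQ hc g) = hatGrp hQ hc (frobGrp r g) := rfl

theorem contractRep_frob {ν : Q.balanced c} (x : Rep p ν.1)
    (hx : x ∈ (heart Q p r c).carrier ν) :
    contractRep hQ hc (frobRep r x) = frobRep r (contractRep hQ hc x) := by
  have et := eq_symm Q.aE (m := fun h => ν.1.1 (Q.tgt h)) (tgt_inv ν.1)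
  have es := eq_symm Q.aE (m := fun h => ν.1.1 (Q.src h)) (src_inv ν.1)
  funext j
  cases j with
  | old h hs ht => rfl
  | post l h hh e =>
    have e' : Q.tgt (Q.aE.symm h) = Q.src (Q.aE.symm l) := by rw [tgt_symm, src_symm, e]
    change recast rfl (congrArg ν.1.1 e.symm) (frobRep r x l) * frobRep r x h =
      (recast (et l) (es h) (recast rfl (congrArg ν.1.1 e'.symm) (x (Q.aE.symm l)) *
        x (Q.aE.symm h))).map (Fr p r)
    rw [recast_mul (et l) (et h) (es h), map_mul_map]
    rfl
  | pre h l hh hl e =>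
    have e' : Q.tgt (Q.aE.symm h) = Q.tgt (Q.aE.symm l) := by rw [tgt_symm, tgt_symm, e]
    have hi := hx _ ((aE_symm_conE h).2 hh)
    change isoInv (frobRep r x h) * recast (congrArg ν.1.1 e.symm) rfl (frobRep r x l) =
      (recast (es h) (es l) (isoInv (x (Q.aE.symm h)) *
        recast (congrArg ν.1.1 e'.symm) rfl (x (Q.aE.symm l)))).map (Fr p r)
    rw [recast_mul (es h) (et h) (es l), map_mul_map, frobRep_apply x h,
      isoInv_map _ (isIsoMat_recast _ _ hi), isoInv_recast]
    rfl

theorem contractRep_act {ν : Q.balanced c} (g : Grp p ν.1) (x : Rep p ν.1)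
    (hx : x ∈ (heart Q p r c).carrier ν) :
    contractRep hQ hc (act g x) = act (hatGrp hQ hc g) (contractRep hQ hc x) := by
  funext j
  cases j with
  | old h hs ht => rfl
  | post l h hh e =>
    have ee := congrArg ν.1.1 e.symm
    have a : recast ee ee (g (Q.src l))⁻¹.1 = (g (Q.tgt h))⁻¹.1 :=
      recast_fam (fun i => (g i)⁻¹.1) e.symm ee ee
    have a2 : (g (Q.tgt h))⁻¹.1 * (g (Q.tgt h)).1 = 1 := Units.inv_mul _
    change recast rfl ee ((g (Q.tgt l)).1 * x l * (g (Q.src l))⁻¹.1) *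
        ((g (Q.tgt h)).1 * x h * (g (Q.src h))⁻¹.1) =
      (g (Q.tgt l)).1 * (recast rfl ee (x l) * x h) * (g (Q.src h))⁻¹.1
    rw [recast_mul rfl ee ee, recast_mul rfl rfl ee, a, recast_rfl]
    calc _ = (g (Q.tgt l)).1 * recast rfl ee (x l) * ((g (Q.tgt h))⁻¹.1 * (g (Q.tgt h)).1) *
          x h * (g (Q.src h))⁻¹.1 := by simp only [Matrix.mul_assoc]
      _ = _ := by rw [a2, Matrix.mul_one]; simp only [Matrix.mul_assoc]
  | pre h l hh hl e =>
    have ee := congrArg ν.1.1 e.symm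
    have a : recast ee ee (g (Q.tgt l)).1 = (g (Q.tgt h)).1 :=
      recast_fam (fun i => (g i).1) e.symm ee ee
    have a2 : (g (Q.tgt h))⁻¹.1 * (g (Q.tgt h)).1 = 1 := Units.inv_mul _
    change isoInv (act g x h) * recast ee rfl ((g (Q.tgt l)).1 * x l * (g (Q.src l))⁻¹.1) =
      (g (Q.src h)).1 * (isoInv (x h) * recast ee rfl (x l)) * (g (Q.src l))⁻¹.1
    rw [(isoInv_act g x h (hx h hh)).2, recast_mul ee rfl rfl, recast_mul ee ee rfl, a,
      recast_rfl]
    calc _ = (g (Q.src h)).1 * isoInv (x h) * ((g (Q.tgt h))⁻¹.1 * (g (Q.tgt h)).1) *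
          recast ee rfl (x l) * (g (Q.src l))⁻¹.1 := by simp only [Matrix.mul_assoc]
      _ = _ := by rw [a2, Matrix.mul_one]; simp only [Matrix.mul_assoc]

/-- The contraction map on rational points. -/
def contractPts {ν : Q.balanced c} (x : Pts r ((heart Q p r c).carrier ν)) :
    Pts r (Set.univ : Set (Rep p (hatDim hQ hc ν))) :=
  ⟨contractRep hQ hc x.1, trivial, by rw [← contractRep_frob hQ hc x.1 x.2.1, x.2.2]⟩

/-- The pull-back `μ_ν^*`. -/
def muPull (v : k) (ν : Q.balanced c) :
    HallPart v (fullLocus (Q.contract c hQ hc) p r ⊤) ⟨hatDim hQ hc ν, trivial⟩ →ₗ[k]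
      HallPart v (heart Q p r c) ν where
  toFun f := ⟨fun x => f.1 (contractPts hQ hc x), fun g hg x y hxy =>
    f.2 (hatGrp hQ hc g) (by rw [hatGrp_frob, hg]) (contractPts hQ hc x) (contractPts hQ hc y)
      ((congrArg (contractRep hQ hc) hxy).trans (contractRep_act hQ hc g x.1 x.2.1))⟩
  map_add' _ _ := rfl
  map_smul' _ _ := rfl

/-- `μ_ν^⋆ = v ^ (- ν_{i₋}² φ₁(i₋)) μ_ν^*`, where `φ₁(i₋)` is the size of `[i₋]`. -/
def muPart (v : k) (ν : Q.balanced c) :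
    HallPart v (fullLocus (Q.contract c hQ hc) p r ⊤) ⟨hatDim hQ hc ν, trivial⟩ →ₗ[k]
      HallPart v (heart Q p r c) ν :=
  v⁻¹ ^ ((ν.1.1 (Q.tgt c)) ^ 2 * (Q.minus c).ncard) • muPull hQ hc v ν

/-- `μ^⋆`, from the Hall algebra of the contracted quiver to the Hall algebra of `E^♡`. -/
def muStar (v : k) :
    Hall v (fullLocus (Q.contract c hQ hc) p r ⊤) →ₗ[k] Hall v (heart Q p r c) :=
  DirectSum.lmap (muPart hQ hc v) ∘ₗ
    { toFun := DFinsupp.comapDomain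
        (fun ν : Q.balanced c => (⟨hatDim hQ hc ν, trivial⟩ :
          (⊤ : AddSubmonoid (Q.contract c hQ hc).DimVec)))
        (fun _ _ h => hatDim_injective hQ hc (congrArg Subtype.val h))
      map_add' := fun f g => DFinsupp.comapDomain_add _ _ f g
      map_smul' := fun a f => DFinsupp.comapDomain_smul _ _ a f }

end Contraction

/-- A linear map between Hall algebras that is multiplicative and preserves the unit. -/
structure IsHallHom {A B : Type*} [NonUnitalNonAssocRing A] [NonUnitalNonAssocRing B] [One A]
    [One B] [Module k A] [Module k B] (f : A →ₗ[k] B) : Prop where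
  map_one : f 1 = 1
  map_mul : ∀ x y, f (x * y) = f x * f y

/-- The field `ℚ(v)` inside `ℂ`. -/
abbrev BaseField (v : ℂ) : Type := ↥(IntermediateField.adjoin ℚ {v})

/-- The generator `v` of `ℚ(v)`. -/
def root (v : ℂ) : BaseField v := IntermediateField.AdjoinSimple.gen ℚ v

section Names

variable [Fintype I] [Fintype Ω] (Q : AutQuiver I Ω) (c : Ω) (p r : ℕ) [Fact p.Prime] (v : ℂ)

/-- The Hall algebra `H` of a quiver with automorphism. -/
abbrev HallQ : Type _ := Hall (root v) (fullLocus Q p r ⊤)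

/-- `H_Î`: the part of `H` with dimension vectors in `ℕ[Î]`. -/
abbrev HallI : Type _ := Hall (root v) (fullLocus Q p r (Q.balanced c))

/-- `H^♡`: the Hall algebra of the locus where the contracted edges are isomorphisms. -/
abbrev HallHeart : Type _ := Hall (root v) (heart Q p r c)

/-- `H^c`: the invariant functions on the complement of that locus. -/
abbrev HallC : Type _ := HallCompl (BaseField v) (heart Q p r c)

/-- The inclusion of `H_Î` into `H`. -/
abbrev inclI : HallI Q c p r v →ₗ[BaseField v] HallQ Q p r v := incl (root v) (Q.balanced c)

/-- The inclusion of `H^c` into `H_Î` (extension by zero). -/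
abbrev iC : HallC Q c p r v →ₗ[BaseField v] HallI Q c p r v := iShriek (root v) (heart Q p r c)

/-- The restriction `j^* : H_Î → H^♡`. -/
abbrev jR : HallI Q c p r v →ₗ[BaseField v] HallHeart Q c p r v :=
  jStar (root v) (heart Q p r c)

/-- The extension by zero `j_! : H^♡ → H_Î`. -/
abbrev jE : HallHeart Q c p r v →ₗ[BaseField v] HallI Q c p r v :=
  jShriek (root v) (heart Q p r c)

/-- `μ^⋆ : Ĥ → H^♡`, where `Ĥ` is the Hall algebra of the contracted quiver. -/
abbrev muH (hQ : Q.Admissible) (hc : Q.Contractible c) :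
    HallQ (Q.contract c hQ hc) p r v →ₗ[BaseField v] HallHeart Q c p r v :=
  muStar hQ hc (root v)

end Names

end AutQuiver

end HallContraction

end

open scoped DirectSum

noncomputable section

namespace HallContraction

universe u w

/-! The proof rests on one description of the product. The fibre of `p₃ p₂` over a rational point
`x` is in bijection with the rational short exact sequences `0 → w → x → t → 0`, given by matrices
`A : W → V` and `B : V → T` fixed by the twisted Frobenius (`Locus.fibreEquiv`). Hence `f₁ ∘ f₂` at
`x` is, up to the scalar, the sum of `f₁(t) f₂(w)` over these sequences (`indFun_eq`). No theorem on
rational points of torsors is needed: an orbit `[g, x]` is determined by `g • x`, by `g` restricted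
to `W` and by `g⁻¹` projected to `T`, so it is rational as soon as these three are.

If `x` is in the heart, so are `t` and `w`; the sums over the heart and over the full space
therefore agree and `j^*` is multiplicative (`hallMul_restr`). By the five lemma the heart is also
closed under extensions (`heart_extClosed`), so a product of functions extended by zero vanishes off
the heart and `j_!` is multiplicative (`hallMul_extZero`). The functions supported on the complement
form the kernel of `j^*`, hence a two-sided ideal.

For the contraction, every `x` in the heart is `X • y` for unique `X` and `y`, where `X` lives at
the vertices of `[i₋]` and `y` has identity matrices at the contracted edges (`exists_normal_form`,
`normal_form_unique`); `y` is the same datum as the contracted representation. This makes the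
pull-back along `μ` bijective (`muPull_bijective`). A short exact sequence with middle term `y`
amounts to one for the contracted quiver together with rational elements of the groups of `T` and
`W` at `[i₋]` (`sesExtend_injective`, `sesExtend_surjective`). The sum therefore grows by the orders
of these two groups, which is exactly the ratio of the normalizing factors `#G_T #G_W` (`cardG_eq`).

The two exponents `m` differ by `2 τ₋ ω₋ #[i₋]`, one half from the vertices of `[i₋]` and one half
from the contracted edges (`mExp_eq`). This is the cross term of `(τ₋ + ω₋)² #[i₋]`, which is why
the power of `v` in `μ^⋆` makes it multiplicative (`muPart_hallMul`). The retraction onto the Hall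
algebra of the contracted quiver is `j^*` followed by the inverse of `μ^⋆`. -/

theorem recast_inj {R : Type*} {m n m' n' : ℕ} {hm hm₁ : m = m'} {hn hn₁ : n = n'}
    {x y : Matrix (Fin m) (Fin n) R} :
    recast hm hn x = recast hm₁ hn₁ y ↔ x = y := by
  subst hm hn; rfl

/-! ### Matrices related by a ring homomorphism, up to equal sizes -/

section RelBy

variable {R S : Type*} [CommRing R] [CommRing S]

/-- `y` is obtained from `x` by applying `σ` to the entries, up to a change of equal sizes. -/
def RelBy (σ : R →+* S) {m n m' n' : ℕ} (x : Matrix (Fin m) (Fin n) R)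
    (y : Matrix (Fin m') (Fin n') S) : Prop :=
  ∃ (hm : m = m') (hn : n = n'), y = (recast hm hn x).map σ

variable {σ : R →+* S} {m n k m' n' k' m₁ n₁ : ℕ}

theorem RelBy.mul {x : Matrix (Fin m) (Fin n) R} {y : Matrix (Fin n) (Fin k) R}
    {x' : Matrix (Fin m') (Fin n') S} {y' : Matrix (Fin n') (Fin k') S}
    (hx : RelBy σ x x') (hy : RelBy σ y y') : RelBy σ (x * y) (x' * y') := by
  obtain ⟨rfl, rfl, rfl⟩ := hx
  obtain ⟨_, rfl, rfl⟩ := hy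
  exact ⟨rfl, rfl, (map_mul_map σ x y).symm⟩

theorem RelBy.one (h : m = m') :
    RelBy σ (1 : Matrix (Fin m) (Fin m) R) (1 : Matrix (Fin m') (Fin m') S) := by
  subst h
  exact ⟨rfl, rfl, (one_map' σ).symm⟩

/-- Used to prove matrix identities on Frobenius translates: both sides are exhibited as images of
one and the same matrix. -/
theorem RelBy.unique {x : Matrix (Fin m) (Fin n) R} {y z : Matrix (Fin m') (Fin n') S}
    (hy : RelBy σ x y) (hz : RelBy σ x z) : y = z := by
  obtain ⟨_, _, rfl⟩ := hy
  obtain ⟨_, _, rfl⟩ := hz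
  rfl

theorem RelBy.recast_left {x : Matrix (Fin m) (Fin n) R} {y : Matrix (Fin m') (Fin n') S}
    (h : RelBy σ x y) (hm : m = m₁) (hn : n = n₁) : RelBy σ (recast hm hn x) y := by
  subst hm hn; exact h

theorem RelBy.recast_right {x : Matrix (Fin m) (Fin n) R} {y : Matrix (Fin m') (Fin n') S}
    (h : RelBy σ x y) (hm : m' = m₁) (hn : n' = n₁) : RelBy σ x (recast hm hn y) := by
  subst hm hn; exact h

theorem RelBy.fam {α : Type*} {s t : α → ℕ} {z : ∀ j, Matrix (Fin (s j)) (Fin (t j)) S}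
    {x : Matrix (Fin m) (Fin n) R} {i j : α} (e : i = j) (h : RelBy σ x (z i)) :
    RelBy σ x (z j) := e ▸ h

theorem recast_mul_recast (hm : m = m') (hn hn₁ : n = n') (hk : k = k')
    (x : Matrix (Fin m) (Fin n) R) (y : Matrix (Fin n) (Fin k) R) :
    recast hm hn x * recast hn₁ hk y = recast hm hk (x * y) := by
  subst hm hn hk; rfl

theorem recast_one_mul (hm : k = m) (hn : k = n) (x : Matrix (Fin n) (Fin n') R) :
    recast hm hn 1 * x = recast (hn.symm.trans hm) rfl x := by
  subst hm hn; exact Matrix.one_mul x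

theorem mul_recast_one (hm : k = n) (hn : k = m) (x : Matrix (Fin n') (Fin n) R) :
    x * recast hm hn 1 = recast rfl (hm.symm.trans hn) x := by
  subst hm hn; exact Matrix.mul_one x

theorem isIsoMat_recast_one (hm : k = m) (hn : k = n) :
    IsIsoMat (recast hm hn (1 : Matrix (Fin k) (Fin k) R)) :=
  isIsoMat_recast _ _ ⟨1, Matrix.one_mul _, Matrix.one_mul _⟩

end RelBy

/-- Comparing the members at `j` and `a j` avoids `a.symm` and turns rationality into a relation
that is stable under products, units and change of sizes. -/
theorem frobFam_eq_iff {p r : ℕ} [Fact p.Prime] {α : Type*} {a : Equiv.Perm α} {m n : α → ℕ}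
    {hm : ∀ j, m (a j) = m j} {hn : ∀ j, n (a j) = n j} {z : Fam p m n} :
    frobFam p r a hm hn z = z ↔ ∀ j, RelBy (Fr p r) (z j) (z (a j)) := by
  constructor
  · intro h j
    exact ⟨(hm j).symm, (hn j).symm, by conv_lhs => rw [← h, frobFam_apply]⟩
  · intro h
    funext j
    obtain ⟨i, rfl⟩ := a.surjective j
    rw [frobFam_apply]
    obtain ⟨_, _, e⟩ := h i
    exact e.symm

/-! ## Split exact pairs of matrices -/

/-- The sequence `0 → W → V → T → 0` given by `A` and `B` is (split) exact. -/
def SplitExact {K : Type*} [CommRing K] {n m m' : ℕ} (A : Matrix (Fin n) (Fin m') K)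
    (B : Matrix (Fin m) (Fin n) K) : Prop :=
  B * A = 0 ∧ ∃ (C : Matrix (Fin n) (Fin m) K) (D : Matrix (Fin m') (Fin n) K),
    B * C = 1 ∧ D * A = 1 ∧ C * B + A * D = 1

section SplitExact

variable {K : Type*} [CommRing K] {n m m' : ℕ} {A : Matrix (Fin n) (Fin m') K}
  {B : Matrix (Fin m) (Fin n) K}

/-- The splitting provides a left inverse `D` of `A`; this is what determines the subrepresentation
once `A` is known. -/
theorem SplitExact.left_cancel (h : SplitExact A B) {k : ℕ} {y z : Matrix (Fin m') (Fin k) K}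
    (e : A * y = A * z) : y = z := by
  obtain ⟨-, C, D, -, h2, -⟩ := h
  rw [← Matrix.one_mul y, ← Matrix.one_mul z, ← h2, Matrix.mul_assoc, Matrix.mul_assoc, e]

theorem SplitExact.right_cancel (h : SplitExact A B) {k : ℕ} {y z : Matrix (Fin k) (Fin m) K}
    (e : y * B = z * B) : y = z := by
  obtain ⟨-, C, D, h1, -, -⟩ := h
  rw [← Matrix.mul_one y, ← Matrix.mul_one z, ← h1, ← Matrix.mul_assoc, ← Matrix.mul_assoc, e]

theorem SplitExact.recast (h : SplitExact A B) {n₁ m₁ m₁' : ℕ} (e₁ e₁' : n = n₁) (e₂ : m = m₁)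
    (e₃ : m' = m₁') : SplitExact (recast e₁ e₃ A) (recast e₂ e₁' B) := by
  subst e₁ e₂ e₃; exact h

theorem SplitExact.conj (h : SplitExact A B) {a a' : Matrix (Fin m) (Fin m) K}
    {b b' : Matrix (Fin m') (Fin m') K} (ha : a * a' = 1) (hb : b * b' = 1) :
    SplitExact (A * b) (a * B) := by
  obtain ⟨h0, C, D, h1, h2, h3⟩ := h
  have ha' := mul_eq_one_comm.1 ha
  have hb' := mul_eq_one_comm.1 hb
  refine ⟨?_, C * a', b' * D, ?_, ?_, ?_⟩
  · rw [Matrix.mul_assoc, ← Matrix.mul_assoc B, h0, Matrix.zero_mul, Matrix.mul_zero]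
  · rw [Matrix.mul_assoc, ← Matrix.mul_assoc B, h1, Matrix.one_mul, ha]
  · rw [Matrix.mul_assoc, ← Matrix.mul_assoc D, h2, Matrix.one_mul, hb']
  · rw [Matrix.mul_assoc, ← Matrix.mul_assoc a', ha', Matrix.one_mul, Matrix.mul_assoc,
      ← Matrix.mul_assoc b, hb, Matrix.one_mul, h3]

/-- A map of short exact sequences whose outer members are isomorphisms is an isomorphism. -/
theorem SplitExact.isIsoMat {n₁ m₁ m₁' : ℕ} (e : n₁ = n) {A₁ : Matrix (Fin n₁) (Fin m₁') K}
    {B₁ : Matrix (Fin m₁) (Fin n₁) K} (h : SplitExact A B) (h' : SplitExact A₁ B₁)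
    {x : Matrix (Fin n₁) (Fin n) K} {t : Matrix (Fin m₁) (Fin m) K}
    {w : Matrix (Fin m₁') (Fin m') K} (hA : x * A = A₁ * w) (hB : t * B = B₁ * x)
    (ht : IsIsoMat t) (hw : IsIsoMat w) : IsIsoMat x := by
  subst e
  obtain ⟨t', -, ht⟩ := ht
  obtain ⟨w', -, hw⟩ := hw
  obtain ⟨-, C, D, h1, h2, h3⟩ := h
  obtain ⟨-, C₁, D₁, h1', h2', h3'⟩ := h'
  -- The left inverse of `x` is assembled from the splittings. The term `C t' B₁` inverts `x` modulo
  -- the image of `A`. The remainder `(1 - x C t' B₁) x = x A D` equals `A₁ w D`, and `A w' D₁`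
  -- takes this back to `A D`; finally `A D + C B = 1`.
  have hCB : 1 - C * B = A * D := by rw [← h3]; abel
  have key : (A * w' * D₁ * (1 - x * C * t' * B₁) + C * t' * B₁) * x = 1 := by
    have e1 : C * t' * B₁ * x = C * B := by
      rw [Matrix.mul_assoc, ← hB, ← Matrix.mul_assoc, Matrix.mul_assoc C, ht, Matrix.mul_one]
    have e2 : (1 - x * C * t' * B₁) * x = x * (A * D) := by
      rw [← hCB, Matrix.sub_mul, Matrix.mul_sub, Matrix.one_mul, Matrix.mul_one, ← e1]
      simp only [Matrix.mul_assoc]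
    calc _ = A * w' * D₁ * ((1 - x * C * t' * B₁) * x) + C * t' * B₁ * x := by
          rw [Matrix.add_mul, Matrix.mul_assoc]
      _ = A * (w' * ((D₁ * A₁) * w)) * D + C * B := by
          rw [e1, e2, ← Matrix.mul_assoc x, hA]
          simp only [Matrix.mul_assoc]
      _ = 1 := by rw [h2', Matrix.one_mul, hw, Matrix.mul_one, add_comm, h3]
  -- After `subst e` the matrix `x` is square, so a left inverse is enough.
  exact ⟨_, mul_eq_one_comm.1 key, key⟩

end SplitExact

/-! ### Rational points of groups and of representation spaces -/

namespace AutQuiver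

variable {I : Type u} {Ω : Type w} {Q : AutQuiver I Ω} {p r : ℕ} [Fact p.Prime]

theorem frobGrp_eq_iff {ν : Q.DimVec} {g : Grp p ν} :
    frobGrp r g = g ↔ ∀ i, RelBy (Fr p r) (g i).1 (g (Q.aV i)).1 := by
  refine Iff.trans ?_ (frobFam_eq_iff (hm := ν.2) (hn := ν.2) (z := fun i => (g i).1))
  constructor
  · intro h
    funext i
    exact congrArg Units.val (congrFun h i)
  · intro h
    funext i
    exact Units.ext (congrFun h i)

theorem frobRep_eq_iff {ν : Q.DimVec} {x : Rep p ν} :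
    frobRep r x = x ↔ ∀ h, RelBy (Fr p r) (x h) (x (Q.aE h)) := frobFam_eq_iff

theorem frobGrp_fixed_inv {ν : Q.DimVec} {g : Grp p ν} (h : frobGrp r g = g) :
    frobGrp r g⁻¹ = g⁻¹ := by
  rw [frobGrp_inv, h]

theorem frobGrp_one {ν : Q.DimVec} : frobGrp r (1 : Grp p ν) = 1 :=
  frobGrp_eq_iff.2 fun i => RelBy.one (ν.2 i).symm

theorem finite_grp [Finite I] [NeZero r] (ν : Q.DimVec) :
    Finite {g : Grp p ν // frobGrp r g = g} := by
  have := finite_frobFam p r Q.aV ν.2 ν.2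
  refine Finite.of_injective (fun g : {g : Grp p ν // frobGrp r g = g} =>
    (⟨fun i => (g.1 i).1, frobFam_eq_iff.2 (frobGrp_eq_iff.1 g.2)⟩ :
      {z // frobFam p r Q.aV ν.2 ν.2 z = z})) ?_
  intro g g' h
  refine Subtype.ext (funext fun i => Units.ext ?_)
  exact congrFun (congrArg Subtype.val h) i

/-! ## Rational short exact sequences of representations -/

/-- `A` and `B` define a short exact sequence `0 → w → x → t → 0` of representations, rational
with respect to the twisted Frobenius. -/
structure IsSES (r : ℕ) {ν τ ω : Q.DimVec} (x : Rep p ν) (A : Fam p ν.1 ω.1) (B : Fam p τ.1 ν.1)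
    (t : Rep p τ) (w : Rep p ω) : Prop where
  exact : ∀ i, SplitExact (A i) (B i)
  sub : ∀ h, x h * A (Q.src h) = A (Q.tgt h) * w h
  quot : ∀ h, t h * B (Q.src h) = B (Q.tgt h) * x h
  frobA : ∀ i, RelBy (Fr p r) (A i) (A (Q.aV i))
  frobB : ∀ i, RelBy (Fr p r) (B i) (B (Q.aV i))

/-- The rational short exact sequences with middle term `x` and outer terms of dimensions
`ω` and `τ`. -/
abbrev SES (r : ℕ) {ν : Q.DimVec} (τ ω : Q.DimVec) (x : Rep p ν) : Type _ :=
  {s : Fam p ν.1 ω.1 × Fam p τ.1 ν.1 × Rep p τ × Rep p ω // IsSES r x s.1 s.2.1 s.2.2.1 s.2.2.2}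

section

variable {ν τ ω : Q.DimVec} {x : Rep p ν} {A : Fam p ν.1 ω.1} {B : Fam p τ.1 ν.1}
  {t : Rep p τ} {w : Rep p ω}

/-- Both `w` at `a h` and the Frobenius image of `w` at `h` become the image of `x A` after
multiplication by `A`, and `A` can be cancelled on the left. So rationality of the outer terms need
not be part of the definition of a rational sequence. -/
theorem IsSES.frob_sub (s : IsSES r x A B t w) (hx : frobRep r x = x) : frobRep r w = w := by
  rw [frobRep_eq_iff] at hx ⊢
  intro h
  have e1 : RelBy (Fr p r) (A (Q.tgt h)) (A (Q.tgt (Q.aE h))) :=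
    RelBy.fam (Q.tgt_aE h).symm (s.frobA _)
  have e2 : RelBy (Fr p r) (A (Q.src h)) (A (Q.src (Q.aE h))) :=
    RelBy.fam (Q.src_aE h).symm (s.frobA _)
  refine ⟨(tgt_inv ω h).symm, (src_inv ω h).symm, (s.exact _).left_cancel ?_⟩
  rw [← s.sub]
  refine ((hx h).mul e2).unique ?_
  rw [s.sub]
  exact e1.mul ⟨_, _, rfl⟩

theorem IsSES.frob_quot (s : IsSES r x A B t w) (hx : frobRep r x = x) : frobRep r t = t := by
  rw [frobRep_eq_iff] at hx ⊢
  intro h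
  have e1 : RelBy (Fr p r) (B (Q.tgt h)) (B (Q.tgt (Q.aE h))) :=
    RelBy.fam (Q.tgt_aE h).symm (s.frobB _)
  have e2 : RelBy (Fr p r) (B (Q.src h)) (B (Q.src (Q.aE h))) :=
    RelBy.fam (Q.src_aE h).symm (s.frobB _)
  refine ⟨(tgt_inv τ h).symm, (src_inv τ h).symm, (s.exact _).right_cancel ?_⟩
  rw [s.quot]
  refine (e1.mul (hx h)).unique ?_
  rw [← s.quot]
  exact RelBy.mul ⟨_, _, rfl⟩ e2

/-- `A` is a split injection and `B` a split surjection, so a short exact sequence with given middle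
term is really just the pair `(A, B)`. -/
theorem IsSES.unique (s : IsSES r x A B t w) {t' : Rep p τ} {w' : Rep p ω}
    (s' : IsSES r x A B t' w') : t = t' ∧ w = w' :=
  ⟨funext fun h => (s.exact _).right_cancel ((s.quot h).trans (s'.quot h).symm),
    funext fun h => (s.exact _).left_cancel ((s.sub h).symm.trans (s'.sub h))⟩

/-- The groups of the outer terms act on short exact sequences. -/
theorem IsSES.conj (s : IsSES r x A B t w) {a : Grp p τ} {b : Grp p ω} (ha : frobGrp r a = a)
    (hb : frobGrp r b = b) :
    IsSES r x (fun i => A i * (b i)⁻¹.1) (fun i => (a i).1 * B i) (act a t) (act b w) where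
  exact i := (s.exact i).conj (Units.mul_inv (a i)) (Units.inv_mul (b i))
  sub h := by
    have e : (b (Q.tgt h))⁻¹.1 * (b (Q.tgt h)).1 = 1 := Units.inv_mul _
    simp only [act]
    rw [← Matrix.mul_assoc, s.sub, Matrix.mul_assoc (b (Q.tgt h)).1,
      Matrix.mul_assoc (A (Q.tgt h)) (b (Q.tgt h))⁻¹.1, ← Matrix.mul_assoc (b (Q.tgt h))⁻¹.1,
      e, Matrix.one_mul, Matrix.mul_assoc]
  quot h := by
    have e : (a (Q.src h))⁻¹.1 * (a (Q.src h)).1 = 1 := Units.inv_mul _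
    simp only [act]
    rw [Matrix.mul_assoc, ← Matrix.mul_assoc (a (Q.src h))⁻¹.1, e, Matrix.one_mul,
      Matrix.mul_assoc, s.quot, Matrix.mul_assoc]
  frobA i := (s.frobA i).mul (frobGrp_eq_iff.1 (frobGrp_fixed_inv hb) i)
  frobB i := (frobGrp_eq_iff.1 ha i).mul (s.frobB i)

end

end AutQuiver

/-! ## Block matrices and short exact sequences -/

section Blocks

variable {p : ℕ} [Fact p.Prime] {N M m m' n n' : ℕ}

theorem blkTW_mul_mul (a : Matrix (Fin (m + m')) (Fin N) (Kbar p))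
    (x : Matrix (Fin N) (Fin M) (Kbar p)) (b : Matrix (Fin M) (Fin (n + n')) (Kbar p)) :
    blkTW (a * x * b) = AutQuiver.Locus.rowT a * x * AutQuiver.Locus.colW b := rfl

/-- The summation over the middle index is split into its `T`-part and its `W`-part. -/
theorem mul_eq_blk_add (g : Matrix (Fin N) (Fin (m + m')) (Kbar p))
    (g' : Matrix (Fin (m + m')) (Fin M) (Kbar p)) :
    g * g' = g.submatrix id (Fin.castAdd m') * AutQuiver.Locus.rowT g' +
      AutQuiver.Locus.colW g * g'.submatrix (Fin.natAdd m) id := by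
  ext i j
  simp [AutQuiver.Locus.rowT, AutQuiver.Locus.colW, Matrix.mul_apply, Fin.sum_univ_add]

/-- The splitting consists of the remaining columns of `g` and the remaining rows of `g'`; the
identities are the blocks of `g' g = 1` together with `g g' = 1`. -/
theorem splitExact_of_unit {g g' : Matrix (Fin (m + m')) (Fin (m + m')) (Kbar p)}
    (h : g * g' = 1) :
    SplitExact (AutQuiver.Locus.colW g) (AutQuiver.Locus.rowT g') := by
  have h' := mul_eq_one_comm.1 h
  refine ⟨?_, g.submatrix id (Fin.castAdd m'), g'.submatrix (Fin.natAdd m) id, ?_, ?_, ?_⟩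
  · exact (congrArg blkTW h').trans blkTW_one
  · exact (congrArg blkTT h').trans blkTT_one
  · exact (congrArg blkWW h').trans blkWW_one
  · rw [← mul_eq_blk_add, h]

/-- Put `C` and `A` side by side to get `g`, and `B` above `D` to get its inverse: `g g' = C B + A D
= 1`. -/
theorem SplitExact.exists_unit {A : Matrix (Fin (m + m')) (Fin m') (Kbar p)}
    {B : Matrix (Fin m) (Fin (m + m')) (Kbar p)} (h : SplitExact A B) :
    ∃ g : GL (Fin (m + m')) (Kbar p), AutQuiver.Locus.colW g.1 = A ∧
      AutQuiver.Locus.rowT g⁻¹.1 = B := by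
  obtain ⟨-, C, D, -, -, h3⟩ := h
  let g : Matrix (Fin (m + m')) (Fin (m + m')) (Kbar p) := Matrix.of fun i j =>
    Fin.addCases (fun j => C i j) (fun j => A i j) j
  let g' : Matrix (Fin (m + m')) (Fin (m + m')) (Kbar p) := Matrix.of fun i j =>
    Fin.addCases (fun i => B i j) (fun i => D i j) i
  have e1 : AutQuiver.Locus.colW g = A := by ext i j; simp [g, AutQuiver.Locus.colW]
  have e2 : AutQuiver.Locus.rowT g' = B := by ext i j; simp [g', AutQuiver.Locus.rowT]
  have e3 : g.submatrix id (Fin.castAdd m') = C := by ext i j; simp [g]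
  have e4 : g'.submatrix (Fin.natAdd m) id = D := by ext i j; simp [g']
  have e : g * g' = 1 := by rw [mul_eq_blk_add, e1, e2, e3, e4, h3]
  exact ⟨⟨g, g', e, mul_eq_one_comm.1 e⟩, e1, e2⟩

/-- The columns of a block triangular matrix. -/
theorem mul_colW_of_blkTW (g : Matrix (Fin N) (Fin (m + m')) (Kbar p))
    {x : Matrix (Fin (m + m')) (Fin (n + n')) (Kbar p)} (hx : blkTW x = 0) :
    g * AutQuiver.Locus.colW x = AutQuiver.Locus.colW g * blkWW x := by
  rw [mul_eq_blk_add g (AutQuiver.Locus.colW x)]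
  have : AutQuiver.Locus.rowT (AutQuiver.Locus.colW x) = 0 := hx
  rw [this, Matrix.mul_zero, zero_add]
  rfl

theorem rowT_mul_of_blkTW {x : Matrix (Fin (m + m')) (Fin (n + n')) (Kbar p)}
    (g : Matrix (Fin (n + n')) (Fin N) (Kbar p)) (hx : blkTW x = 0) :
    AutQuiver.Locus.rowT x * g = blkTT x * AutQuiver.Locus.rowT g := by
  rw [mul_eq_blk_add (AutQuiver.Locus.rowT x) g]
  have : AutQuiver.Locus.colW (AutQuiver.Locus.rowT x) = 0 := hx
  rw [this, Matrix.zero_mul, add_zero]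
  rfl

/-- If `x` preserves `W`, then `g x k'` preserves the translated subspaces, and its induced maps,
read through `colW` and `rowT`, are the diagonal blocks of `x`. These are the intertwining relations
of the sequence attached to `[g, x]`. -/
theorem conj_mul_colW {g g' : Matrix (Fin (m + m')) (Fin (m + m')) (Kbar p)}
    {k k' : Matrix (Fin (n + n')) (Fin (n + n')) (Kbar p)} (hk : k' * k = 1)
    {x : Matrix (Fin (m + m')) (Fin (n + n')) (Kbar p)} (hx : blkTW x = 0) (hg : g' * g = 1) :
    g * x * k' * AutQuiver.Locus.colW k = AutQuiver.Locus.colW g * blkWW x ∧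
    blkTT x * AutQuiver.Locus.rowT k' = AutQuiver.Locus.rowT g' * (g * x * k') := by
  constructor
  · rw [← AutQuiver.Locus.colW_mul, Matrix.mul_assoc, hk, Matrix.mul_one,
      AutQuiver.Locus.colW_mul, mul_colW_of_blkTW g hx]
  · rw [← AutQuiver.Locus.rowT_mul, Matrix.mul_assoc g, ← Matrix.mul_assoc g', hg,
      Matrix.one_mul, AutQuiver.Locus.rowT_mul, rowT_mul_of_blkTW k' hx]

end Blocks

namespace AutQuiver

variable {I : Type u} {Ω : Type w} {Q : AutQuiver I Ω} {p r : ℕ} [Fact p.Prime]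
  {D : AddSubmonoid Q.DimVec}

namespace Locus

variable (L : Locus Q p r D) {τ ω : D}

theorem isSES_ind (y : L.Ind (unip p τ.1 ω.1))
    (hy : L.frobInd _ (fun _ => frobGrp_unip r) y = y) :
    IsSES r (L.ev _ y) (L.famA y) (L.famB y) (L.preT y) (L.preW y) := by
  have hA := frobFam_eq_iff.1 ((L.fam_frob y).1.symm.trans (congrArg L.famA hy))
  have hB := frobFam_eq_iff.1 ((L.fam_frob y).2.symm.trans (congrArg L.famB hy))
  -- The rationality of `A` and `B` is extracted at the level of the orbit, before a representative
  -- is chosen, because the representative itself need not be rational.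
  clear hy
  induction y using Quotient.inductionOn with
  | h y =>
    refine ⟨fun i => ?_, fun h => ?_, fun h => ?_, hA, hB⟩
    · exact splitExact_of_unit (m := τ.1.1 i) (m' := ω.1.1 i) (Units.mul_inv (y.1 i))
    · exact (conj_mul_colW (m := τ.1.1 (Q.tgt h)) (m' := ω.1.1 (Q.tgt h))
        (n := τ.1.1 (Q.src h)) (n' := ω.1.1 (Q.src h)) (Units.inv_mul (y.1 (Q.src h)))
        (y.2.2.1 h) (Units.inv_mul (y.1 (Q.tgt h)))).1
    · exact (conj_mul_colW (m := τ.1.1 (Q.tgt h)) (m' := ω.1.1 (Q.tgt h))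
        (n := τ.1.1 (Q.src h)) (n' := ω.1.1 (Q.src h)) (Units.inv_mul (y.1 (Q.src h)))
        (y.2.2.1 h) (Units.inv_mul (y.1 (Q.tgt h)))).2

/-- A splitting gives some `g` with the prescribed `A` and `B`, not necessarily rational, and `[g,
g⁻¹ • x]` is the orbit sought. Its rationality follows from `fam_inj`, since the three invariants
that determine an orbit are all fixed by the Frobenius. -/
theorem exists_ind (x : Rep p (τ.1 + ω.1)) (hx : x ∈ L.carrier (τ + ω)) (hF : frobRep r x = x)
    {A : Fam p (τ.1 + ω.1).1 ω.1.1} {B : Fam p τ.1.1 (τ.1 + ω.1).1} {t : Rep p τ.1}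
    {w : Rep p ω.1} (s : IsSES r x A B t w) :
    ∃ y : L.E1F τ ω, L.ev _ y.1 = x ∧ L.famA y.1 = A ∧ L.famB y.1 = B := by
  have hg : ∀ i, ∃ g : GL (Fin (τ.1.1 i + ω.1.1 i)) (Kbar p), colW g.1 = A i ∧
      rowT g⁻¹.1 = B i := fun i =>
    SplitExact.exists_unit (m := τ.1.1 i) (m' := ω.1.1 i) (s.exact i)
  choose g hgA hgB using hg
  let g' : Grp p (τ.1 + ω.1) := g
  have hst : Stab (act g'⁻¹ x) := by
    intro h
    refine (blkTW_mul_mul (m := τ.1.1 (Q.tgt h)) (m' := ω.1.1 (Q.tgt h)) (n := τ.1.1 (Q.src h))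
      (n' := ω.1.1 (Q.src h)) (g (Q.tgt h))⁻¹.1 (x h) ((g'⁻¹) (Q.src h))⁻¹.1).trans ?_
    rw [hgB]
    have : colW (m := τ.1.1 (Q.src h)) (m' := ω.1.1 (Q.src h)) ((g'⁻¹) (Q.src h))⁻¹.1 =
        A (Q.src h) := by
      rw [← hgA, Pi.inv_apply, inv_inv]
    rw [this]
    -- The component of `g⁻¹ x g` from `W` to `T` is `B x A = B A w = 0`.
    refine (Matrix.mul_assoc _ _ _).trans ?_
    rw [s.sub, ← Matrix.mul_assoc, (s.exact _).1, Matrix.zero_mul]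
  let z : L.Pre τ ω := (g', ⟨act g'⁻¹ x, hst, L.act_mem _ _ _ hx⟩)
  let y : L.Ind (unip p τ.1 ω.1) := Quotient.mk _ z
  have e1 : L.ev _ y = x := by
    change act g' (act g'⁻¹ x) = x
    rw [← act_mul, mul_inv_cancel, act_one]
  have e2 : L.famA y = A := funext hgA
  have e3 : L.famB y = B := funext hgB
  refine ⟨⟨y, L.fam_inj _ _ ?_ ?_ ?_⟩, e1, e2, e3⟩
  · rw [L.ev_frob, e1, hF]
  · rw [(L.fam_frob y).1, e2]
    exact frobFam_eq_iff.2 s.frobA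
  · rw [(L.fam_frob y).2, e3]
    exact frobFam_eq_iff.2 s.frobB

/-- The outer terms of a short exact sequence with middle term in a locus are in the locus. -/
theorem mem_of_isSES {x : Rep p (τ.1 + ω.1)} (hx : x ∈ L.carrier (τ + ω)) (hF : frobRep r x = x)
    {A : Fam p (τ.1 + ω.1).1 ω.1.1} {B : Fam p τ.1.1 (τ.1 + ω.1).1} {t : Rep p τ.1}
    {w : Rep p ω.1} (s : IsSES r x A B t w) : t ∈ L.carrier τ ∧ w ∈ L.carrier ω := by
  obtain ⟨y, rfl, rfl, rfl⟩ := L.exists_ind x hx hF s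
  obtain ⟨rfl, rfl⟩ := (L.isSES_ind y.1 y.2).unique s
  exact L.pre_mem y.1

/-- The fibre of `p₃ p₂` over a rational point is the set of short exact sequences. -/
def fibreEquiv (x : Pts r (L.carrier (τ + ω))) :
    {y : L.E1F τ ω // L.p3 (L.p2 y) = x} ≃ SES r τ.1 ω.1 (ν := τ.1 + ω.1) x.1 :=
  have hev : ∀ y : L.E1F τ ω, L.ev _ y.1 = (L.p3 (L.p2 y)).1 := fun y => by
    change L.ev _ y.1 = L.ev _ (L.proj y.1)
    induction y.1 using Quotient.inductionOn with
    | h y => rfl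
  Equiv.ofBijective (fun y => ⟨(L.famA y.1.1, L.famB y.1.1, L.preT y.1.1, L.preW y.1.1), by
      have h := L.isSES_ind y.1.1 y.1.2
      rwa [hev, y.2] at h⟩) (by
    constructor
    · intro y z h
      have h' := congrArg Subtype.val h
      simp only [Prod.mk.injEq] at h'
      refine Subtype.ext (Subtype.ext (L.fam_inj _ _ ?_ h'.1 h'.2.1))
      rw [hev, hev, y.2, z.2]
    · rintro ⟨⟨A, B, t, w⟩, s⟩
      obtain ⟨y, h1, rfl, rfl⟩ := L.exists_ind x.1 x.2.1 x.2.2 s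
      -- The orbit was constructed from `A` and `B` only; uniqueness of the outer terms identifies
      -- `t` and `w`.
      have hy := L.isSES_ind y.1 y.2
      rw [h1] at hy
      obtain ⟨rfl, rfl⟩ := hy.unique s
      exact ⟨⟨y, Subtype.ext ((hev y).symm.trans h1)⟩, rfl⟩)

end Locus

/-! ## The product in terms of short exact sequences -/

open Classical in
/-- The extension by zero of a function on rational points to the whole representation space. -/
def zeroExt {k : Type*} [Field k] {ν : Q.DimVec} {X : Set (Rep p ν)} (f : Pts r X → k)
    (x : Rep p ν) : k :=
  if h : x ∈ X ∧ frobRep r x = x then f ⟨x, h⟩ else 0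

theorem push_push {k : Type*} [Field k] {X Y Z : Type*} [Finite X] (φ : X → Y) (ψ : Y → Z)
    (f : X → k) (z : Z) : push ψ (push φ f) z = ∑ᶠ x : {x // ψ (φ x) = z}, f x := by
  classical
  have := Fintype.ofFinite X
  refine Eq.trans ?_ (finsum_set_coe_eq_finsum_mem {x | ψ (φ x) = z} (f := f)).symm
  simp only [push]
  -- `Y` may be infinite, but the inner push-forward vanishes off the image of `φ`, so the outer sum
  -- runs over a finite set.
  rw [finsum_mem_eq_sum_of_inter_support_eq
    (t := (Finset.univ.image φ).filter (fun y => ψ y = z))]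
  · have h2 : ∀ (P : X → Prop) [DecidablePred P], (∑ᶠ (x) (_ : P x), f x) =
        ∑ x with P x, f x := fun P _ => by
      rw [← finsum_mem_finset_eq_sum]
      simp
    rw [h2]
    have h3 : ∀ y, (∑ᶠ x ∈ φ ⁻¹' {y}, f x) = ∑ x with φ x = y, f x := fun y => h2 _
    simp only [h3]
    rw [Finset.sum_sigma']
    refine Finset.sum_bij' (fun a _ => a.2) (fun x _ => ⟨φ x, x⟩) ?_ ?_ ?_ ?_ ?_ <;> aesop
  · ext y
    simp only [Set.mem_inter_iff, Set.mem_preimage, Set.mem_singleton_iff, Finset.coe_filter,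
      Finset.mem_image, Finset.mem_univ, true_and, Set.mem_ofPred_eq, Function.mem_support]
    constructor
    · rintro ⟨h1, h2⟩
      obtain ⟨x, hx, -⟩ := exists_ne_zero_of_finsum_mem_ne_zero h2
      exact ⟨⟨⟨x, hx⟩, h1⟩, h2⟩
    · rintro ⟨⟨-, h1⟩, h2⟩
      exact ⟨h1, h2⟩

theorem zeroExt_apply {k : Type*} [Field k] {ν : Q.DimVec} {X : Set (Rep p ν)} (f : Pts r X → k)
    (x : Pts r X) : zeroExt f x.1 = f x := dif_pos x.2

theorem zeroExt_of_notMem {k : Type*} [Field k] {ν : Q.DimVec} {X : Set (Rep p ν)}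
    (f : Pts r X → k) {x : Rep p ν} (hx : x ∉ X) : zeroExt f x = 0 := dif_neg fun h => hx h.1

/-- The working form of the product. The index set depends only on the representation `x`, not on
the locus, and `zeroExt` removes the membership proofs, so that products on different loci can be
compared term by term. -/
theorem indFun_eq [Finite I] [Finite Ω] [NeZero r] {k : Type*} [Field k] (L : Locus Q p r D)
    {τ ω : D} (f₁ : Pts r (L.carrier τ) → k) (f₂ : Pts r (L.carrier ω) → k)
    (x : Pts r (L.carrier (τ + ω))) :
    indFun L f₁ f₂ x = ∑ᶠ s : SES r τ.1 ω.1 (ν := τ.1 + ω.1) x.1,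
      zeroExt f₁ s.1.2.2.1 * zeroExt f₂ s.1.2.2.2 := by
  have := L.finite_E1F (τ := τ) (ω := ω)
  rw [indFun, push_push, ← finsum_comp_equiv (L.fibreEquiv x)]
  refine finsum_congr fun y => ?_
  rw [← zeroExt_apply f₁, ← zeroExt_apply f₂]
  rfl

/-- The matrices `A` and `B` are fixed points of twisted Frobenius maps, hence finite in number, and
they determine the outer terms. -/
theorem finite_SES [Finite I] [NeZero r] {ν τ ω : Q.DimVec} (x : Rep p ν) :
    Finite (SES r τ ω x) := by
  have f2 := finite_frobFam p r Q.aV ν.2 ω.2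
  have f3 := finite_frobFam p r Q.aV τ.2 ν.2
  refine Finite.of_injective (fun s : SES r τ ω x =>
    ((⟨s.1.1, frobFam_eq_iff.2 s.2.frobA⟩, ⟨s.1.2.1, frobFam_eq_iff.2 s.2.frobB⟩) :
      {z // frobFam p r Q.aV ν.2 ω.2 z = z} × {z // frobFam p r Q.aV τ.2 ν.2 z = z})) ?_
  rintro ⟨⟨A, B, t, w⟩, s⟩ ⟨⟨A', B', t', w'⟩, s'⟩ h
  simp only [Prod.mk.injEq, Subtype.mk.injEq] at h
  obtain ⟨rfl, rfl⟩ := h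
  obtain ⟨rfl, rfl⟩ := s.unique s'
  rfl

end AutQuiver

/-! ### Change of sizes inside products -/

theorem recast_mul_eq_mul_recast {R : Type*} [CommRing R] {a b b' d : ℕ} (e₁ : b = b') (e₂ : d = b)
    (y : Matrix (Fin a) (Fin b) R) (z : Matrix (Fin b') (Fin d) R) :
    recast rfl e₂ (recast rfl e₁ y * z) = y * recast e₁.symm e₂ z := by
  subst e₁ e₂; rfl

/-- This is `x_h (x_h⁻¹ x_l) = x_l` with all changes of size made explicit, for an edge `l` ending
in `[i₋]`. -/
theorem recast_recast_mul_eq {R : Type*} [CommRing R] {a b b' d : ℕ} (e₁ : b = b') (e₂ : d = b)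
    {z' : Matrix (Fin d) (Fin b') R} {z : Matrix (Fin b') (Fin d) R} (h : z * z' = 1)
    (y : Matrix (Fin b) (Fin a) R) :
    recast e₁.symm e₂ z * recast e₂ rfl (z' * recast e₁ rfl y) = y := by
  subst e₁ e₂
  exact (Matrix.mul_assoc z z' y).symm.trans (by rw [h, Matrix.one_mul])

namespace AutQuiver

variable {I : Type u} {Ω : Type w} {Q : AutQuiver I Ω} {p r : ℕ} [Fact p.Prime] {c : Ω}

/-! ## Vertices and edges of the contracted quiver -/

theorem exists_conE_of_minus {i : I} (hi : i ∈ Q.minus c) : ∃ h, h ∈ Q.conE c ∧ Q.tgt h = i := by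
  obtain ⟨n, rfl⟩ := hi
  exact ⟨_, ⟨n, rfl⟩, tgt_pow n c⟩

theorem tgt_image_conE : Q.tgt '' Q.conE c = Q.minus c := by
  ext i
  constructor
  · rintro ⟨h, hh, rfl⟩
    exact tgt_mem_minus hh
  · intro hi
    exact exists_conE_of_minus hi

/-- The contracted edge that ends at a vertex of `[i₋]`. -/
def conEdge {i : I} (hi : i ∈ Q.minus c) : Ω := (exists_conE_of_minus hi).choose

theorem conEdge_mem {i : I} (hi : i ∈ Q.minus c) : conEdge hi ∈ Q.conE c :=
  (exists_conE_of_minus hi).choose_spec.1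

theorem tgt_conEdge {i : I} (hi : i ∈ Q.minus c) : Q.tgt (conEdge hi) = i :=
  (exists_conE_of_minus hi).choose_spec.2

section

variable [Finite Ω]

/-- The target map sends the contracted edges onto `[i₋]`, and both sets have the same finite
cardinality. Consequently each vertex of `[i₋]` is the end of exactly one contracted edge. -/
theorem Contractible.injOn_tgt (hc : Q.Contractible c) : Set.InjOn Q.tgt (Q.conE c) :=
  Set.injOn_of_ncard_image_eq (by rw [tgt_image_conE, hc.card_conE, hc.card_eq])
    (Set.toFinite _)

theorem conEdge_eq (hc : Q.Contractible c) {i : I} (hi : i ∈ Q.minus c) {h : Ω}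
    (hh : h ∈ Q.conE c) (e : Q.tgt h = i) : conEdge hi = h :=
  hc.injOn_tgt (conEdge_mem hi) hh ((tgt_conEdge hi).trans e.symm)

end

open Classical in
/-- The vertex of the contracted quiver to which a vertex is moved. -/
def rho (hQ : Q.Admissible) (hc : Q.Contractible c) (i : I) : HatV Q c :=
  if hi : i ∈ Q.minus c then ⟨Q.src (conEdge hi), src_notMem hQ hc (conEdge_mem hi)⟩ else ⟨i, hi⟩

open Classical in
/-- The edge of the contracted quiver given by an edge that is not contracted. -/
def edgeOf (l : Ω) (hl : l ∉ Q.conE c) : HatE Q c :=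
  if hs : Q.src l ∈ Q.minus c then .post l (conEdge hs) (conEdge_mem hs) (tgt_conEdge hs)
  else if ht : Q.tgt l ∈ Q.minus c then .pre (conEdge ht) l (conEdge_mem ht) hl (tgt_conEdge ht)
  else .old l hs ht

/-- The edge of the quiver from which an edge of the contracted quiver is made. -/
def HatE.base : HatE Q c → Ω
  | .old h _ _ => h
  | .post l _ _ _ => l
  | .pre _ l _ _ _ => l

theorem edgeOf_base (l : Ω) (hl : l ∉ Q.conE c) : (edgeOf l hl).base = l := by
  rw [edgeOf]
  split_ifs <;> rfl

section

variable (hQ : Q.Admissible) (hc : Q.Contractible c)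

theorem rho_of_notMem {i : I} (hi : i ∉ Q.minus c) : rho hQ hc i = ⟨i, hi⟩ := dif_neg hi

theorem rho_coe (i : HatV Q c) : rho hQ hc i.1 = i := dif_neg i.2

/-- A contracted edge starts outside `[i₋]` and ends in it. This excludes the base of an `old` edge,
whose target is outside, and of a `post` edge, whose source is inside; for `pre` edges the claim is
part of the data. -/
theorem HatE.base_notMem (hQ : Q.Admissible) (hc : Q.Contractible c) (e : HatE Q c) :
    e.base ∉ Q.conE c := by
  cases e with
  | old h hs ht => exact fun hh => ht (tgt_mem_minus hh)
  | post l h hh e => exact fun hl => src_notMem hQ hc hl (e ▸ tgt_mem_minus hh)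
  | pre h l hh hl e => exact hl

/-- The part of `G_V` at the vertices of `[i₋]`. -/
def minusGrp (p : ℕ) [Fact p.Prime] (c : Ω) (ν : Q.DimVec) : Subgroup (Grp p ν) where
  carrier := {g | ∀ i, i ∉ Q.minus c → g i = 1}
  one_mem' := fun _ _ => rfl
  mul_mem' := fun {g g'} h h' i hi => by rw [Pi.mul_apply, h i hi, h' i hi, one_mul]
  inv_mem' := fun {g} h i hi => by rw [Pi.inv_apply, h i hi, inv_one]

/-- Contraction is equivariant through `hatGrp`, which forgets the components at `[i₋]`. -/
theorem contractRep_act_minus {ν : Q.balanced c} {X : Grp p ν.1} (hX : X ∈ minusGrp p c ν.1)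
    {x : Rep p ν.1} (hx : x ∈ (heart Q p r c).carrier ν) :
    contractRep hQ hc (act X x) = contractRep hQ hc x := by
  have : hatGrp hQ hc X = 1 := funext fun i => hX i.1 i.2
  rw [contractRep_act hQ hc X x hx, this, act_one]

variable [Finite Ω]

theorem rho_tgt {h : Ω} (hh : h ∈ Q.conE c) :
    rho hQ hc (Q.tgt h) = ⟨Q.src h, src_notMem hQ hc hh⟩ := by
  rw [rho, dif_pos (tgt_mem_minus hh)]
  exact Subtype.ext (congrArg Q.src (conEdge_eq hc _ hh rfl))

theorem rho_tgt_eq_rho_src {h : Ω} (hh : h ∈ Q.conE c) :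
    rho hQ hc (Q.tgt h) = rho hQ hc (Q.src h) := by
  rw [rho_tgt hQ hc hh, rho_of_notMem hQ hc (src_notMem hQ hc hh)]

/-- The case distinction in `edgeOf` recovers the constructor because no edge has both ends in
`[i₋]`, and it recovers the contracted edge because that edge is determined by its target. -/
theorem HatE.edgeOf_eq (hQ : Q.Admissible) (hc : Q.Contractible c) (e : HatE Q c)
    {l : Ω} (hl : l ∉ Q.conE c) (h : e.base = l) :
    edgeOf l hl = e := by
  subst h
  cases e with
  | old h hs ht => exact (dif_neg hs).trans (dif_neg ht)
  | post l h hh e =>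
    have hs : Q.src l ∈ Q.minus c := by rw [← e]; exact tgt_mem_minus hh
    refine (dif_pos hs).trans ?_
    simp only [HatE.base, conEdge_eq hc hs hh e]
  | pre h l hh hl' e =>
    have ht : Q.tgt l ∈ Q.minus c := by rw [← e]; exact tgt_mem_minus hh
    have hs : Q.src l ∉ Q.minus c := fun hs => not_both hQ hc hs ht
    refine (dif_neg hs).trans ((dif_pos ht).trans ?_)
    simp only [HatE.base, conEdge_eq hc ht hh e]

/-- The edges of the contracted quiver correspond to the edges that are not contracted. -/
def edgeEquiv : HatE Q c ≃ {l : Ω // l ∉ Q.conE c} where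
  toFun e := ⟨e.base, e.base_notMem hQ hc⟩
  invFun l := edgeOf l.1 l.2
  left_inv e := e.edgeOf_eq hQ hc _ rfl
  right_inv l := Subtype.ext (edgeOf_base l.1 l.2)

/-- Contraction slides the ends of the uncontracted edges along `rho`: the path `l h` starts at
`h'`, which is the vertex to which `l' = h''` is moved. -/
theorem src_eq_rho (e : HatE Q c) : (Q.contract c hQ hc).src e = rho hQ hc (Q.src e.base) := by
  cases e with
  | old h hs ht => exact (rho_of_notMem hQ hc hs).symm
  | post l h hh e =>
    change _ = rho hQ hc (Q.src l)
    rw [← e, rho_tgt hQ hc hh]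
    rfl
  | pre h l hh hl e =>
    have hs : Q.src l ∉ Q.minus c := fun h1 =>
      not_both hQ hc h1 (by rw [← e]; exact tgt_mem_minus hh)
    exact (rho_of_notMem hQ hc hs).symm

theorem tgt_eq_rho (e : HatE Q c) : (Q.contract c hQ hc).tgt e = rho hQ hc (Q.tgt e.base) := by
  cases e with
  | old h hs ht => exact (rho_of_notMem hQ hc ht).symm
  | post l h hh e =>
    have ht : Q.tgt l ∉ Q.minus c := not_both hQ hc (by rw [← e]; exact tgt_mem_minus hh)
    exact (rho_of_notMem hQ hc ht).symm
  | pre h l hh hl e =>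
    change _ = rho hQ hc (Q.tgt l)
    rw [← e, rho_tgt hQ hc hh]
    rfl

theorem src_edgeOf {l : Ω} (hl : l ∉ Q.conE c) :
    (Q.contract c hQ hc).src (edgeOf l hl) = rho hQ hc (Q.src l) := by
  rw [src_eq_rho, edgeOf_base]

theorem tgt_edgeOf {l : Ω} (hl : l ∉ Q.conE c) :
    (Q.contract c hQ hc).tgt (edgeOf l hl) = rho hQ hc (Q.tgt l) := by
  rw [tgt_eq_rho, edgeOf_base]

theorem rho_aV (i : I) : rho hQ hc (Q.aV i) = (Q.contract c hQ hc).aV (rho hQ hc i) := by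
  by_cases hi : i ∈ Q.minus c
  · obtain ⟨h, hh, rfl⟩ := exists_conE_of_minus hi
    rw [← Q.tgt_aE, rho_tgt hQ hc ((aE_conE h).2 hh), rho_tgt hQ hc hh]
    exact Subtype.ext (Q.src_aE h)
  · rw [rho_of_notMem hQ hc hi, rho_of_notMem hQ hc (fun h => hi ((aV_minus i).1 h))]
    rfl

theorem edgeOf_aE {l : Ω} (hl : l ∉ Q.conE c) (hl' : Q.aE l ∉ Q.conE c) :
    edgeOf (Q.aE l) hl' = (Q.contract c hQ hc).aE (edgeOf l hl) := by
  refine HatE.edgeOf_eq hQ hc _ _ ?_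
  have : ∀ e : HatE Q c, ((Q.contract c hQ hc).aE e).base = Q.aE e.base := by
    rintro (_ | _ | _) <;> rfl
  rw [this, edgeOf_base]

/-! ## Extension of representations of the contracted quiver -/

/-- A vertex of `[i₋]` is moved along a contracted edge, and balanced dimension vectors take equal
values at the two ends of such an edge. -/
theorem dim_rho (ν : Q.balanced c) (i : I) : (hatDim hQ hc ν).1 (rho hQ hc i) = ν.1.1 i := by
  by_cases hi : i ∈ Q.minus c
  · obtain ⟨h, hh, rfl⟩ := exists_conE_of_minus hi
    rw [rho_tgt hQ hc hh]
    exact (dim_conE ν hh).symm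
  · rw [rho_of_notMem hQ hc hi]
    rfl

theorem dim_src_edgeOf (ν : Q.balanced c) {l : Ω} (hl : l ∉ Q.conE c) :
    (hatDim hQ hc ν).1 ((Q.contract c hQ hc).src (edgeOf l hl)) = ν.1.1 (Q.src l) := by
  rw [src_edgeOf, dim_rho]

theorem dim_tgt_edgeOf (ν : Q.balanced c) {l : Ω} (hl : l ∉ Q.conE c) :
    (hatDim hQ hc ν).1 ((Q.contract c hQ hc).tgt (edgeOf l hl)) = ν.1.1 (Q.tgt l) := by
  rw [tgt_edgeOf, dim_rho]

variable {μ ν : Q.balanced c}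

/-- The extension of a family of matrices from the vertices of the contracted quiver. -/
def extFam (z : Fam p (hatDim hQ hc μ).1 (hatDim hQ hc ν).1) : Fam p μ.1.1 ν.1.1 := fun i =>
  recast (dim_rho hQ hc μ i) (dim_rho hQ hc ν i) (z (rho hQ hc i))

open Classical in
/-- The representation with identity matrices at the contracted edges that is given by a
representation of the contracted quiver. -/
def extRep (x : Rep p (hatDim hQ hc ν)) : Rep p ν.1 := fun l =>
  if hl : l ∈ Q.conE c then recast rfl (dim_conE ν hl) 1 else
    recast (dim_tgt_edgeOf hQ hc ν hl) (dim_src_edgeOf hQ hc ν hl) (x (edgeOf l hl))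

variable {hQ hc}

theorem extRep_conE (x : Rep p (hatDim hQ hc ν)) {l : Ω} (hl : l ∈ Q.conE c) :
    extRep hQ hc x l = recast rfl (dim_conE ν hl) 1 := dif_pos hl

theorem mul_extRep_conE (x : Rep p (hatDim hQ hc ν)) {l : Ω} (hl : l ∈ Q.conE c) {N : ℕ}
    (y : Matrix (Fin N) (Fin (ν.1.1 (Q.tgt l))) (Kbar p)) :
    y * extRep hQ hc x l = recast rfl (dim_conE ν hl) y := by
  rw [extRep_conE x hl]
  exact mul_recast_one _ _ _

theorem extRep_conE_mul (x : Rep p (hatDim hQ hc ν)) {l : Ω} (hl : l ∈ Q.conE c) {N : ℕ}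
    (y : Matrix (Fin (ν.1.1 (Q.src l))) (Fin N) (Kbar p)) :
    extRep hQ hc x l * y = recast (dim_conE ν hl).symm rfl y := by
  rw [extRep_conE x hl]
  exact recast_one_mul _ _ _

theorem isoInv_extRep_conE_mul (x : Rep p (hatDim hQ hc ν)) {l : Ω} (hl : l ∈ Q.conE c) {N : ℕ}
    (y : Matrix (Fin (ν.1.1 (Q.tgt l))) (Fin N) (Kbar p)) :
    isoInv (extRep hQ hc x l) * y = recast (dim_conE ν hl) rfl y := by
  rw [extRep_conE x hl, isoInv_recast, isoInv_eq (Matrix.one_mul 1) (Matrix.one_mul 1)]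
  exact recast_one_mul _ _ _

theorem extRep_edgeOf (x : Rep p (hatDim hQ hc ν)) {l : Ω} (hl : l ∉ Q.conE c) :
    extRep hQ hc x l = recast (dim_tgt_edgeOf hQ hc ν hl) (dim_src_edgeOf hQ hc ν hl)
      (x (edgeOf l hl)) := dif_neg hl

/-- Replaces the chosen edge `edgeOf l hl` by any edge with base `l`, and the particular size
equalities by arbitrary ones, so that each constructor of `HatE` can be handled separately. -/
theorem extRep_eq (x : Rep p (hatDim hQ hc ν)) (e : HatE Q c) {l : Ω} (h : e.base = l)
    (h1 : (hatDim hQ hc ν).1 ((Q.contract c hQ hc).tgt e) = ν.1.1 (Q.tgt l))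
    (h2 : (hatDim hQ hc ν).1 ((Q.contract c hQ hc).src e) = ν.1.1 (Q.src l)) :
    extRep hQ hc x l = recast h1 h2 (x e) := by
  subst h
  rw [extRep_edgeOf x (e.base_notMem hQ hc)]
  have := e.edgeOf_eq hQ hc (e.base_notMem hQ hc) rfl
  rw [← recast_fam x this (by rw [this]) (by rw [this])]
  rfl

theorem extFam_eq (z : Fam p (hatDim hQ hc μ).1 (hatDim hQ hc ν).1) {i : I} {j : HatV Q c}
    (h : rho hQ hc i = j) (h1 : (hatDim hQ hc μ).1 j = μ.1.1 i)
    (h2 : (hatDim hQ hc ν).1 j = ν.1.1 i) : extFam hQ hc z i = recast h1 h2 (z j) := by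
  subst h; rfl

/-- With identity matrices at the contracted edges, both `x_l x_h` and `x_h⁻¹ x_l` reduce to the
matrix at `l`. -/
theorem contractRep_extRep (x : Rep p (hatDim hQ hc ν)) :
    contractRep hQ hc (extRep hQ hc x) = x := by
  funext e
  cases e with
  | old h hs ht =>
    exact extRep_eq x (.old h hs ht) rfl rfl rfl
  | post l h hh e =>
    change recast rfl _ (extRep hQ hc x l) * extRep hQ hc x h = _
    have e2 : (hatDim hQ hc ν).1 ((Q.contract c hQ hc).src (.post l h hh e)) =
        ν.1.1 (Q.src l) := by
      rw [src_eq_rho, dim_rho]; rfl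
    rw [extRep_eq (l := l) x (.post l h hh e) rfl rfl e2]
    exact mul_extRep_conE x hh _
  | pre h l hh hl e =>
    change isoInv (extRep hQ hc x h) * recast _ rfl (extRep hQ hc x l) = _
    have e2 : (hatDim hQ hc ν).1 ((Q.contract c hQ hc).tgt (.pre h l hh hl e)) =
        ν.1.1 (Q.tgt l) := by
      rw [tgt_eq_rho, dim_rho]; rfl
    rw [extRep_eq (l := l) x (.pre h l hh hl e) rfl e2 rfl]
    exact isoInv_extRep_conE_mul x hh _

theorem extRep_mem_heart (x : Rep p (hatDim hQ hc ν)) :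
    extRep hQ hc x ∈ (heart Q p r c).carrier ν := by
  intro h hh
  rw [extRep_conE x hh]
  exact isIsoMat_recast_one _ _

theorem extFam_frob {z : Fam p (hatDim hQ hc μ).1 (hatDim hQ hc ν).1}
    (hz : ∀ i, RelBy (Fr p r) (z i) (z ((Q.contract c hQ hc).aV i))) (i : I) :
    RelBy (Fr p r) (extFam hQ hc z i) (extFam hQ hc z (Q.aV i)) :=
  ((RelBy.fam (rho_aV hQ hc i).symm (hz (rho hQ hc i))).recast_left _ _).recast_right _ _

theorem extRep_frob {x : Rep p (hatDim hQ hc ν)} (hx : frobRep r x = x) :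
    frobRep r (extRep hQ hc x) = extRep hQ hc x := by
  rw [frobRep_eq_iff] at hx ⊢
  intro l
  by_cases hl : l ∈ Q.conE c
  · rw [extRep_conE x hl, extRep_conE x ((aE_conE l).2 hl)]
    exact ((RelBy.one (tgt_inv ν.1 l).symm).recast_left _ _).recast_right _ _
  · have hl' : Q.aE l ∉ Q.conE c := fun h => hl ((aE_conE l).1 h)
    rw [extRep_edgeOf x hl, extRep_edgeOf x hl']
    exact ((RelBy.fam (edgeOf_aE hQ hc hl hl').symm (hx _)).recast_left _ _).recast_right _ _

/-! ## The normal form of representations in the heart -/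

/-- Take `X` at `h''` to be `x_h` itself, for each contracted edge `h`. Acting by `X⁻¹` changes the
basis at `[i₋]` so that the contracted edges become identities, and the other matrices become those
of the contraction. Rationality of `X` is inherited from `x`, so no argument about forms is needed.
-/
theorem exists_normal_form {x : Rep p ν.1} (hx : x ∈ (heart Q p r c).carrier ν)
    (hF : frobRep r x = x) : ∃ X ∈ minusGrp p c ν.1, frobGrp r X = X ∧
      x = act X (extRep hQ hc (contractRep hQ hc x)) := by
  -- The condition ranges over all contracted edges ending at `i` and over all proofs of the size
  -- equalities, which spares transports later on; it is consistent since there is only one such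
  -- edge.
  have hX : ∀ i, ∃ X : GL (Fin (ν.1.1 i)) (Kbar p), (i ∉ Q.minus c → X = 1) ∧
      ∀ h, h ∈ Q.conE c → ∀ e : Q.tgt h = i, ∀ e2 : ν.1.1 (Q.src h) = ν.1.1 i,
        X.1 = recast (congrArg ν.1.1 e) e2 (x h) := by
    intro i
    by_cases hi : i ∈ Q.minus c
    · obtain ⟨h, hh, rfl⟩ := exists_conE_of_minus hi
      have e := dim_conE ν hh
      have hy := isIsoMat_recast rfl e.symm (hx h hh)
      refine ⟨⟨recast rfl e.symm (x h), isoInv (recast rfl e.symm (x h)), hy.mul_isoInv.1,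
        hy.mul_isoInv.2⟩, fun hi' => (hi' hi).elim, fun h' hh' e' _ => ?_⟩
      obtain rfl := hc.injOn_tgt hh' hh e'
      rfl
    · refine ⟨1, fun _ => rfl, ?_⟩
      rintro h hh rfl
      exact (hi (tgt_mem_minus hh)).elim
  choose X hX1 hX2 using hX
  rw [frobRep_eq_iff] at hF
  refine ⟨X, hX1, frobGrp_eq_iff.2 fun i => ?_, funext fun l => ?_⟩
  -- At `h''` the relation to be checked is the rationality of `x` at `h`, because `a` takes the
  -- contracted edge ending at `i` to the one ending at `a i`.
  · by_cases hi : i ∈ Q.minus c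
    · obtain ⟨h, hh, rfl⟩ := exists_conE_of_minus hi
      have hh' := (aE_conE h).2 hh
      rw [hX2 _ h hh rfl (dim_conE ν hh).symm, hX2 _ _ hh' (Q.tgt_aE h)
        ((dim_conE ν hh').symm.trans (congrArg ν.1.1 (Q.tgt_aE h)))]
      exact ((hF h).recast_left _ _).recast_right _ _
    · rw [hX1 i hi, hX1 _ fun h => hi ((aV_minus i).1 h)]
      exact RelBy.one (ν.1.2 i).symm
  · rw [eq_comm]
    simp only [act]
    by_cases hl : l ∈ Q.conE c
    · rw [mul_extRep_conE _ hl, hX1 _ (src_notMem hQ hc hl), hX2 _ l hl rfl (dim_conE ν hl).symm,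
        inv_one, Units.val_one, Matrix.mul_one, recast_recast]
      rfl
    -- For an edge leaving `[i₋]` the claim is `(x_l x_h) x_h⁻¹ = x_l`.
    by_cases hs : Q.src l ∈ Q.minus c
    · have ht := not_both hQ hc hs
      have hh := conEdge_mem hs
      have e := tgt_conEdge hs
      set h := conEdge hs
      have e2 : ν.1.1 (Q.src h) = ν.1.1 (Q.src l) := by rw [← dim_conE ν hh, e]
      rw [extRep_eq (l := l) (contractRep hQ hc x) (.post l h hh e) rfl rfl e2, hX1 _ ht,
        Units.val_one, Matrix.one_mul]
      change recast rfl e2 (recast rfl (congrArg ν.1.1 e.symm) (x l) * x h) *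
        (X (Q.src l))⁻¹.1 = _
      rw [recast_mul_eq_mul_recast, ← hX2 (Q.src l) h hh e e2, Matrix.mul_assoc]
      exact (congrArg _ (Units.mul_inv (X (Q.src l)))).trans (Matrix.mul_one _)
    -- For an edge entering `[i₋]` the claim is `x_h (x_h⁻¹ x_l) = x_l`.
    by_cases ht : Q.tgt l ∈ Q.minus c
    · have hh := conEdge_mem ht
      have e := tgt_conEdge ht
      set h := conEdge ht
      have e2 : ν.1.1 (Q.src h) = ν.1.1 (Q.tgt l) := by rw [← dim_conE ν hh, e]
      rw [extRep_eq (l := l) (contractRep hQ hc x) (.pre h l hh hl e) rfl e2 rfl, hX1 _ hs, inv_one,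
        Units.val_one, Matrix.mul_one, hX2 (Q.tgt l) h hh e e2]
      exact recast_recast_mul_eq (congrArg ν.1.1 e.symm) e2 (hx h hh).mul_isoInv.1 (x l)
    · rw [extRep_eq (l := l) (contractRep hQ hc x) (.old l hs ht) rfl rfl rfl, hX1 _ hs, hX1 _ ht,
        inv_one, Units.val_one, Units.val_one, Matrix.mul_one, Matrix.one_mul]
      rfl

theorem contractRep_normal_form {X : Grp p ν.1} (hX : X ∈ minusGrp p c ν.1)
    (x : Rep p (hatDim hQ hc ν)) : contractRep hQ hc (act X (extRep hQ hc x)) = x := by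
  -- Any exponent would do in place of `0`: membership in the heart does not involve the Frobenius.
  rw [contractRep_act_minus hQ hc hX (extRep_mem_heart (r := 0) x), contractRep_extRep]

/-- The component of `X` at `l''` can be read off at the contracted edge `l`, where the
representation is `X` times an identity matrix; `x` is then recovered by contraction. -/
theorem normal_form_unique {X X' : Grp p ν.1} (hX : X ∈ minusGrp p c ν.1)
    (hX' : X' ∈ minusGrp p c ν.1) {x x' : Rep p (hatDim hQ hc ν)}
    (h : act X (extRep hQ hc x) = act X' (extRep hQ hc x')) : X = X' ∧ x = x' := by
  refine ⟨?_, ?_⟩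
  · funext i
    by_cases hi : i ∈ Q.minus c
    · obtain ⟨l, hl, rfl⟩ := exists_conE_of_minus hi
      have e := congrFun h l
      simp only [act] at e
      have hs := src_notMem hQ hc hl
      rw [mul_extRep_conE _ hl, mul_extRep_conE _ hl, hX _ hs, hX' _ hs, inv_one, Units.val_one,
        Matrix.mul_one, Matrix.mul_one, recast_inj] at e
      exact Units.ext e
    · rw [hX i hi, hX' i hi]
  · rw [← contractRep_normal_form hX x, h, contractRep_normal_form hX' x']

end

/-! ## Rational points of the group -/

/-- The rational points of the part of `G_V` at the vertices of `[i₋]`. -/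
abbrev MinusPts (p r : ℕ) [Fact p.Prime] (c : Ω) (ν : Q.DimVec) : Type _ :=
  {g : Grp p ν // g ∈ minusGrp p c ν ∧ frobGrp r g = g}

theorem finite_minusPts [Finite I] [NeZero r] (ν : Q.DimVec) : Finite (MinusPts p r c ν) := by
  have := finite_grp (p := p) (r := r) ν
  exact Finite.of_injective
    (fun g : MinusPts p r c ν => (⟨g.1, g.2.2⟩ : {g : Grp p ν // frobGrp r g = g}))
    fun g g' h => Subtype.ext (Subtype.mk.inj h)

/-- Needed because the orders of these groups are cancelled in `k`. -/
theorem card_minusPts_ne_zero [Finite I] [NeZero r] (ν : Q.DimVec) :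
    Nat.card (MinusPts p r c ν) ≠ 0 := by
  have := finite_minusPts (p := p) (r := r) (c := c) ν
  have : Nonempty (MinusPts p r c ν) := ⟨⟨1, one_mem _, frobGrp_one⟩⟩
  exact Nat.card_pos.ne'

section

variable (hQ : Q.Admissible) (hc : Q.Contractible c) {ν : Q.balanced c}

open Classical in
/-- The element of `G_V` with the components of `a` at `[i₋]` and of `g` elsewhere. -/
def glueGrp (g : Grp p (hatDim hQ hc ν)) (a : Grp p ν.1) : Grp p ν.1 := fun i =>
  if hi : i ∈ Q.minus c then a i else g ⟨i, hi⟩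

theorem glueGrp_of_mem (g : Grp p (hatDim hQ hc ν)) (a : Grp p ν.1) {i : I}
    (hi : i ∈ Q.minus c) : glueGrp hQ hc g a i = a i := dif_pos hi

theorem glueGrp_of_notMem (g : Grp p (hatDim hQ hc ν)) (a : Grp p ν.1) {i : I}
    (hi : i ∉ Q.minus c) : glueGrp hQ hc g a i = g ⟨i, hi⟩ := dif_neg hi

theorem frob_glueGrp {g : Grp p (hatDim hQ hc ν)} {a : Grp p ν.1} (hg : frobGrp r g = g)
    (ha : frobGrp r a = a) : frobGrp r (glueGrp hQ hc g a) = glueGrp hQ hc g a := by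
  refine frobGrp_eq_iff.2 fun i => ?_
  by_cases hi : i ∈ Q.minus c
  · rw [glueGrp_of_mem hQ hc g a hi, glueGrp_of_mem hQ hc g a ((aV_minus i).2 hi)]
    exact frobGrp_eq_iff.1 ha i
  · rw [glueGrp_of_notMem hQ hc g a hi,
      glueGrp_of_notMem hQ hc g a fun h => hi ((aV_minus i).1 h)]
    exact frobGrp_eq_iff.1 hg ⟨i, hi⟩

end

/-- The set `[i₋]` is stable under `a`, so the rational group is the direct product of its
components at `[i₋]` and of those at the other vertices. -/
theorem cardG_eq (hQ : Q.Admissible) (hc : Q.Contractible c) (ν : Q.balanced c) :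
    cardG p r ν.1 = cardG p r (hatDim hQ hc ν) * Nat.card (MinusPts p r c ν.1) := by
  rw [cardG, cardG, ← Nat.card_prod]
  refine (Nat.card_congr (Equiv.ofBijective (fun y :
    {g : Grp p (hatDim hQ hc ν) // frobGrp r g = g} × MinusPts p r c ν.1 =>
      (⟨glueGrp hQ hc y.1.1 y.2.1, frob_glueGrp hQ hc y.1.2 y.2.2.2⟩ :
        {g : Grp p ν.1 // frobGrp r g = g})) ⟨?_, ?_⟩)).symm
  · intro y z h
    have h' : glueGrp hQ hc y.1.1 y.2.1 = glueGrp hQ hc z.1.1 z.2.1 := congrArg Subtype.val h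
    refine Prod.ext (Subtype.ext (funext fun i => ?_)) (Subtype.ext (funext fun i => ?_))
    · have := congrFun h' i.1
      rwa [glueGrp_of_notMem hQ hc _ _ i.2, glueGrp_of_notMem hQ hc _ _ i.2] at this
    · by_cases hi : i ∈ Q.minus c
      · have := congrFun h' i
        rwa [glueGrp_of_mem hQ hc _ _ hi, glueGrp_of_mem hQ hc _ _ hi] at this
      · rw [y.2.2.1 i hi, z.2.2.1 i hi]
  · rintro ⟨g, hg⟩
    refine ⟨(⟨hatGrp hQ hc g, by rw [hatGrp_frob, hg]⟩,
      ⟨glueGrp hQ hc 1 g, fun i hi => glueGrp_of_notMem hQ hc _ _ hi,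
        frob_glueGrp hQ hc frobGrp_one hg⟩), Subtype.ext (funext fun i => ?_)⟩
    by_cases hi : i ∈ Q.minus c
    · exact (glueGrp_of_mem hQ hc _ _ hi).trans (glueGrp_of_mem hQ hc _ _ hi)
    · exact glueGrp_of_notMem hQ hc _ _ hi

/-! ## Short exact sequences of representations of the contracted quiver -/

section

variable [Finite Ω] {hQ : Q.Admissible} {hc : Q.Contractible c} {ν τ ω : Q.balanced c}

theorem extFam_coe (z : Fam p (hatDim hQ hc τ).1 (hatDim hQ hc ω).1) (i : HatV Q c) :
    extFam hQ hc z i.1 = z i := extFam_eq z (rho_coe hQ hc i) rfl rfl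

theorem extFam_injective :
    Function.Injective (extFam hQ hc : Fam p (hatDim hQ hc τ).1 (hatDim hQ hc ω).1 → _) := by
  intro z z' h
  funext i
  rw [← extFam_coe z, h, extFam_coe]

variable (hQ hc) in
/-- The restriction of a family of matrices to the vertices of the contracted quiver. -/
def resFam (z : Fam p τ.1.1 ω.1.1) : Fam p (hatDim hQ hc τ).1 (hatDim hQ hc ω).1 :=
  fun i => z i.1

/-- Each vertex of `[i₋]` is joined by a contracted edge to a vertex outside, so agreement along the
contracted edges determines the family from its restriction. -/
theorem eq_extFam (A : Fam p τ.1.1 ω.1.1)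
    (h : ∀ l (hl : l ∈ Q.conE c), A (Q.tgt l) =
      recast (dim_conE τ hl).symm (dim_conE ω hl).symm (A (Q.src l))) :
    A = extFam hQ hc (resFam hQ hc A) := by
  funext i
  by_cases hi : i ∈ Q.minus c
  · obtain ⟨l, hl, rfl⟩ := exists_conE_of_minus hi
    rw [extFam_eq _ (rho_tgt hQ hc hl) (dim_conE τ hl).symm (dim_conE ω hl).symm, h l hl]
    rfl
  · exact (extFam_coe (resFam hQ hc A) ⟨i, hi⟩).symm

theorem extFam_tgt (z : Fam p (hatDim hQ hc τ).1 (hatDim hQ hc ω).1) {l : Ω}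
    (hl : l ∈ Q.conE c) : extFam hQ hc z (Q.tgt l) =
      recast (dim_conE τ hl).symm (dim_conE ω hl).symm (extFam hQ hc z (Q.src l)) := by
  have h := rho_tgt_eq_rho_src hQ hc hl
  rw [extFam_eq z h (by rw [← h, dim_rho]) (by rw [← h, dim_rho])]
  rfl

theorem dim_src_base (ν : Q.balanced c) (e : HatE Q c) :
    (hatDim hQ hc ν).1 ((Q.contract c hQ hc).src e) = ν.1.1 (Q.src e.base) := by
  rw [src_eq_rho, dim_rho]

theorem dim_tgt_base (ν : Q.balanced c) (e : HatE Q c) :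
    (hatDim hQ hc ν).1 ((Q.contract c hQ hc).tgt e) = ν.1.1 (Q.tgt e.base) := by
  rw [tgt_eq_rho, dim_rho]

theorem extFam_src_base (z : Fam p (hatDim hQ hc τ).1 (hatDim hQ hc ω).1) (e : HatE Q c) :
    extFam hQ hc z (Q.src e.base) = recast (dim_src_base τ e) (dim_src_base ω e)
      (z ((Q.contract c hQ hc).src e)) :=
  extFam_eq z (src_eq_rho hQ hc e).symm _ _

theorem extFam_tgt_base (z : Fam p (hatDim hQ hc τ).1 (hatDim hQ hc ω).1) (e : HatE Q c) :
    extFam hQ hc z (Q.tgt e.base) = recast (dim_tgt_base τ e) (dim_tgt_base ω e)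
      (z ((Q.contract c hQ hc).tgt e)) :=
  extFam_eq z (tgt_eq_rho hQ hc e).symm _ _

theorem extRep_base (x : Rep p (hatDim hQ hc ν)) (e : HatE Q c) :
    extRep hQ hc x e.base = recast (dim_tgt_base ν e) (dim_src_base ν e) (x e) :=
  extRep_eq x e rfl _ _

variable {x : Rep p (hatDim hQ hc ν)} {t : Rep p (hatDim hQ hc τ)} {w : Rep p (hatDim hQ hc ω)}

/-- At an uncontracted edge the two relations differ only by changes of size, which cancel. -/
theorem ext_sub_iff (A : Fam p (hatDim hQ hc ν).1 (hatDim hQ hc ω).1) (e : HatE Q c) :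
    extRep hQ hc x e.base * extFam hQ hc A (Q.src e.base) =
      extFam hQ hc A (Q.tgt e.base) * extRep hQ hc w e.base ↔
    x e * A ((Q.contract c hQ hc).src e) = A ((Q.contract c hQ hc).tgt e) * w e := by
  rw [extRep_base, extRep_base, extFam_src_base, extFam_tgt_base, recast_mul_recast,
    recast_mul_recast, recast_inj]

theorem ext_quot_iff (B : Fam p (hatDim hQ hc τ).1 (hatDim hQ hc ν).1) (e : HatE Q c) :
    extRep hQ hc t e.base * extFam hQ hc B (Q.src e.base) =
      extFam hQ hc B (Q.tgt e.base) * extRep hQ hc x e.base ↔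
    t e * B ((Q.contract c hQ hc).src e) = B ((Q.contract c hQ hc).tgt e) * x e :=
  -- The relation for quotients has the same shape, with `B` as intertwiner from `x` to `t`.
  ext_sub_iff B e

/-- At a contracted edge the representations are identities and the extended families agree at both
ends; at the remaining edges the relations are those of the contracted quiver. -/
theorem IsSES.extend {A : Fam p (hatDim hQ hc ν).1 (hatDim hQ hc ω).1}
    {B : Fam p (hatDim hQ hc τ).1 (hatDim hQ hc ν).1} (s : IsSES r x A B t w) :
    IsSES r (extRep hQ hc x) (extFam hQ hc A) (extFam hQ hc B) (extRep hQ hc t)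
      (extRep hQ hc w) where
  exact i := (s.exact (rho hQ hc i)).recast _ _ _ _
  sub l := by
    by_cases hl : l ∈ Q.conE c
    · rw [extRep_conE_mul x hl, mul_extRep_conE w hl, extFam_tgt A hl, recast_recast]
    · have := (ext_sub_iff A (edgeOf l hl)).2 (s.sub _)
      rwa [edgeOf_base] at this
  quot l := by
    by_cases hl : l ∈ Q.conE c
    · rw [extRep_conE_mul t hl, mul_extRep_conE x hl, extFam_tgt B hl, recast_recast]
    · have := (ext_quot_iff B (edgeOf l hl)).2 (s.quot _)
      rwa [edgeOf_base] at this
  frobA := extFam_frob s.frobA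
  frobB := extFam_frob s.frobB

/-- The converse of `IsSES.extend`: when all three terms have identities at the contracted edges,
the intertwining relations there force `A` and `B` to take the same values at the two ends, so the
sequence comes from the contracted quiver. -/
theorem IsSES.eq_extend {A : Fam p ν.1.1 ω.1.1} {B : Fam p τ.1.1 ν.1.1}
    (s : IsSES r (extRep hQ hc x) A B (extRep hQ hc t) (extRep hQ hc w)) :
    A = extFam hQ hc (resFam hQ hc A) ∧ B = extFam hQ hc (resFam hQ hc B) ∧
      IsSES r x (resFam hQ hc A) (resFam hQ hc B) t w := by
  have hA : A = extFam hQ hc (resFam hQ hc A) := by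
    refine eq_extFam A fun l hl => ?_
    have := s.sub l
    rw [extRep_conE_mul x hl, mul_extRep_conE w hl] at this
    rw [← recast_inj (hm := rfl) (hn := dim_conE ω hl) (hm₁ := rfl) (hn₁ := dim_conE ω hl),
      ← this, recast_recast]
  have hB : B = extFam hQ hc (resFam hQ hc B) := by
    refine eq_extFam B fun l hl => ?_
    have := s.quot l
    rw [extRep_conE_mul t hl, mul_extRep_conE x hl] at this
    rw [← recast_inj (hm := rfl) (hn := dim_conE ν hl) (hm₁ := rfl) (hn₁ := dim_conE ν hl),
      ← this, recast_recast]
  refine ⟨hA, hB, fun i => s.exact i.1, fun e => ?_, fun e => ?_, fun i => s.frobA i.1,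
    fun i => s.frobB i.1⟩
  · refine (ext_sub_iff (resFam hQ hc A) e).1 ?_
    rw [← hA]
    exact s.sub _
  · refine (ext_quot_iff (resFam hQ hc B) e).1 ?_
    rw [← hB]
    exact s.quot _

/-- A short exact sequence of representations of the contracted quiver, together with elements
of the groups at `[i₋]`, gives a short exact sequence of representations. -/
def sesExtend (x : Rep p (hatDim hQ hc ν))
    (y : SES r (hatDim hQ hc τ) (hatDim hQ hc ω) x × MinusPts p r c τ.1 × MinusPts p r c ω.1) :
    SES r τ.1 ω.1 (extRep hQ hc x) :=
  ⟨(fun i => extFam hQ hc y.1.1.1 i * (y.2.2.1 i)⁻¹.1,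
    fun i => (y.2.1.1 i).1 * extFam hQ hc y.1.1.2.1 i,
    act y.2.1.1 (extRep hQ hc y.1.1.2.2.1), act y.2.2.1 (extRep hQ hc y.1.1.2.2.2)),
    y.1.2.extend.conj y.2.1.2.2 y.2.2.2.2⟩

/-- The outer terms are in normal form, so they determine the group elements and the contracted
outer terms; then `A` and `B` follow by cancelling the group elements. -/
theorem sesExtend_injective (x : Rep p (hatDim hQ hc ν)) :
    Function.Injective (sesExtend (r := r) (τ := τ) (ω := ω) x) := by
  rintro ⟨⟨⟨A, B, t, w⟩, s⟩, a, b⟩ ⟨⟨⟨A', B', t', w'⟩, s'⟩, a', b'⟩ h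
  have h' := congrArg Subtype.val h
  simp only [sesExtend, Prod.mk.injEq] at h'
  obtain ⟨h1, h2, h3, h4⟩ := h'
  obtain ⟨ha, rfl⟩ := normal_form_unique a.2.1 a'.2.1 h3
  obtain ⟨hb, rfl⟩ := normal_form_unique b.2.1 b'.2.1 h4
  obtain rfl := Subtype.ext ha
  obtain rfl := Subtype.ext hb
  have hA : A = A' := extFam_injective (hQ := hQ) (hc := hc) (funext fun i => by
    have e : (b.1 i)⁻¹.1 * (b.1 i).1 = 1 := Units.inv_mul _
    have := congrArg (fun z => z * (b.1 i).1) (congrFun h1 i)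
    simp only [Matrix.mul_assoc] at this
    rwa [e, Matrix.mul_one, Matrix.mul_one] at this)
  have hB : B = B' := extFam_injective (hQ := hQ) (hc := hc) (funext fun i => by
    have e : (a.1 i)⁻¹.1 * (a.1 i).1 = 1 := Units.inv_mul _
    have := congrArg (fun z => (a.1 i)⁻¹.1 * z) (congrFun h2 i)
    simp only [← Matrix.mul_assoc] at this
    rwa [e, Matrix.one_mul, Matrix.one_mul] at this)
  subst hA hB
  rfl

/-- The middle term is in the heart, hence so are the outer terms. Their normal forms provide
rational elements `a` and `b`; conjugating the sequence by the inverses leaves identities at the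
contracted edges, so that `IsSES.eq_extend` applies. -/
theorem sesExtend_surjective {x : Rep p (hatDim hQ hc (τ + ω))} (hx : frobRep r x = x) :
    Function.Surjective (sesExtend (r := r) (τ := τ) (ω := ω) x) := by
  rintro ⟨⟨A, B, t, w⟩, s⟩
  have s : IsSES r (extRep hQ hc x) A B t w := s
  have hF := extRep_frob hx
  obtain ⟨ht, hw⟩ := (heart Q p r c).mem_of_isSES (extRep_mem_heart x) hF s
  obtain ⟨a, ha, hFa, hat⟩ := exists_normal_form (hQ := hQ) (hc := hc) ht (s.frob_quot hF)
  obtain ⟨b, hb, hFb, hbw⟩ := exists_normal_form (hQ := hQ) (hc := hc) hw (s.frob_sub hF)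
  have s' := s.conj (frobGrp_fixed_inv hFa) (frobGrp_fixed_inv hFb)
  have e1 : act a⁻¹ t = extRep hQ hc (contractRep hQ hc t) := by
    conv_lhs => rw [hat, ← act_mul, inv_mul_cancel, act_one]
  have e2 : act b⁻¹ w = extRep hQ hc (contractRep hQ hc w) := by
    conv_lhs => rw [hbw, ← act_mul, inv_mul_cancel, act_one]
  rw [e1, e2] at s'
  obtain ⟨hA, hB, s''⟩ := s'.eq_extend
  refine ⟨(⟨⟨_, _, _, _⟩, s''⟩, ⟨a, ha, hFa⟩, ⟨b, hb, hFb⟩),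
    Subtype.ext (Prod.ext ?_ (Prod.ext ?_ (Prod.ext hat.symm hbw.symm)))⟩
  · funext i
    refine (congrArg (· * (b i)⁻¹.1) (congrFun hA i).symm).trans ?_
    simp only [Pi.inv_apply, inv_inv]
    rw [Matrix.mul_assoc]
    exact (congrArg _ (Units.mul_inv (b i))).trans (Matrix.mul_one _)
  · funext i
    refine (congrArg ((a i).1 * ·) (congrFun hB i).symm).trans ?_
    simp only [Pi.inv_apply]
    rw [← Matrix.mul_assoc]
    exact (congrArg (· * B i) (Units.mul_inv (a i))).trans (Matrix.one_mul _)

end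

/-! ## Restriction and extension by zero are multiplicative -/

section Loci

variable {D : AddSubmonoid Q.DimVec} {k : Type*} [Field k]

theorem zeroExt_extZero {ν : Q.DimVec} (X : Set (Rep p ν))
    (hX : ∀ (g : Grp p ν) x, x ∈ X → act g x ∈ X) (f : InvFun r k X) :
    zeroExt (extZero X hX f).1 = zeroExt f.1 := by
  funext x
  by_cases hF : frobRep r x = x
  · rw [zeroExt, dif_pos ⟨trivial, hF⟩]
    by_cases hx : x ∈ X
    · rw [zeroExt, dif_pos ⟨hx, hF⟩]
      exact dif_pos hx
    · rw [zeroExt, dif_neg fun h => hx h.1]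
      exact dif_neg hx
  · rw [zeroExt, zeroExt, dif_neg fun h => hF h.2, dif_neg fun h => hF h.2]

theorem zeroExt_restr {ν : Q.DimVec} (X : Set (Rep p ν))
    (f : InvFun r k (Set.univ : Set (Rep p ν))) {x : Rep p ν} (hx : x ∈ X) :
    zeroExt (restr X f).1 x = zeroExt f.1 x := by
  by_cases hF : frobRep r x = x
  · rw [zeroExt, dif_pos ⟨hx, hF⟩, zeroExt, dif_pos ⟨trivial, hF⟩]
    rfl
  · rw [zeroExt, zeroExt, dif_neg fun h => hF h.2, dif_neg fun h => hF h.2]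

/-- A locus is closed under extensions if the middle term of a short exact sequence is in the
locus when the outer terms are. -/
def Locus.ExtClosed (L : Locus Q p r D) : Prop :=
  ∀ (τ ω : D) (x : Rep p (τ.1 + ω.1)) (A : Fam p (τ.1 + ω.1).1 ω.1.1)
    (B : Fam p τ.1.1 (τ.1 + ω.1).1) (t : Rep p τ.1) (w : Rep p ω.1), IsSES r x A B t w →
    t ∈ L.carrier τ → w ∈ L.carrier ω → x ∈ L.carrier (τ + ω)

/-- The five lemma at each contracted edge; equality of dimensions at its two ends makes the middle
matrix square. -/
theorem heart_extClosed : (heart Q p r c).ExtClosed := by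
  intro τ ω x A B t w s ht hw h hh
  exact (s.exact (Q.src h)).isIsoMat (dim_conE (τ + ω) hh) (s.exact (Q.tgt h)) (s.sub h)
    (s.quot h) (ht h hh) (hw h hh)

variable [Fintype I] [Fintype Ω] [NeZero r]

/-- For `x` in the locus both products are sums over the same sequences, and the outer terms all lie
in the locus, where restriction changes no value. -/
theorem hallMul_restr (v : k) (L : Locus Q p r D) {τ ω : D}
    (f₁ : HallPart v (fullLocus Q p r D) τ) (f₂ : HallPart v (fullLocus Q p r D) ω) :
    (restr (L.carrier (τ + ω)) (hallMul v (fullLocus Q p r D) f₁ f₂) : HallPart v L (τ + ω)) =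
      hallMul v L (restr (L.carrier τ) f₁ : HallPart v L τ)
        (restr (L.carrier ω) f₂ : HallPart v L ω) := by
  refine Subtype.ext (funext fun x => ?_)
  refine congrArg ((v⁻¹ ^ mExp τ.1 ω.1 * ((cardG p r τ.1 * cardG p r ω.1 : ℕ) : k)⁻¹) * ·) ?_
  refine (indFun_eq (fullLocus Q p r D) _ _ _).trans (Eq.trans ?_ (indFun_eq L _ _ x).symm)
  refine finsum_congr fun s => ?_
  obtain ⟨ht, hw⟩ := L.mem_of_isSES x.2.1 x.2.2 s.2
  exact (congrArg₂ (· * ·) (zeroExt_restr (L.carrier τ) f₁ ht)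
    (zeroExt_restr (L.carrier ω) f₂ hw)).symm

/-- On the locus the two sums agree term by term. Off the locus every term vanishes, because by
closure under extensions one of the outer terms is not in the locus. -/
theorem hallMul_extZero (v : k) (L : Locus Q p r D) (hL : L.ExtClosed) {τ ω : D}
    (f₁ : HallPart v L τ) (f₂ : HallPart v L ω) :
    (extZero (L.carrier (τ + ω)) (L.act_mem _) (hallMul v L f₁ f₂) :
      HallPart v (fullLocus Q p r D) (τ + ω)) =
      hallMul v (fullLocus Q p r D)
        (extZero (L.carrier τ) (L.act_mem _) f₁ : HallPart v (fullLocus Q p r D) τ)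
        (extZero (L.carrier ω) (L.act_mem _) f₂ : HallPart v (fullLocus Q p r D) ω) := by
  refine Subtype.ext (funext fun x => Eq.symm ?_)
  have e := indFun_eq (fullLocus Q p r D)
    (extZero (L.carrier τ) (L.act_mem _) f₁ : HallPart v (fullLocus Q p r D) τ).1
    (extZero (L.carrier ω) (L.act_mem _) f₂ : HallPart v (fullLocus Q p r D) ω).1 x
  have e1 := zeroExt_extZero (L.carrier τ) (L.act_mem _) f₁
  have e2 := zeroExt_extZero (L.carrier ω) (L.act_mem _) f₂
  have e' := e.trans (finsum_congr fun s => congrArg₂ (· * ·) (congrFun e1 s.1.2.2.1)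
    (congrFun e2 s.1.2.2.2))
  refine (congrArg (_ * ·) e').trans ?_
  by_cases hx : x.1 ∈ L.carrier (τ + ω)
  · refine Eq.trans ?_ (dif_pos hx).symm
    exact congrArg (_ * ·) (indFun_eq L f₁.1 f₂.1 ⟨x.1, hx, x.2.2⟩).symm
  · refine Eq.trans ?_ (dif_neg hx).symm
    refine mul_eq_zero_of_right _ ((finsum_congr fun s => ?_).trans finsum_zero)
    by_cases ht : s.1.2.2.1 ∈ L.carrier τ
    · have hw : s.1.2.2.2 ∉ L.carrier ω := fun hw => hx (hL _ _ _ _ _ _ _ s.2 ht hw)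
      exact mul_eq_zero_of_right _ (zeroExt_of_notMem f₂.1 hw)
    · exact mul_eq_zero_of_left (zeroExt_of_notMem f₁.1 ht) _

end Loci

/-! ## Multiplicativity of the contraction -/

section

variable {k : Type*} [Field k] (hQ : Q.Admissible) (hc : Q.Contractible c) {τ ω ν : Q.balanced c}

theorem zeroExt_muPull [Finite Ω] (v : k)
    (f : HallPart v (fullLocus (Q.contract c hQ hc) p r ⊤) ⟨hatDim hQ hc ν, trivial⟩)
    {x : Rep p (hatDim hQ hc ν)} (hx : frobRep r x = x) (a : MinusPts p r c ν.1) :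
    zeroExt (muPull hQ hc v ν f).1 (act a.1 (extRep hQ hc x)) = zeroExt f.1 x := by
  have h1 : act a.1 (extRep hQ hc x) ∈ (heart Q p r c).carrier ν :=
    (heart Q p r c).act_mem _ _ _ (extRep_mem_heart x)
  have h2 : frobRep r (act a.1 (extRep hQ hc x)) = act a.1 (extRep hQ hc x) := by
    rw [frobRep_act, a.2.2, extRep_frob hx]
  rw [zeroExt, dif_pos ⟨h1, h2⟩, zeroExt, dif_pos ⟨trivial, hx⟩]
  refine congrArg f.1 (Subtype.ext ?_)
  exact contractRep_normal_form a.2.1 x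

/-- By invariance `x` may be replaced by its normal form. The sequences are then parametrized by
those of the contraction and by pairs of group elements at `[i₋]`, on which the summand does not
depend. -/
theorem indFun_muPull [Finite I] [Finite Ω] [NeZero r] (v : k)
    (f₁ : HallPart v (fullLocus (Q.contract c hQ hc) p r ⊤) ⟨hatDim hQ hc τ, trivial⟩)
    (f₂ : HallPart v (fullLocus (Q.contract c hQ hc) p r ⊤) ⟨hatDim hQ hc ω, trivial⟩)
    (x : Pts r ((heart Q p r c).carrier (τ + ω))) :
    indFun (heart Q p r c) (muPull hQ hc v τ f₁).1 (muPull hQ hc v ω f₂).1 x =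
      ((Nat.card (MinusPts p r c τ.1) * Nat.card (MinusPts p r c ω.1) : ℕ) : k) *
      indFun (fullLocus (Q.contract c hQ hc) p r ⊤) f₁.1 f₂.1 (contractPts hQ hc x) := by
  have hF : frobRep r (contractRep hQ hc x.1) = contractRep hQ hc x.1 :=
    (contractPts hQ hc x).2.2
  obtain ⟨X, hX, hFX, hxX⟩ := exists_normal_form (hQ := hQ) (hc := hc) x.2.1 x.2.2
  rw [indFun_inv (heart Q p r c) _ _ X hFX
    ⟨extRep hQ hc (contractRep hQ hc x.1), extRep_mem_heart _, extRep_frob hF⟩ x hxX]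
  refine (indFun_eq _ _ _ _).trans ?_
  have e := indFun_eq (fullLocus (Q.contract c hQ hc) p r ⊤) f₁.1 f₂.1 (contractPts hQ hc x)
  refine Eq.trans ?_ (congrArg (_ * ·) e.symm)
  have i1 := finite_minusPts (p := p) (r := r) (c := c) τ.1
  have i2 := finite_minusPts (p := p) (r := r) (c := c) ω.1
  have i3 : Finite (SES r (hatDim hQ hc τ) (hatDim hQ hc ω) (contractRep hQ hc x.1)) :=
    finite_SES _
  refine (finsum_comp_equiv (Equiv.ofBijective _ ⟨sesExtend_injective (r := r) (τ := τ) (ω := ω)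
    (contractRep hQ hc x.1), sesExtend_surjective hF⟩)).symm.trans ?_
  have := Fintype.ofFinite (MinusPts p r c τ.1)
  have := Fintype.ofFinite (MinusPts p r c ω.1)
  have := Fintype.ofFinite
    (SES r (hatDim hQ hc τ) (hatDim hQ hc ω) (contractRep hQ hc x.1))
  let ψ (s : SES r (hatDim hQ hc τ) (hatDim hQ hc ω) (contractRep hQ hc x.1)) : k :=
    zeroExt f₁.1 s.1.2.2.1 * zeroExt f₂.1 s.1.2.2.2
  have h1 : ∀ y : SES r (hatDim hQ hc τ) (hatDim hQ hc ω) (contractRep hQ hc x.1) ×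
      MinusPts p r c τ.1 × MinusPts p r c ω.1,
      zeroExt (muPull hQ hc v τ f₁).1 (sesExtend _ y).1.2.2.1 *
        zeroExt (muPull hQ hc v ω f₂).1 (sesExtend _ y).1.2.2.2 = ψ y.1 := fun y =>
    congrArg₂ (· * ·) (zeroExt_muPull hQ hc v f₁ (y.1.2.frob_quot hF) y.2.1)
      (zeroExt_muPull hQ hc v f₂ (y.1.2.frob_sub hF) y.2.2)
  -- The summation over the two groups only contributes their orders.
  have h2 : ∑ᶠ y : SES r (hatDim hQ hc τ) (hatDim hQ hc ω) (contractRep hQ hc x.1) ×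
      MinusPts p r c τ.1 × MinusPts p r c ω.1, ψ y.1 =
      ((Nat.card (MinusPts p r c τ.1) * Nat.card (MinusPts p r c ω.1) : ℕ) : k) *
        ∑ᶠ s, ψ s := by
    rw [finsum_eq_sum_of_fintype, finsum_eq_sum_of_fintype, Fintype.sum_prod_type,
      Finset.mul_sum]
    refine Finset.sum_congr rfl fun s _ => ?_
    simp only [Finset.sum_const, Finset.card_univ, nsmul_eq_mul]
    rw [← Nat.card_eq_fintype_card, Nat.card_prod]
  exact (finsum_congr h1).trans h2

/-- The vertices removed contribute `τ₋ ω₋` each, and so does every contracted edge; there are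
`#[i₋]` of either kind. The uncontracted edges keep their contributions under `edgeEquiv`, since
`rho` preserves dimensions. -/
theorem mExp_eq [Fintype I] [Fintype Ω] (τ ω : Q.balanced c) :
    mExp τ.1 ω.1 = mExp (hatDim hQ hc τ) (hatDim hQ hc ω) +
      2 * (τ.1.1 (Q.tgt c) * ω.1.1 (Q.tgt c)) * (Q.minus c).ncard := by
  classical
  have h1 : ∑ i, τ.1.1 i * ω.1.1 i = ∑ i : HatV Q c, τ.1.1 i.1 * ω.1.1 i.1 +
      (Q.minus c).ncard * (τ.1.1 (Q.tgt c) * ω.1.1 (Q.tgt c)) := by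
    rw [← Fintype.sum_subtype_add_sum_subtype (· ∈ Q.minus c), add_comm]
    congr 1
    · exact Finset.sum_congr (by ext; simp) fun _ _ => rfl
    · rw [Finset.sum_congr rfl (g := fun _ => τ.1.1 (Q.tgt c) * ω.1.1 (Q.tgt c)) fun i _ => by
        rw [← dim_sameCycle τ.1 i.2, ← dim_sameCycle ω.1 i.2], Finset.sum_const,
        Finset.card_univ, smul_eq_mul, ← Nat.card_eq_fintype_card]
      rfl
  have h2 : ∑ h, τ.1.1 (Q.src h) * ω.1.1 (Q.tgt h) =
      ∑ e : HatE Q c, (hatDim hQ hc τ).1 ((Q.contract c hQ hc).src e) *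
        (hatDim hQ hc ω).1 ((Q.contract c hQ hc).tgt e) +
      (Q.minus c).ncard * (τ.1.1 (Q.tgt c) * ω.1.1 (Q.tgt c)) := by
    rw [← Fintype.sum_subtype_add_sum_subtype (· ∈ Q.conE c), add_comm]
    congr 1
    · refine (Fintype.sum_equiv (edgeEquiv hQ hc) _ _ fun e => ?_).symm
      rw [dim_src_base, dim_tgt_base]
      rfl
    · rw [Finset.sum_congr rfl (g := fun _ => τ.1.1 (Q.tgt c) * ω.1.1 (Q.tgt c)) fun l _ => by
        rw [← dim_conE τ l.2, dim_sameCycle τ.1 (tgt_mem_minus l.2),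
          dim_sameCycle ω.1 (tgt_mem_minus l.2)], Finset.sum_const,
        Finset.card_univ, smul_eq_mul, ← Nat.card_eq_fintype_card, ← hc.card_eq, ← hc.card_conE]
      rfl
  have h3 : mExp (hatDim hQ hc τ) (hatDim hQ hc ω) = ∑ i : HatV Q c, τ.1.1 i.1 * ω.1.1 i.1 +
      ∑ e : HatE Q c, (hatDim hQ hc τ).1 ((Q.contract c hQ hc).src e) *
        (hatDim hQ hc ω).1 ((Q.contract c hQ hc).tgt e) := rfl
  rw [h3, mExp, h1, h2]
  ring

/-- Here `nt` and `nw` stand for the orders of the groups at `[i₋]`, `gt` and `gw` for those of the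
groups of the contracted quiver, and `m`, `d`, `a`, `b` for powers of `v⁻¹`. -/
theorem mul_cancel_cards {nt nw : k} (ht : nt ≠ 0) (hw : nw ≠ 0) (gt gw m d a b F : k) :
    d * a * b * (m * (gt * gw)⁻¹ * F) =
      m * d * (gt * nt * (gw * nw))⁻¹ * (a * (b * (nt * nw * F))) := by
  have e : (gt * nt * (gw * nw))⁻¹ * (nt * nw) = (gt * gw)⁻¹ := by
    rw [mul_mul_mul_comm, mul_inv, mul_assoc, inv_mul_cancel₀ (mul_ne_zero ht hw), mul_one]
  rw [← e]
  ring

/-- Two discrepancies cancel: the additional sequences against the larger groups, and the difference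
of the exponents `mExp` against the failure of `ν₋² #[i₋]` to be additive in `ν`. -/
theorem muPart_hallMul [Fintype I] [Fintype Ω] [NeZero r] [CharZero k] (v : k)
    (f₁ : HallPart v (fullLocus (Q.contract c hQ hc) p r ⊤) ⟨hatDim hQ hc τ, trivial⟩)
    (f₂ : HallPart v (fullLocus (Q.contract c hQ hc) p r ⊤) ⟨hatDim hQ hc ω, trivial⟩) :
    muPart hQ hc v (τ + ω) (hallMul v (fullLocus (Q.contract c hQ hc) p r ⊤) f₁ f₂) =
      hallMul v (heart Q p r c) (muPart hQ hc v τ f₁) (muPart hQ hc v ω f₂) := by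
  refine Subtype.ext (funext fun x => ?_)
  have hτ : ((Nat.card (MinusPts p r c τ.1) : ℕ) : k) ≠ 0 :=
    Nat.cast_ne_zero.2 (card_minusPts_ne_zero τ.1)
  have hω : ((Nat.card (MinusPts p r c ω.1) : ℕ) : k) ≠ 0 :=
    Nat.cast_ne_zero.2 (card_minusPts_ne_zero ω.1)
  have e1 : indFun (heart Q p r c) (muPart hQ hc v τ f₁).1 (muPart hQ hc v ω f₂).1 =
      v⁻¹ ^ ((τ.1.1 (Q.tgt c)) ^ 2 * (Q.minus c).ncard) •
      v⁻¹ ^ ((ω.1.1 (Q.tgt c)) ^ 2 * (Q.minus c).ncard) •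
        indFun (heart Q p r c) (muPull hQ hc v τ f₁).1 (muPull hQ hc v ω f₂).1 := by
    rw [← indFun_smul_right, ← indFun_smul_left]
    rfl
  change v⁻¹ ^ ((τ.1.1 (Q.tgt c) + ω.1.1 (Q.tgt c)) ^ 2 * (Q.minus c).ncard) *
      (v⁻¹ ^ mExp (hatDim hQ hc τ) (hatDim hQ hc ω) *
        ((cardG p r (hatDim hQ hc τ) * cardG p r (hatDim hQ hc ω) : ℕ) : k)⁻¹ *
        indFun (fullLocus (Q.contract c hQ hc) p r ⊤) f₁.1 f₂.1 (contractPts hQ hc x)) =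
    v⁻¹ ^ mExp τ.1 ω.1 * ((cardG p r τ.1 * cardG p r ω.1 : ℕ) : k)⁻¹ *
      indFun (heart Q p r c) (muPart hQ hc v τ f₁).1 (muPart hQ hc v ω f₂).1 x
  -- The cross term `2 τ₋ ω₋` of the square is the difference found in `mExp_eq`.
  have e2 : v⁻¹ ^ ((τ.1.1 (Q.tgt c) + ω.1.1 (Q.tgt c)) ^ 2 * (Q.minus c).ncard) =
      v⁻¹ ^ (2 * (τ.1.1 (Q.tgt c) * ω.1.1 (Q.tgt c)) * (Q.minus c).ncard) *
      v⁻¹ ^ ((τ.1.1 (Q.tgt c)) ^ 2 * (Q.minus c).ncard) *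
      v⁻¹ ^ ((ω.1.1 (Q.tgt c)) ^ 2 * (Q.minus c).ncard) := by
    rw [← pow_add, ← pow_add]
    congr 1
    ring
  rw [e1, Pi.smul_apply, Pi.smul_apply, smul_eq_mul, smul_eq_mul, indFun_muPull,
    cardG_eq hQ hc τ, cardG_eq hQ hc ω, mExp_eq hQ hc τ ω, e2, pow_add, Nat.cast_mul,
    Nat.cast_mul, Nat.cast_mul, Nat.cast_mul, Nat.cast_mul]
  exact mul_cancel_cards hτ hω _ _ _ _ _ _ _

end

/-! ## Restriction and extension by zero on Hall algebras -/

section Loci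

variable {D : AddSubmonoid Q.DimVec} {k : Type*} [Field k]

theorem extZero_injective {ν : Q.DimVec} (X : Set (Rep p ν))
    (hX : ∀ (g : Grp p ν) x, x ∈ X → act g x ∈ X) :
    Function.Injective (extZero (r := r) (k := k) X hX) := by
  intro f f' h
  refine Subtype.ext (funext fun x => ?_)
  rw [← zeroExt_apply f.1, ← zeroExt_apply f'.1, ← zeroExt_extZero X hX, h, zeroExt_extZero]

theorem restr_extZero {ν : Q.DimVec} (X : Set (Rep p ν))
    (hX : ∀ (g : Grp p ν) x, x ∈ X → act g x ∈ X) (f : InvFun r k X) :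
    restr X (extZero X hX f) = f := by
  refine Subtype.ext (funext fun x => ?_)
  exact dif_pos x.2.1

/-- A function that vanishes on `X` is the extension by zero of its own restriction to the
complement. -/
theorem range_extZero_compl {ν : Q.DimVec} (X : Set (Rep p ν))
    (hX : ∀ (g : Grp p ν) x, x ∈ Xᶜ → act g x ∈ Xᶜ) :
    LinearMap.range (extZero (r := r) (k := k) Xᶜ hX) = LinearMap.ker (restr X) := by
  ext f
  rw [LinearMap.mem_range, LinearMap.mem_ker]
  constructor
  · rintro ⟨f, rfl⟩
    refine Subtype.ext (funext fun x => ?_)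
    exact dif_neg fun h => h x.2.1
  · intro h
    refine ⟨restr Xᶜ f, Subtype.ext (funext fun x => ?_)⟩
    by_cases hx : x.1 ∈ X
    · refine (dif_neg fun h' => h' hx).trans ?_
      exact (congrFun (congrArg Subtype.val h) ⟨x.1, hx, x.2.2⟩).symm
    · exact dif_pos hx

theorem iShriek_injective (v : k) (L : Locus Q p r D) : Function.Injective (iShriek v L) :=
  (DirectSum.lmap_injective _).2 fun _ => extZero_injective _ _

theorem jStar_comp_jShriek (v : k) (L : Locus Q p r D) :
    jStar v L ∘ₗ jShriek v L = LinearMap.id := by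
  refine LinearMap.ext fun f => DFinsupp.ext fun ν => ?_
  exact restr_extZero (L.carrier ν) (L.act_mem ν) (f ν)

theorem exact_iShriek_jStar (v : k) (L : Locus Q p r D) :
    Function.Exact (iShriek v L) (jStar v L) := by
  refine LinearMap.exact_iff.2 ((DirectSum.ker_lmap _).trans
    (Eq.trans ?_ (DirectSum.range_lmap _).symm))
  exact congrArg (fun S => Submodule.comap _ (Submodule.pi Set.univ S))
    (funext fun ν => (range_extZero_compl _ _).symm)

/-- In dimension `0` all matrices are empty, hence isomorphisms. Because of this, extension by zero
preserves the unit. -/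
theorem heart_zero : (heart Q p r c).carrier 0 = Set.univ :=
  Set.eq_univ_of_forall fun _ _ _ =>
    ⟨fun i => i.elim0, funext fun i => i.elim0, funext fun i => i.elim0⟩

variable [Fintype I]

theorem jStar_of (v : k) (L : Locus Q p r D) (ν : D) (f : HallPart v (fullLocus Q p r D) ν) :
    jStar v L (DirectSum.of (HallPart v (fullLocus Q p r D)) ν f) =
      DirectSum.of (HallPart v L) ν (restr (L.carrier ν) f) :=
  DirectSum.lmap_of _ _ _

theorem jShriek_of (v : k) (L : Locus Q p r D) (ν : D) (f : HallPart v L ν) :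
    jShriek v L (DirectSum.of (HallPart v L) ν f) =
      DirectSum.of (HallPart v (fullLocus Q p r D)) ν
        (extZero (L.carrier ν) (L.act_mem ν) f) :=
  DirectSum.lmap_of _ _ _

theorem incl_of (v : k) (D : AddSubmonoid Q.DimVec) (ν : D)
    (f : HallPart v (fullLocus Q p r D) ν) :
    incl v D (DirectSum.of (HallPart v (fullLocus Q p r D)) ν f) =
      DirectSum.of (HallPart v (fullLocus Q p r ⊤)) ⟨ν.1, trivial⟩ f :=
  DirectSum.toModule_lof k ν f

/-- Each component is recovered from the image, which gives injectivity; distinct degrees in `D`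
stay distinct in `⊤`. -/
theorem incl_apply (v : k) (D : AddSubmonoid Q.DimVec) (f : Hall v (fullLocus Q p r D)) (ν : D) :
    (incl v D f) ⟨ν.1, trivial⟩ = f ν := by
  induction f using DirectSum.induction_on with
  | zero => rw [map_zero]; rfl
  | add f f' h h' => rw [map_add, DirectSum.add_apply, DirectSum.add_apply, h, h']; rfl
  | of μ f =>
    rw [incl_of]
    by_cases e : μ = ν
    · subst e
      exact (DirectSum.of_eq_same _ _).trans (DirectSum.of_eq_same μ f).symm
    · refine (DirectSum.of_eq_of_ne _ _ _ fun h => e ?_).trans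
        (DirectSum.of_eq_of_ne μ ν f fun h => e h.symm).symm
      exact Subtype.ext (congrArg Subtype.val h).symm

theorem incl_injective (v : k) (D : AddSubmonoid Q.DimVec) :
    Function.Injective (incl (p := p) (r := r) v D) := by
  intro f f' h
  refine DFinsupp.ext fun ν => ?_
  exact (incl_apply v D f ν).symm.trans ((congrArg (fun z => z ⟨ν.1, trivial⟩) h).trans
    (incl_apply v D f' ν))

variable [Fintype Ω] [NeZero r]

theorem hall_of_mul_of {v : k} {L : Locus Q p r D} {τ ω : D} (a : HallPart v L τ)
    (b : HallPart v L ω) :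
    DirectSum.of (HallPart v L) τ a * DirectSum.of (HallPart v L) ω b =
      DirectSum.of (HallPart v L) (τ + ω) (hallMul v L a b) :=
  DirectSum.of_mul_of a b

/-- A linear map on a Hall algebra is multiplicative if it is so on homogeneous elements. -/
theorem hall_map_mul {v : k} {L : Locus Q p r D} {B : Type*} [NonUnitalNonAssocRing B]
    [Module k B] (f : Hall v L →ₗ[k] B)
    (h : ∀ (τ ω : D) (a : HallPart v L τ) (b : HallPart v L ω),
      f (DirectSum.of (HallPart v L) (τ + ω) (hallMul v L a b)) =
        f (DirectSum.of (HallPart v L) τ a) * f (DirectSum.of (HallPart v L) ω b))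
    (x y : Hall v L) : f (x * y) = f x * f y := by
  induction x using DirectSum.induction_on with
  | zero => rw [zero_mul, map_zero, zero_mul]
  | add x x' h h' => rw [add_mul, map_add, map_add, add_mul, h, h']
  | of τ a =>
    induction y using DirectSum.induction_on with
    | zero => rw [mul_zero, map_zero, mul_zero]
    | add x x' h h' => rw [mul_add, map_add, map_add, mul_add, h, h']
    | of ω b =>
      rw [hall_of_mul_of]
      exact h τ ω a b

theorem isHallHom_jStar (v : k) (L : Locus Q p r D) : IsHallHom (jStar v L) where
  map_one := jStar_of v L 0 _
  map_mul := hall_map_mul _ fun τ ω a b => by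
    rw [jStar_of, jStar_of, jStar_of]
    exact (congrArg _ (hallMul_restr v L a b)).trans (hall_of_mul_of _ _).symm

theorem isHallHom_jShriek (v : k) (L : Locus Q p r D) (hL : L.ExtClosed)
    (h0 : L.carrier 0 = Set.univ) : IsHallHom (jShriek v L) where
  map_one := (jShriek_of v L 0 _).trans (congrArg _ (Subtype.ext (funext fun x =>
    dif_pos (h0.symm ▸ Set.mem_univ x.1))))
  map_mul := hall_map_mul _ fun τ ω a b => by
    rw [jShriek_of, jShriek_of, jShriek_of]
    exact (congrArg _ (hallMul_extZero v L hL a b)).trans (hall_of_mul_of _ _).symm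

/-- The carriers of the two full loci coincide in degrees from `D`, and the product of homogeneous
elements involves only their sum and these carriers; the two products agree by definition. -/
theorem isHallHom_incl (v : k) (D : AddSubmonoid Q.DimVec) :
    IsHallHom (incl (p := p) (r := r) v D) where
  map_one := incl_of v D 0 _
  map_mul := hall_map_mul _ fun τ ω a b => by
    rw [incl_of, incl_of, incl_of]
    exact (hall_of_mul_of (L := fullLocus Q p r ⊤) (τ := ⟨τ.1, trivial⟩) (ω := ⟨ω.1, trivial⟩)
      a b).symm

end Loci

/-! ## The contraction isomorphism -/

section

variable {k : Type*} [Field k] (hQ : Q.Admissible) (hc : Q.Contractible c)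

/-- A dimension vector of the contracted quiver is extended along `rho`, which is equivariant and
identifies the two ends of `c`. -/
theorem exists_hatDim_eq [Finite Ω] (μ : (Q.contract c hQ hc).DimVec) :
    ∃ ν : Q.balanced c, hatDim hQ hc ν = μ := by
  have hcc : c ∈ Q.conE c := Equiv.Perm.SameCycle.refl _ _
  refine ⟨⟨⟨fun i => μ.1 (rho hQ hc i), fun i => ?_⟩, ?_⟩, ?_⟩
  · exact (congrArg μ.1 (rho_aV hQ hc i)).trans (μ.2 _)
  · exact congrArg μ.1 (rho_tgt_eq_rho_src hQ hc hcc).symm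
  · exact Subtype.ext (funext fun i => congrArg μ.1 (rho_coe hQ hc i))

/-- Contraction has the section `extRep`, which gives injectivity. Conversely, every rational point
of the heart is conjugate, by a rational element, to the image of its contraction under this
section, so an invariant function is determined by its values there. -/
theorem muPull_bijective [Finite Ω] (v : k) (ν : Q.balanced c) :
    Function.Bijective (muPull (p := p) (r := r) hQ hc v ν) := by
  constructor
  · intro f f' h
    refine Subtype.ext (funext fun x => ?_)
    have e := congrFun (congrArg Subtype.val h)
      ⟨extRep hQ hc x.1, extRep_mem_heart _, extRep_frob x.2.2⟩
    have e' : contractPts hQ hc (r := r)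
        ⟨extRep hQ hc x.1, extRep_mem_heart _, extRep_frob x.2.2⟩ = x :=
      Subtype.ext (contractRep_extRep x.1)
    change f.1 (contractPts hQ hc _) = f'.1 (contractPts hQ hc _) at e
    rwa [e'] at e
  · intro f
    let σ (x : Pts r (Set.univ : Set (Rep p (hatDim hQ hc ν)))) :
        Pts r ((heart Q p r c).carrier ν) :=
      ⟨extRep hQ hc x.1, extRep_mem_heart _, extRep_frob x.2.2⟩
    have key : ∀ z : Pts r ((heart Q p r c).carrier ν), f.1 (σ (contractPts hQ hc z)) = f.1 z := by
      intro z
      obtain ⟨X, -, hFX, hX⟩ := exists_normal_form (hQ := hQ) (hc := hc) z.2.1 z.2.2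
      exact (f.2 X hFX (σ (contractPts hQ hc z)) z hX).symm
    refine ⟨⟨fun x => f.1 (σ x), fun g hg x y hxy => ?_⟩, Subtype.ext (funext key)⟩
    -- For invariance of the preimage, `g` is lifted to a rational element of `G_V` that is trivial
    -- at `[i₋]`. The translate `z` of `σ x` then contracts to `y`, although it need not be equal to
    -- `σ y`; `key` bridges the two.
    let g' := glueGrp hQ hc g 1
    have hg' : frobGrp r g' = g' := frob_glueGrp hQ hc hg frobGrp_one
    have hgg' : hatGrp hQ hc g' = g := funext fun i => glueGrp_of_notMem hQ hc g 1 i.2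
    let z : Pts r ((heart Q p r c).carrier ν) := ⟨act g' (σ x).1,
      (heart Q p r c).act_mem _ _ _ (σ x).2.1, by rw [frobRep_act, hg', (σ x).2.2]⟩
    have hz : contractPts hQ hc z = y := by
      refine Subtype.ext (Eq.trans ?_ hxy.symm)
      exact (contractRep_act hQ hc g' _ (σ x).2.1).trans
        (congrArg₂ act hgg' (contractRep_extRep x.1))
    rw [← hz]
    refine (key z).trans ?_
    exact f.2 g' hg' (σ x) z rfl

theorem muPart_bijective [Finite Ω] {v : k} (hv : v ≠ 0) (ν : Q.balanced c) :
    Function.Bijective (muPart (p := p) (r := r) hQ hc v ν) := by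
  have h := muPull_bijective (p := p) (r := r) hQ hc v ν
  have ha : v⁻¹ ^ ((ν.1.1 (Q.tgt c)) ^ 2 * (Q.minus c).ncard) ≠ 0 := pow_ne_zero _ (inv_ne_zero hv)
  constructor
  · intro f f' e
    exact h.1 (smul_right_injective _ ha e)
  · intro f
    obtain ⟨f', hf'⟩ := h.2 ((v⁻¹ ^ ((ν.1.1 (Q.tgt c)) ^ 2 * (Q.minus c).ncard))⁻¹ • f)
    refine ⟨f', (congrArg _ hf').trans (smul_inv_smul₀ ha f)⟩

theorem muStar_apply (v : k) (f : Hall v (fullLocus (Q.contract c hQ hc) p r ⊤))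
    (ν : Q.balanced c) :
    muStar hQ hc v f ν = muPart hQ hc v ν (f ⟨hatDim hQ hc ν, trivial⟩) := rfl

theorem muStar_of [Fintype I] (v : k) (ν : Q.balanced c)
    (f : HallPart v (fullLocus (Q.contract c hQ hc) p r ⊤) ⟨hatDim hQ hc ν, trivial⟩) :
    muStar hQ hc v (DirectSum.of (HallPart v (fullLocus (Q.contract c hQ hc) p r ⊤))
      ⟨hatDim hQ hc ν, trivial⟩ f) =
      DirectSum.of (HallPart v (heart Q p r c)) ν (muPart hQ hc v ν f) := by
  refine DFinsupp.ext fun μ => ?_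
  refine (muStar_apply hQ hc v _ μ).trans ?_
  by_cases e : μ = ν
  · subst e
    refine (congrArg _ (DirectSum.of_eq_same _ f)).trans (DirectSum.of_eq_same μ _).symm
  · refine (congrArg _ (DirectSum.of_eq_of_ne _ _ _ fun h => e ?_)).trans
      ((map_zero _).trans (DirectSum.of_eq_of_ne _ _ _ e).symm)
    exact hatDim_injective hQ hc (congrArg Subtype.val h)

/-- Every degree of the contracted quiver is `hatDim` of a unique balanced degree, so bijectivity
can be checked on the homogeneous parts. -/
theorem muStar_bijective [Fintype I] [Finite Ω] {v : k} (hv : v ≠ 0) :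
    Function.Bijective (muStar (p := p) (r := r) hQ hc v) := by
  constructor
  · intro f f' h
    refine DFinsupp.ext fun μ => ?_
    obtain ⟨μ, hμ⟩ := μ
    obtain ⟨ν, rfl⟩ := exists_hatDim_eq hQ hc μ
    exact (muPart_bijective hQ hc hv ν).1 (congrArg (fun z => z ν) h)
  · intro f
    induction f using DirectSum.induction_on with
    | zero => exact ⟨0, map_zero _⟩
    | add f f' h h' =>
      obtain ⟨g, rfl⟩ := h
      obtain ⟨g', rfl⟩ := h'
      exact ⟨g + g', map_add _ _ _⟩
    | of ν f =>
      obtain ⟨g, rfl⟩ := (muPart_bijective hQ hc hv ν).2 f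
      exact ⟨_, muStar_of hQ hc v ν g⟩

theorem isHallHom_muStar [Fintype I] [Fintype Ω] [NeZero r] [CharZero k] (v : k) :
    IsHallHom (muStar (p := p) (r := r) hQ hc v) where
  map_one := by
    refine (muStar_of hQ hc v 0 _).trans (congrArg _ (Subtype.ext (funext fun x => ?_)))
    -- In degree `0` the normalizing power of `v` is trivial.
    change v⁻¹ ^ (0 ^ 2 * (Q.minus c).ncard) * 1 = 1
    rw [mul_one, zero_pow two_ne_zero, zero_mul, pow_zero]
  map_mul := hall_map_mul _ fun τ ω a b => by
    obtain ⟨τ, hτ⟩ := τ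
    obtain ⟨ω, hω⟩ := ω
    obtain ⟨τ, rfl⟩ := exists_hatDim_eq hQ hc τ
    obtain ⟨ω, rfl⟩ := exists_hatDim_eq hQ hc ω
    refine (muStar_of hQ hc v (τ + ω) _).trans ?_
    refine Eq.trans ?_ (congrArg₂ (· * ·) (muStar_of hQ hc v τ a).symm
      (muStar_of hQ hc v ω b).symm)
    rw [hall_of_mul_of]
    exact congrArg _ (muPart_hallMul hQ hc v a b)

end

end AutQuiver

end HallContraction

end

/-! ### The main theorem -/

open HallContraction HallContraction.AutQuiver in
theorem mainTheorem2 {I Ω : Type*} [Fintype I] [Fintype Ω] (Q : AutQuiver I Ω)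
    (hQ : Q.Admissible) (c : Ω) (hc : Q.Contractible c) (p r : ℕ) [Fact p.Prime] [NeZero r]
    (v : ℂ) (hv : v ^ 2 = (p : ℂ) ^ r) :
    -- `H_Î` is a subalgebra of `H`
    (IsHallHom (inclI Q c p r v) ∧ Function.Injective (inclI Q c p r v)) ∧
    -- the split short exact sequence `0 → H^c → H_Î → H^♡ → 0` of Hall algebras
    (IsHallHom (jR Q c p r v) ∧ IsHallHom (jE Q c p r v) ∧
      Function.Injective (iC Q c p r v) ∧ Function.Exact (iC Q c p r v) (jR Q c p r v) ∧
      Function.Surjective (jR Q c p r v) ∧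
      jR Q c p r v ∘ₗ jE Q c p r v = LinearMap.id) ∧
    -- the Hall algebra `Ĥ` of the contracted quiver is isomorphic to `H^♡` by `μ^⋆`
    (IsHallHom (muH Q c p r v hQ hc) ∧ Function.Bijective (muH Q c p r v hQ hc)) ∧
    -- `H^c` is a two-sided ideal `J` of `H_Î`
    ∃ J : TwoSidedIdeal (HallI Q c p r v), (J : Set (HallI Q c p r v)) = Set.range (iC Q c p r v) ∧
      -- `Ĥ` is isomorphic to `H_Î / J` as an algebra, by `j_! μ^⋆`
      (∃ e : HallQ (Q.contract c hQ hc) p r v ≃+* J.ringCon.Quotient,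
        (∀ f, e f = ((jE Q c p r v (muH Q c p r v hQ hc f) : HallI Q c p r v) :
          J.ringCon.Quotient)) ∧
        e 1 = ((1 : HallI Q c p r v) : J.ringCon.Quotient) ∧
        ∀ (a : BaseField v) (f : HallQ (Q.contract c hQ hc) p r v) (x : HallI Q c p r v),
          e f = (x : J.ringCon.Quotient) →
          e (a • f) = ((a • x : HallI Q c p r v) : J.ringCon.Quotient)) ∧
      -- the quotient map `H_Î → Ĥ` with kernel `J` is split by an algebra homomorphism
      ∃ π : HallI Q c p r v →ₗ[BaseField v] HallQ (Q.contract c hQ hc) p r v,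
        IsHallHom π ∧ Function.Surjective π ∧ (∀ x, π x = 0 ↔ x ∈ J) ∧
        IsHallHom (jE Q c p r v ∘ₗ muH Q c p r v hQ hc) ∧
        π ∘ₗ (jE Q c p r v ∘ₗ muH Q c p r v hQ hc) = LinearMap.id := by
  -- The square of `v` is the prime power `p ^ r`, so `v` is nonzero; the scalar in `μ^⋆` is
  -- therefore invertible.
  have hv0 : root v ≠ 0 := by
    intro h
    have h0 : v = 0 := congrArg (algebraMap (BaseField v) ℂ) h
    rw [h0, zero_pow two_ne_zero] at hv
    exact pow_ne_zero r (Nat.cast_ne_zero.2 (Fact.out : p.Prime).ne_zero) hv.symm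
  have hjR : IsHallHom (jR Q c p r v) := isHallHom_jStar (root v) (heart Q p r c)
  have hjE : IsHallHom (jE Q c p r v) :=
    isHallHom_jShriek (root v) (heart Q p r c) heart_extClosed heart_zero
  have hid : jR Q c p r v ∘ₗ jE Q c p r v = LinearMap.id :=
    jStar_comp_jShriek (root v) (heart Q p r c)
  have hid' : ∀ f, jR Q c p r v (jE Q c p r v f) = f := fun f => LinearMap.congr_fun hid f
  have hex : Function.Exact (iC Q c p r v) (jR Q c p r v) :=
    exact_iShriek_jStar (root v) (heart Q p r c)
  have hmu : IsHallHom (muH Q c p r v hQ hc) := isHallHom_muStar hQ hc (root v)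
  have hbij : Function.Bijective (muH Q c p r v hQ hc) := muStar_bijective hQ hc hv0
  refine ⟨⟨isHallHom_incl (root v) (Q.balanced c), incl_injective (root v) (Q.balanced c)⟩,
    ⟨hjR, hjE, iShriek_injective (root v) (heart Q p r c), hex, fun f => ⟨_, hid' f⟩, hid⟩,
    ⟨hmu, hbij⟩, ?_⟩
  -- The ideal is taken to be the kernel of `j^*`, so the ideal axioms come for free; exactness
  -- identifies it with the image of `H^c`.
  let φ : HallI Q c p r v →ₙ+* HallHeart Q c p r v :=
    { toFun := jR Q c p r v
      map_mul' := hjR.map_mul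
      map_zero' := map_zero _
      map_add' := map_add _ }
  -- Classes in the quotient are equal exactly when their images under `j^*` are. With `j^* j_! =
  -- id`, this reduces every claim about the quotient to one about `μ^⋆`.
  have hrel : ∀ x y : HallI Q c p r v, ((x : (TwoSidedIdeal.ker φ).ringCon.Quotient) = y) ↔
      jR Q c p r v x = jR Q c p r v y := fun x y =>
    (RingCon.eq _).trans (TwoSidedIdeal.ker_ringCon (f := φ))
  have hcomp : IsHallHom (jE Q c p r v ∘ₗ muH Q c p r v hQ hc) :=
    { map_one := (congrArg _ hmu.map_one).trans hjE.map_one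
      map_mul := fun x y => (congrArg _ (hmu.map_mul x y)).trans (hjE.map_mul _ _) }
  let m := LinearEquiv.ofBijective (muH Q c p r v hQ hc) hbij
  have hm : ∀ f, m f = muH Q c p r v hQ hc f := fun _ => rfl
  -- The retraction `π` is `j^*` followed by the inverse of `μ^⋆`.
  refine ⟨TwoSidedIdeal.ker φ, ?_, ⟨⟨Equiv.ofBijective (fun f =>
      ((jE Q c p r v (muH Q c p r v hQ hc f) : HallI Q c p r v) :
        (TwoSidedIdeal.ker φ).ringCon.Quotient)) ⟨?_, ?_⟩, ?_, ?_⟩, ?_, ?_, ?_⟩,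
    m.symm.toLinearMap ∘ₗ jR Q c p r v, ⟨?_, ?_⟩, ?_, ?_, hcomp, ?_⟩
  · ext x
    exact (TwoSidedIdeal.mem_ker φ).trans (hex x)
  · intro f f' h
    have h' := (hrel _ _).1 h
    rw [hid', hid'] at h'
    exact hbij.1 h'
  · intro y
    induction y using Quotient.inductionOn with
    | h x =>
      -- The class of `x` is hit by the preimage of `j^* x` under `μ^⋆`, because `x` and `j_! j^* x`
      -- have the same restriction.
      obtain ⟨f, hf⟩ := hbij.2 (jR Q c p r v x)
      refine ⟨f, (hrel _ x).2 ?_⟩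
      rw [hid', hf]
  · intro x y
    exact congrArg _ (hcomp.map_mul x y)
  · intro x y
    exact congrArg _ (map_add (jE Q c p r v ∘ₗ muH Q c p r v hQ hc) x y)
  · intro f
    rfl
  · exact congrArg _ hcomp.map_one
  -- Compatibility with scalars is tested on representatives, and follows from linearity of `j^*`,
  -- `j_!` and `μ^⋆`.
  · intro a f x h
    refine (hrel _ _).2 ?_
    have h' := (hrel _ _).1 h
    rw [map_smul, map_smul, map_smul, map_smul, h']
  · change m.symm (jR Q c p r v 1) = 1
    rw [LinearEquiv.symm_apply_eq, hjR.map_one, hm, hmu.map_one]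
  · intro x y
    change m.symm (jR Q c p r v (x * y)) = m.symm (jR Q c p r v x) * m.symm (jR Q c p r v y)
    rw [LinearEquiv.symm_apply_eq, hm, hmu.map_mul, ← hm, ← hm, m.apply_symm_apply,
      m.apply_symm_apply, hjR.map_mul]
  · exact m.symm.surjective.comp fun f => ⟨_, hid' f⟩
  · intro x
    refine Iff.trans ?_ (TwoSidedIdeal.mem_ker φ).symm
    exact m.symm.map_eq_zero_iff
  · refine LinearMap.ext fun f => ?_
    change m.symm (jR Q c p r v (jE Q c p r v (muH Q c p r v hQ hc f))) = f
    rw [hid', LinearEquiv.symm_apply_eq, hm]
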